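/- Let $k\in\{0,-1\}$, $S_0(\chi)=\chi$, $S_{-1}(\chi)=\sinh\chi$, and let $a:[0,\infty)\to[0,\infty)$ be a regular scale factor: $a(0)=0$, $a$ is strictly increasing and continuous on $[0,\infty)$ and $C^2$ on $(0,\infty)$, and $\dot a(t)\neq 0$, $a(t)\ddot a(t)/\dot a(t)^2\le 1$ for all $t>0$. Let $b$ be the inverse function of $a$. Let $\mathcal M$ be the Robertson--Walker spacetime with $t>0$, $\chi\ge 0$ and metric $$ds^2=-dt^2+a^2(t)\left[d\chi^2+S_k^2(\chi)\,(d\theta^2+\sin^2\theta\,d\varphi^2)\right],$$ let $\beta(\tau)$, $\tau>0$, be the comoving observer at $\chi=0$ (at $t=\tau$), and put $\chi_{\rm horiz}(t)=\int_t^\infty ds/a(s)\in(0,\infty]$. For $\tau>0$, $\sigma\ge 1$ define $$t(\tau,\sigma)=b\!\left(\tfrac{a(\tau)}{\sqrt\sigma}\right),\quad \chi(\tau,\sigma)=\frac12\int_1^\sigma \dot b\!\left(\tfrac{a(\tau)}{\sqrt s}\right)\frac{ds}{\sqrt s\sqrt{s-1}},\quad \rho_\tau(\sigma)=\frac{a(\tau)}2\int_1^\sigma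 \dot b\!\left(\tfrac{a(\tau)}{\sqrt s}\right)\frac{ds}{s^{3/2}\sqrt{s-1}},$$ let $\rho_{\mathcal M_\tau}=\lim_{\sigma\to\infty}\rho_\tau(\sigma)$, and let $\sigma_\tau(\rho)$, $0\le\rho<\rho_{\mathcal M_\tau}$, be the inverse function of $\rho_\tau$. For $\tau>0$ and $\rho=\sqrt{x^2+y^2+z^2}<\rho_{\mathcal M_\tau}$ with $(x,y,z)=\rho(\sin\theta\cos\varphi,\sin\theta\sin\varphi,\cos\theta)$, assign the coordinates $(\tau,x,y,z)$ to the point of $\mathcal M$ with cosmological coordinates $t=t(\tau,\sigma_\tau(\rho))$, $\chi=\chi(\tau,\sigma_\tau(\rho))$, $\theta$, $\varphi$; let $\mathcal U_{\rm Fermi}$ be the set of all points obtained in this way. Then: 1. Each point of $\mathcal U_{\rm Fermi}$ has exactly one such quadruple of coordinates, and $\{\partial_\tau,\partial_x,\partial_y,\partial_z\}$ is a parallel orthonormal tetrad along $\beta(\tau)=(\tau,0,0,0)$, with $\partial_\tau=\dot\beta$. 2. $(\{\tau,x,y,z\},\mathcal U_{\rm Fermi})$ is a maximal Fermi coordinate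 chart for $\beta$ with respect to this tetrad. Here a Fermi chart with respect to a tetrad $e_0,\dots,e_3$ along $\beta$ is a coordinate chart on an open neighbourhood of $\beta$ in which $\beta(\tau)$ has coordinates $(\tau,0,0,0)$ and each point $p$ with coordinates $(\tau,\lambda^1,\lambda^2,\lambda^3)$ satisfies $\tau>0$ and $p=\exp_{\beta(\tau)}(\sum_j\lambda^je_j(\tau))$; maximal means that every other Fermi chart with respect to the same tetrad is a restriction of it. The chart is of class $C^{n+1}$ if $a$ is of class $C^{n+2}$ on $(0,\infty)$, for every $0\le n\le\infty$ (and maximality holds among charts of that class). 3. $\mathcal U_{\rm Fermi}=\{p\in\mathcal M: t(p)>0,\ 0\le\chi(p)<\chi_{\rm horiz}(t(p))\}$; in particular $\mathcal U_{\rm Fermi}=\mathcal M$ if $\chi_{\rm horiz}(t_0)=\infty$ for some $t_0>0$. 4. In these coordinates $$\begin{aligned}ds^2=\,&g_{\tau\tau}d\tau^2+dx^2+dy^2+dz^2+\lambda_k(\tau,\rho)\big[(y^2+z^2)dx^2+(x^2+z^2)dy^2+(x^2+y^2)dz^2\\&-xy(dxdy+dydx)-xz(dxdz+dzdx)-yz(dydz+dzdy)\big],\end{aligned}$$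 where, with $\sigma=\sigma_\tau(\rho)$, $$g_{\tau\tau}=-\dot a(\tau)^2\left(\dot b\!\left(\tfrac{a(\tau)}{\sqrt\sigma}\right)+a(\tau)\frac{\sqrt{\sigma-1}}{2\sqrt\sigma}\int_1^\sigma\frac{\ddot b\left(a(\tau)/\sqrt s\right)}{s\sqrt{s-1}}ds\right)^2,\qquad \rho^4\lambda_k(\tau,\rho)=\frac{a^2(\tau)}{\sigma}S_k^2(\chi(\tau,\sigma))-\rho^2 .$$ Moreover $\lambda_k(\tau,\rho)=\Lambda(\tau,\rho^2)$ for a function $\Lambda(\tau,s)$ on $\{\tau>0,\ 0\le s<\rho_{\mathcal M_\tau}^2\}$ that is continuous, and of class $C^n$ whenever $a$ is of class $C^{n+2}$ on $(0,\infty)$, $0\le n\le\infty$ (so smooth if $a$ is smooth). -/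

import Mathlib

open Set MeasureTheory

noncomputable section

namespace RWFermi

/-! ### Semi-Riemannian geometry in a global coordinate system

A metric on (an open subset of) a normed space `V` is written `g p u v`: the value at the point `p`
on the tangent vectors `u`, `v`. -/

/-- The Christoffel symbols of the first kind, as a trilinear expression:
`Γ(u, v; w) = (∂_u g(v, w) + ∂_v g(u, w) - ∂_w g(u, v)) / 2`. -/
def christoffel {V : Type*} [NormedAddCommGroup V] [NormedSpace ℝ V]
    (g : V → V → V → ℝ) (p u v w : V) : ℝ :=
  (fderiv ℝ (fun q => g q v w) p u + fderiv ℝ (fun q => g q u w) p v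
    - fderiv ℝ (fun q => g q u v) p w) / 2

/-- `q = exp_p v`: some geodesic `γ : [0, 1] → M` of `g` has `γ 0 = p`, `γ' 0 = v` and `γ 1 = q`.
The geodesic equation `∇_{γ'} γ' = 0` is written with the free index lowered by `g`. -/
def IsExp {V : Type*} [NormedAddCommGroup V] [NormedSpace ℝ V]
    (g : V → V → V → ℝ) (M : Set V) (p v q : V) : Prop :=
  ∃ γ γ' γ'' : ℝ → V,
    (∀ s ∈ Icc (0 : ℝ) 1, γ s ∈ M ∧
      HasDerivWithinAt γ (γ' s) (Icc 0 1) s ∧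
      HasDerivWithinAt γ' (γ'' s) (Icc 0 1) s ∧
      ∀ w, g (γ s) (γ'' s) w + christoffel g (γ s) (γ' s) (γ' s) w = 0) ∧
    γ 0 = p ∧ γ' 0 = v ∧ γ 1 = q

/-- `e 0, e 1, e 2, e 3` is a parallel orthonormal tetrad along the curve `β` on the parameter
set `I`, and `e 0` is the four-velocity of `β`. The equation `∇_{β'} e i = 0` is written with the
free index lowered by `g`. -/
structure IsParallelTetrad {V : Type*} [NormedAddCommGroup V] [NormedSpace ℝ V]
    (g : V → V → V → ℝ) (I : Set ℝ) (β : ℝ → V) (e : Fin 4 → ℝ → V) : Prop where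
  velocity : ∀ τ ∈ I, HasDerivAt β (e 0 τ) τ
  orthonormal : ∀ τ ∈ I, ∀ i j,
    g (β τ) (e i τ) (e j τ) = if i = j then (if i = 0 then -1 else 1) else 0
  parallel : ∀ τ ∈ I, ∀ i, ∃ e' : V, HasDerivAt (e i) e' τ ∧
    ∀ w, g (β τ) e' w + christoffel g (β τ) (e 0 τ) (e i τ) w = 0

/-- The coordinate space with coordinates `(x⁰, (x¹, x², x³))`. -/
abbrev R4 : Type := ℝ × EuclideanSpace ℝ (Fin 3)

/-- `(φ, U)` is a Fermi coordinate chart of class `C^n` for the curve `β : I → M` relative to the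
tetrad `e`: a coordinate chart of `M` on an open neighbourhood `U` of `β` in which `β τ` has
coordinates `(τ, 0, 0, 0)`, and in which the coordinates `(τ, λ)` of any point `p` of `U` satisfy
`p = exp_{β τ} (∑ j, λʲ e_j(τ))`. -/
structure IsFermiChart (n : WithTop ℕ∞) (g : R4 → R4 → R4 → ℝ) (M : Set R4) (I : Set ℝ)
    (β : ℝ → R4) (e : Fin 4 → ℝ → R4) (U : Set R4) (φ : R4 → R4) : Prop where
  subset : U ⊆ M
  isOpen : IsOpen U
  isOpen_image : IsOpen (φ '' U)
  contDiffOn : ContDiffOn ℝ n φ U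
  contDiffOn_inverse : ∃ ψ : R4 → R4, ContDiffOn ℝ n ψ (φ '' U) ∧ ∀ p ∈ U, ψ (φ p) = p
  along : ∀ τ ∈ I, β τ ∈ U ∧ φ (β τ) = (τ, 0)
  exp_eq : ∀ p ∈ U, (φ p).1 ∈ I ∧
    IsExp g M (β (φ p).1) (∑ j : Fin 3, (φ p).2 j • e j.succ (φ p).1) p

/-- A maximal Fermi chart: every Fermi chart for the same curve and tetrad is a restriction of
it. -/
def IsMaximalFermiChart (n : WithTop ℕ∞) (g : R4 → R4 → R4 → ℝ) (M : Set R4) (I : Set ℝ)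
    (β : ℝ → R4) (e : Fin 4 → ℝ → R4) (U : Set R4) (φ : R4 → R4) : Prop :=
  IsFermiChart n g M I β e U φ ∧
    ∀ (U' : Set R4) (φ' : R4 → R4), IsFermiChart n g M I β e U' φ' → U' ⊆ U ∧ EqOn φ' φ U'

/-! ### Robertson–Walker spacetimes -/

/-- Regular scale factors. -/
structure IsRegular (a : ℝ → ℝ) : Prop where
  zero : a 0 = 0
  strictMonoOn : StrictMonoOn a (Ici 0)
  continuousOn : ContinuousOn a (Ici 0)
  contDiffOn : ContDiffOn ℝ 2 a (Ioi 0)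
  deriv_ne_zero : ∀ t, 0 < t → deriv a t ≠ 0
  bound : ∀ t, 0 < t → a t * deriv (deriv a) t / (deriv a t) ^ 2 ≤ 1

/-- The function `S_k`, for `k = 1, 0, -1`. -/
def Sk (k : ℤ) (χ : ℝ) : ℝ :=
  if k = 1 then Real.sin χ else if k = 0 then χ else Real.sinh χ

/-- The underlying manifold for `k = 0, -1`: points `(t, X)` with `t > 0` and `X = χ ω`, where
`χ = ‖X‖` is the radial coordinate and
`ω = (sin θ cos φ, sin θ sin φ, cos θ)` is the unit vector with angular coordinates `θ, φ`. -/
def spacetime : Set R4 := {p | 0 < p.1}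

/-- The form `dχ` at `X = χ ω`. -/
def dChi (X v : EuclideanSpace ℝ (Fin 3)) : ℝ := inner ℝ X v / ‖X‖

/-- The form `dΩ² = dθ² + sin² θ dφ²` at `X = χ ω`, i.e. the squared length of `dω`. -/
def dOmegaSq (X v w : EuclideanSpace ℝ (Fin 3)) : ℝ :=
  (inner ℝ v w - dChi X v * dChi X w) / ‖X‖ ^ 2

open Classical in
/-- The spatial metric `dχ² + S_k(χ)² dΩ²`, with its smooth extension to `χ = 0`. -/
def spatialMetric (k : ℤ) (X v w : EuclideanSpace ℝ (Fin 3)) : ℝ :=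
  if X = 0 then inner ℝ v w
  else dChi X v * dChi X w + Sk k ‖X‖ ^ 2 * dOmegaSq X v w

/-- The Robertson–Walker metric `-dt² + a(t)² (dχ² + S_k(χ)² dΩ²)`. -/
def rwMetric (k : ℤ) (a : ℝ → ℝ) (p u v : R4) : ℝ :=
  -(u.1 * v.1) + a p.1 ^ 2 * spatialMetric k p.2 u.2 v.2

/-- The comoving observer at `χ = 0`. -/
def comoving (τ : ℝ) : R4 := (τ, 0)

/-- `χ_horiz(t) = ∫_t^∞ ds / a(s)`, possibly infinite. -/
def chiHoriz (a : ℝ → ℝ) (t : ℝ) : ENNReal :=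
  ∫⁻ s in Ioi t, ENNReal.ofReal (1 / a s)

/-! ### Fermi coordinates of the comoving observer -/

/-- The inverse function `b` of the scale factor. -/
def scaleInv (a : ℝ → ℝ) : ℝ → ℝ := Function.invFunOn a (Ici 0)

/-- `t(τ, σ)`. -/
def tOf (a : ℝ → ℝ) (τ σ : ℝ) : ℝ := scaleInv a (a τ / √σ)

/-- `χ(τ, σ)`. -/
def chiOf (a : ℝ → ℝ) (τ σ : ℝ) : ℝ :=
  1 / 2 * ∫ s in (1 : ℝ)..σ, deriv (scaleInv a) (a τ / √s) * (1 / (√s * √(s - 1)))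

/-- The proper length `ρ_τ(σ)`. -/
def rhoOf (a : ℝ → ℝ) (τ σ : ℝ) : ℝ :=
  a τ / 2 * ∫ s in (1 : ℝ)..σ,
    deriv (scaleInv a) (a τ / √s) * (1 / (s ^ (3 / 2 : ℝ) * √(s - 1)))

/-- The proper radius of the Fermi space slice at proper time `τ`. -/
def radius (a : ℝ → ℝ) (τ : ℝ) : ℝ :=
  a τ / 2 * ∫ s in Ioi (1 : ℝ),
    deriv (scaleInv a) (a τ / √s) * (1 / (s ^ (3 / 2 : ℝ) * √(s - 1)))

/-- `σ_τ(ρ)`, the inverse function of `σ ↦ ρ_τ(σ)` on `[1, ∞)`. -/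
def sigmaOf (a : ℝ → ℝ) (τ ρ : ℝ) : ℝ := Function.invFunOn (rhoOf a τ) (Ici 1) ρ

/-- The set of coordinate values `(τ, (x, y, z))` with `τ > 0` and
`ρ = √(x² + y² + z²) < radius a τ`. -/
def fermiRange (a : ℝ → ℝ) : Set R4 := {q | 0 < q.1 ∧ ‖q.2‖ < radius a q.1}

/-- The point with coordinates `(τ, (x, y, z)) = (τ, ρ ω)`: its cosmological coordinates are
`t(τ, σ_τ(ρ))`, `χ(τ, σ_τ(ρ))` and the same direction `ω`. -/
def fermiPoint (a : ℝ → ℝ) (q : R4) : R4 :=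
  (tOf a q.1 (sigmaOf a q.1 ‖q.2‖), (chiOf a q.1 (sigmaOf a q.1 ‖q.2‖) / ‖q.2‖) • q.2)

/-- The set of spacetime points that have coordinates `(τ, (x, y, z))` with `τ > 0` and
`ρ < radius a τ`. -/
def fermiDomain (a : ℝ → ℝ) : Set R4 := fermiPoint a '' fermiRange a

/-- The coordinate map `p ↦ (τ(p), (x(p), y(p), z(p)))` on `fermiDomain a`. -/
def fermiCoord (a : ℝ → ℝ) : R4 → R4 := Function.invFunOn (fermiPoint a) (fermiRange a)

/-- The coordinate vector fields `∂/∂τ, ∂/∂x, ∂/∂y, ∂/∂z` along `β(τ) = (τ, 0, 0, 0)`. -/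
def fermiFrame (a : ℝ → ℝ) (i : Fin 4) (τ : ℝ) : R4 :=
  fderiv ℝ (fermiPoint a) (τ, 0)
    (Fin.cases ((1, 0) : R4) (fun j : Fin 3 => ((0, EuclideanSpace.single j 1) : R4)) i)

/-- The coefficient `g_ττ(τ, ρ)`. -/
def gTauTau (a : ℝ → ℝ) (τ ρ : ℝ) : ℝ :=
  let σ : ℝ := sigmaOf a τ ρ;
  -(deriv a τ) ^ 2 *
    (deriv (scaleInv a) (a τ / √σ) + a τ * (√(σ - 1) / (2 * √σ)) *
      ∫ s in (1 : ℝ)..σ, deriv (deriv (scaleInv a)) (a τ / √s) / (s * √(s - 1))) ^ 2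

/-- The line element
`g_ττ dτ² + dx² + dy² + dz² + l [(y² + z²) dx² + (x² + z²) dy² + (x² + y²) dz²`
`  - xy (dx dy + dy dx) - xz (dx dz + dz dx) - yz (dy dz + dz dy)]`
at the coordinate vector `(x, y, z) = X`, as a bilinear form. -/
def fermiLineElement (gtt l : ℝ) (X : EuclideanSpace ℝ (Fin 3)) (u v : R4) : ℝ :=
  gtt * (u.1 * v.1) + u.2 0 * v.2 0 + u.2 1 * v.2 1 + u.2 2 * v.2 2
    + l * ((X 1 ^ 2 + X 2 ^ 2) * (u.2 0 * v.2 0) + (X 0 ^ 2 + X 2 ^ 2) * (u.2 1 * v.2 1)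
      + (X 0 ^ 2 + X 1 ^ 2) * (u.2 2 * v.2 2)
      - X 0 * X 1 * (u.2 0 * v.2 1 + u.2 1 * v.2 0)
      - X 0 * X 2 * (u.2 0 * v.2 2 + u.2 2 * v.2 0)
      - X 1 * X 2 * (u.2 1 * v.2 2 + u.2 2 * v.2 1))

end RWFermi

end

noncomputable section

namespace RWFermi

open Filter Topology
open scoped ContDiff

/-! ### The inverse function theorem for maps with injective derivatives -/

section InverseFunction

variable {E : Type*} [NormedAddCommGroup E] [NormedSpace ℝ E] [FiniteDimensional ℝ E]

/-! A spacelike geodesic leaving `β(τ)` orthogonally stays on a fixed ray, and its motion is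
governed by two first integrals, the momentum `a² χ' = a(τ) ρ` and the squared length `-t'² + a² χ'²
= ρ²`. In the variable `y = √(1 - (a(t)/a(τ))²) = √(1 - 1/σ)` they become `dρ = a(τ) b' dy` and `dχ
= b'/(1 - y²) dy`, with `b'` taken at `a(τ) √(1 - y²)`. Hence `ρ = y P(τ, y²)` and `χ = y G(τ, y²)`,
where `P` and `G` (`rhoRatio`, `chiRatio`) are integrals over `[0, 1]` of kernels that are regular
across `y = 0`.

The work is therefore done in the auxiliary chart `(τ, y ω)`, mapped by `auxToFermi` and
`auxToCosmo` to the two coordinate systems. Regularity comes from the inverse function theorem once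
both derivatives are injective. For `auxToFermi` this is `∂ρ/∂y > 0`. For `auxToCosmo` it rests on
the positivity of `b' + a r K`, where `r = y²` and `K` is `accRatio`: this is the factor whose
square appears in `g_ττ`. `rateFun_add_pos` writes it as `(1 - r) b'` plus `r` times an average of
`(x b'(x))'`, and the hypothesis `a ä / ȧ² ≤ 1` says exactly that `(x b'(x))' ≥ 0`. Up to a positive
factor the same quantity is the `τ`-derivative of `χ²` at fixed `t` (`hasDerivAt_chiSq`), so an
event lies on at most one slice.

For the domain, fix `t`; then `χ` grows with `τ`. Slices are spacelike, so `χ ≥ ∫_t^τ ds/a`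
(`neg_conformal_le_chiAt`). Conversely, monotonicity of the Hubble parameter bounds `χ` strictly by
`∫_t^T ds/a` for some `T` (`chiAt_lt_conformal`). The values attained are thus exactly those below
the horizon.

For maximality, the components of a geodesic transverse to its initial direction solve a homogeneous
linear equation with zero data (`geodesic_radial`), and the first integrals then determine the
endpoint (`radial_motion`). So the exponential condition alone forces the coordinates of a point.

For the line element, `rhoRatio_add` and `chiRatio_add` eliminate the radial derivatives of `P` and
`G`, and the pull-back becomes algebra. The numerator of `λ_k` vanishes at `y = 0`, so Hadamard's
lemma divides it by `y²` at the cost of one derivative. -/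

theorem exists_equiv_of_injective (L : E →L[ℝ] E) (hL : ∀ v, L v = 0 → v = 0) :
    ∃ L' : E ≃L[ℝ] E, (L' : E →L[ℝ] E) = L := by
  have hinj : Function.Injective (L : E →ₗ[ℝ] E) :=
    (injective_iff_map_eq_zero (L : E →ₗ[ℝ] E)).2 hL
  refine ⟨(LinearEquiv.ofInjectiveEndo (L : E →ₗ[ℝ] E) hinj).toContinuousLinearEquiv, ?_⟩
  ext v
  simp

/-- In finite dimensions an injective derivative is an isomorphism, so the inverse function theorem
applies. A trivial kernel is the form in which the coordinate maps below can be checked. -/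
theorem exists_contDiffAt_localInverse {n : WithTop ℕ∞} (hn : n ≠ 0) {f : E → E} {x : E}
    (hf : ContDiffAt ℝ n f x) (hker : ∀ v, fderiv ℝ f x v = 0 → v = 0) :
    ∃ g : E → E, ContDiffAt ℝ n g (f x) ∧ g (f x) = x ∧ (∀ᶠ z in 𝓝 (f x), f (g z) = z) ∧
      (∀ᶠ y in 𝓝 x, g (f y) = y) ∧ map f (𝓝 x) = 𝓝 (f x) := by
  have : CompleteSpace E := FiniteDimensional.complete ℝ E
  obtain ⟨L, hL⟩ := exists_equiv_of_injective _ hker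
  have hd : HasFDerivAt f (L : E →L[ℝ] E) x := by
    rw [hL]; exact (hf.differentiableAt hn).hasFDerivAt
  have hs := hf.hasStrictFDerivAt' hd hn
  exact ⟨hf.localInverse hd hn, hf.to_localInverse hd hn, hf.localInverse_apply_image hd hn,
    hs.eventually_right_inverse, hs.eventually_left_inverse, hs.map_nhds_eq_of_equiv⟩

theorem isOpen_image_of_fderiv_injective {n : WithTop ℕ∞} (hn : n ≠ 0) {f : E → E} {D : Set E}
    (hD : IsOpen D) (hf : ContDiffOn ℝ n f D)
    (hker : ∀ x ∈ D, ∀ v, fderiv ℝ f x v = 0 → v = 0) : IsOpen (f '' D) := by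
  rw [isOpen_iff_mem_nhds]
  rintro _ ⟨x, hx, rfl⟩
  obtain ⟨g, -, -, -, -, hmap⟩ := exists_contDiffAt_localInverse hn
    (hf.contDiffAt (hD.mem_nhds hx)) (hker x hx)
  rw [← hmap]
  exact image_mem_map (hD.mem_nhds hx)

/-- A global left inverse `g` agrees near `f x` with the local inverse `g'`, since `g z = g (f (g'
z)) = g' z`, and so inherits its regularity. This serves inverses built with `Function.invFunOn`,
known only through their left inverse property. -/
theorem contDiffOn_leftInverse {n : WithTop ℕ∞} (hn : n ≠ 0) {f g : E → E} {D : Set E}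
    (hD : IsOpen D) (hf : ContDiffOn ℝ n f D)
    (hker : ∀ x ∈ D, ∀ v, fderiv ℝ f x v = 0 → v = 0) (hg : ∀ x ∈ D, g (f x) = x) :
    ContDiffOn ℝ n g (f '' D) := by
  rintro _ ⟨x, hx, rfl⟩
  obtain ⟨g', hg', hgx, hr, -, hmap⟩ := exists_contDiffAt_localInverse hn
    (hf.contDiffAt (hD.mem_nhds hx)) (hker x hx)
  refine (hg'.congr_of_eventuallyEq ?_).contDiffWithinAt
  have hD' : ∀ᶠ z in 𝓝 (f x), g' z ∈ D :=
    hg'.continuousAt.eventually (by rw [hgx]; exact hD.mem_nhds hx)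
  filter_upwards [hr, hD'] with z hz hzD
  rw [← hg _ hzD, hz]

end InverseFunction

/-! ### Integrals over `[0, 1]` depending on parameters -/

section Parametric

set_option linter.unusedSectionVars false

universe u

variable {E G : Type u} [NormedAddCommGroup E] [NormedSpace ℝ E]
  [NormedAddCommGroup G] [NormedSpace ℝ G]

/-- The parameters for which the whole segment `[0, 1]` lies in the slice of `Ω`. -/
def slab (Ω : Set (E × ℝ)) : Set E := {x | ∀ s ∈ Icc (0 : ℝ) 1, (x, s) ∈ Ω}

/-- The tube lemma over the compact segment; it turns a condition on one slice into a condition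
uniform near the parameter. -/
theorem slab_tube {Ω : Set (E × ℝ)} (hΩ : IsOpen Ω) {x : E} (hx : x ∈ slab Ω) :
    ∃ u, IsOpen u ∧ x ∈ u ∧ ∀ y ∈ u, ∀ s ∈ Icc (0 : ℝ) 1, (y, s) ∈ Ω := by
  obtain ⟨u, v, hu, -, hxu, hv, huv⟩ := generalized_tube_lemma (isCompact_singleton (x := x))
    (isCompact_Icc (a := (0 : ℝ)) (b := 1)) hΩ (by rintro ⟨y, s⟩ ⟨rfl, hs⟩; exact hx s hs)
  exact ⟨u, hu, hxu rfl, fun y hy s hs => huv ⟨hy, hv hs⟩⟩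

theorem isOpen_slab {Ω : Set (E × ℝ)} (hΩ : IsOpen Ω) : IsOpen (slab Ω) := by
  rw [isOpen_iff_mem_nhds]
  intro x hx
  obtain ⟨u, hu, hxu, h⟩ := slab_tube hΩ hx
  exact mem_of_superset (hu.mem_nhds hxu) h

/-- Continuity bounds `F` on the compact slice, and staying below that bound plus one is an open
condition. The constant is the dominating function in the limits and derivatives under the integral
sign below. -/
theorem slab_bound {Ω : Set (E × ℝ)} (hΩ : IsOpen Ω) {F : E × ℝ → G} (hF : ContinuousOn F Ω)
    {x : E} (hx : x ∈ slab Ω) :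
    ∃ C : ℝ, ∃ u, IsOpen u ∧ x ∈ u ∧ u ⊆ slab Ω ∧ ∀ y ∈ u, ∀ s ∈ Icc (0 : ℝ) 1, ‖F (y, s)‖ ≤ C := by
  have hc : ContinuousOn (fun s : ℝ => F (x, s)) (Icc 0 1) :=
    hF.comp (by fun_prop) (fun s hs => hx s hs)
  obtain ⟨C, hC⟩ := isCompact_Icc.exists_bound_of_continuousOn hc
  have hopen : IsOpen (Ω ∩ (fun z => ‖F z‖) ⁻¹' Iio (C + 1)) :=
    hF.norm.isOpen_inter_preimage hΩ isOpen_Iio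
  obtain ⟨u, hu, hxu, h⟩ := slab_tube hopen (x := x)
    (fun s hs => ⟨hx s hs, lt_of_le_of_lt (hC s hs) (lt_add_one C)⟩)
  exact ⟨C + 1, u, hu, hxu, fun y hy s hs => (h y hy s hs).1,
    fun y hy s hs => le_of_lt (h y hy s hs).2⟩

theorem uIoc_unit_subset : uIoc (0 : ℝ) 1 ⊆ Icc 0 1 := by
  rw [uIoc_of_le zero_le_one]; exact Ioc_subset_Icc_self

theorem slice_continuousOn {Ω : Set (E × ℝ)} {F : E × ℝ → G} (hF : ContinuousOn F Ω)
    {x : E} (hx : x ∈ slab Ω) : ContinuousOn (fun s : ℝ => F (x, s)) (Icc 0 1) :=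
  hF.comp (by fun_prop) (fun s hs => hx s hs)

theorem slice_intervalIntegrable {Ω : Set (E × ℝ)} {F : E × ℝ → G} (hF : ContinuousOn F Ω)
    {x : E} (hx : x ∈ slab Ω) : IntervalIntegrable (fun s : ℝ => F (x, s)) volume 0 1 :=
  ContinuousOn.intervalIntegrable (by
    rw [uIcc_of_le zero_le_one]; exact slice_continuousOn hF hx)

theorem slice_aestronglyMeasurable {Ω : Set (E × ℝ)} {F : E × ℝ → G} (hF : ContinuousOn F Ω)
    {x : E} (hx : x ∈ slab Ω) :
    AEStronglyMeasurable (fun s : ℝ => F (x, s)) (volume.restrict (uIoc (0 : ℝ) 1)) :=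
  ((slice_continuousOn hF hx).mono uIoc_unit_subset).aestronglyMeasurable measurableSet_uIoc

theorem continuousOn_integral_unit {Ω : Set (E × ℝ)} (hΩ : IsOpen Ω) {F : E × ℝ → G}
    (hF : ContinuousOn F Ω) : ContinuousOn (fun x => ∫ s in (0 : ℝ)..1, F (x, s)) (slab Ω) := by
  intro x hx
  obtain ⟨C, u, hu, hxu, huΩ, hC⟩ := slab_bound hΩ hF hx
  refine ContinuousAt.continuousWithinAt ?_
  refine intervalIntegral.continuousAt_of_dominated_interval (bound := fun _ => C) ?_ ?_
    intervalIntegrable_const ?_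
  · filter_upwards [hu.mem_nhds hxu] with y hy
    exact slice_aestronglyMeasurable hF (huΩ hy)
  · filter_upwards [hu.mem_nhds hxu] with y hy
    exact Eventually.of_forall fun s hs => hC y hy s (uIoc_unit_subset hs)
  · refine Eventually.of_forall fun s hs => ?_
    have h1 : ContinuousAt F (x, s) := hF.continuousAt (hΩ.mem_nhds (hx s (uIoc_unit_subset hs)))
    exact ContinuousAt.comp (f := fun y : E => (y, s)) h1 (by fun_prop)

theorem hasFDerivAt_integral_unit {Ω : Set (E × ℝ)} (hΩ : IsOpen Ω) {F : E × ℝ → G}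
    (hF : ContDiffOn ℝ 1 F Ω) {x : E} (hx : x ∈ slab Ω) :
    HasFDerivAt (fun x => ∫ s in (0 : ℝ)..1, F (x, s))
      (∫ s in (0 : ℝ)..1, (fderiv ℝ F (x, s)).comp (ContinuousLinearMap.inl ℝ E ℝ)) x := by
  have hF' : ContinuousOn (fun z => (fderiv ℝ F z).comp (ContinuousLinearMap.inl ℝ E ℝ)) Ω :=
    (hF.continuousOn_fderiv_of_isOpen hΩ le_rfl).clm_comp continuousOn_const
  obtain ⟨C, u, hu, hxu, huΩ, hC⟩ := slab_bound hΩ hF' hx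
  refine intervalIntegral.hasFDerivAt_integral_of_dominated_of_fderiv_le
    (F := fun x s => F (x, s))
    (F' := fun x s => (fderiv ℝ F (x, s)).comp (ContinuousLinearMap.inl ℝ E ℝ))
    (bound := fun _ => C) (hu.mem_nhds hxu) ?_ (slice_intervalIntegrable hF.continuousOn hx)
    (slice_aestronglyMeasurable hF' hx) ?_ intervalIntegrable_const ?_
  · filter_upwards [hu.mem_nhds hxu] with y hy
    exact slice_aestronglyMeasurable hF.continuousOn (huΩ hy)
  · exact Eventually.of_forall fun s hs y hy => hC y hy s (uIoc_unit_subset hs)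
  · refine Eventually.of_forall fun s hs y hy => ?_
    have h1 : HasFDerivAt F (fderiv ℝ F (y, s)) (y, s) :=
      ((hF.contDiffAt (hΩ.mem_nhds (huΩ hy s (uIoc_unit_subset hs)))).differentiableAt
        one_ne_zero).hasFDerivAt
    exact h1.comp y (hasFDerivAt_prodMk_left y s)

/-- The derivative of the integral is an integral of the same kind, with values in `E →L[ℝ] G`. This
is why `G` is quantified inside the induction and shares the universe of `E`. -/
theorem contDiffOn_integral_unit_nat {E : Type u} [NormedAddCommGroup E] [NormedSpace ℝ E]
    {Ω : Set (E × ℝ)} (hΩ : IsOpen Ω) (n : ℕ) :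
    ∀ {G : Type u} [NormedAddCommGroup G] [NormedSpace ℝ G] {F : E × ℝ → G},
      ContDiffOn ℝ n F Ω → ContDiffOn ℝ n (fun x => ∫ s in (0 : ℝ)..1, F (x, s)) (slab Ω) := by
  induction n with
  | zero =>
    intro G _ _ F hF
    simp only [Nat.cast_zero, contDiffOn_zero] at hF ⊢
    exact continuousOn_integral_unit hΩ hF
  | succ n ih =>
    intro G _ _ F hF
    have hF1 : ContDiffOn ℝ 1 F Ω := hF.of_le (by exact_mod_cast Nat.le_add_left 1 n)
    rw [Nat.cast_succ, contDiffOn_succ_iff_fderiv_of_isOpen (isOpen_slab hΩ)]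
    refine ⟨fun x hx =>
      (hasFDerivAt_integral_unit hΩ hF1 hx).differentiableAt.differentiableWithinAt,
      by simp, ?_⟩
    have hF' : ContDiffOn ℝ n (fun z => (fderiv ℝ F z).comp (ContinuousLinearMap.inl ℝ E ℝ)) Ω :=
      (hF.fderiv_of_isOpen hΩ (by norm_cast)).clm_comp contDiffOn_const
    exact (ih hF').congr fun x hx => (hasFDerivAt_integral_unit hΩ hF1 hx).fderiv

theorem contDiffOn_integral_unit {Ω : Set (E × ℝ)} (hΩ : IsOpen Ω) {n : ℕ∞} {F : E × ℝ → G}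
    (hF : ContDiffOn ℝ n F Ω) :
    ContDiffOn ℝ n (fun x => ∫ s in (0 : ℝ)..1, F (x, s)) (slab Ω) := by
  induction n using ENat.recTopCoe with
  | top =>
    exact contDiffOn_infty.2 fun m => contDiffOn_integral_unit_nat hΩ m (contDiffOn_infty.1 hF m)
  | coe m => exact contDiffOn_integral_unit_nat hΩ m hF

end Parametric

/-! ### Division by a coordinate -/

/-- The quotient `(N (τ, r) - N (τ, 0)) / r`, extended across `r = 0`. -/
def divSnd (N : ℝ × ℝ → ℝ) (x : ℝ × ℝ) : ℝ :=
  ∫ u in (0 : ℝ)..1, fderiv ℝ N (x.1, u * x.2) (0, 1)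

section Hadamard

variable {N : ℝ × ℝ → ℝ} {W : Set (ℝ × ℝ)}

/-- Hadamard's lemma: the quotient is an average of the derivative of `N`, so one derivative is
lost. Star-shapedness in the second variable keeps the averaging segment inside `W`. -/
theorem contDiffOn_divSnd (hW : IsOpen W)
    (hstar : ∀ x ∈ W, ∀ u ∈ Icc (0 : ℝ) 1, (x.1, u * x.2) ∈ W) {n : ℕ∞}
    (hN : ContDiffOn ℝ (n + 1) N W) : ContDiffOn ℝ n (divSnd N) W := by
  have hN' : ContDiffOn ℝ n (fun x => fderiv ℝ N x (0, 1)) W :=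
    (hN.fderiv_of_isOpen hW le_rfl).clm_apply contDiffOn_const
  let h : (ℝ × ℝ) × ℝ → ℝ × ℝ := fun z => (z.1.1, z.2 * z.1.2)
  have hh : ContDiff ℝ n h := by fun_prop
  have hΩ : IsOpen (h ⁻¹' W) := hW.preimage hh.continuous
  exact (contDiffOn_integral_unit hΩ (hN'.comp hh.contDiffOn (fun z hz => hz))).mono
    fun x hx u hu => hstar x hx u hu

theorem mul_divSnd (hW : IsOpen W)
    (hstar : ∀ x ∈ W, ∀ u ∈ Icc (0 : ℝ) 1, (x.1, u * x.2) ∈ W)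
    (hN : ContDiffOn ℝ 1 N W) {x : ℝ × ℝ} (hx : x ∈ W) :
    x.2 * divSnd N x = N x - N (x.1, 0) := by
  have hd : ∀ u ∈ uIcc (0 : ℝ) 1, HasDerivAt (fun u : ℝ => N (x.1, u * x.2))
      (x.2 * fderiv ℝ N (x.1, u * x.2) (0, 1)) u := by
    intro u hu
    rw [uIcc_of_le zero_le_one] at hu
    have h1 : HasFDerivAt N (fderiv ℝ N (x.1, u * x.2)) (x.1, u * x.2) :=
      ((hN.contDiffAt (hW.mem_nhds (hstar x hx u hu))).differentiableAt one_ne_zero).hasFDerivAt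
    have h2 : HasDerivAt (fun u : ℝ => (x.1, u * x.2)) ((0 : ℝ), x.2) u :=
      (hasDerivAt_const u x.1).prodMk (by simpa using (hasDerivAt_id u).mul_const x.2)
    have h3 := h1.comp_hasDerivAt u h2
    have h4 : ((0 : ℝ), x.2) = x.2 • ((0 : ℝ), (1 : ℝ)) := by simp
    rw [h4, map_smul, smul_eq_mul] at h3
    exact h3
  have hc : ContinuousOn (fun u : ℝ => x.2 * fderiv ℝ N (x.1, u * x.2) (0, 1)) (uIcc 0 1) := by
    rw [uIcc_of_le zero_le_one]
    refine continuousOn_const.mul (ContinuousOn.clm_apply ?_ continuousOn_const)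
    exact (hN.continuousOn_fderiv_of_isOpen hW le_rfl).comp (by fun_prop)
      (fun u hu => hstar x hx u hu)
  have := intervalIntegral.integral_eq_sub_of_hasDerivAt hd hc.intervalIntegrable
  rw [intervalIntegral.integral_const_mul] at this
  simpa [divSnd] using this

end Hadamard

/-! ### The spatial metric in Cartesian coordinates -/

/-- The odd series of `sinh` is `χ` times a power series in `χ²`, of infinite radius by the ratio
test. Evenness is the point: `sinh² χ` becomes a smooth function of `‖X‖²`, also across `X = 0`. -/
theorem exists_sinh_eq_mul_entire :
    ∃ e : ℝ → ℝ, ContDiff ℝ ∞ e ∧ e 0 = 1 ∧ ∀ χ, Real.sinh χ = χ * e (χ ^ 2) := by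
  let c : ℕ → ℝ := fun n => ((2 * n + 1).factorial : ℝ)⁻¹
  have hc : ∀ n, c n ≠ 0 := fun n => by positivity
  have hrad : (FormalMultilinearSeries.ofScalars ℝ c).radius = ⊤ := by
    refine FormalMultilinearSeries.ofScalars_radius_eq_top_of_tendsto ℝ c
      (Eventually.of_forall hc) ?_
    refine squeeze_zero (fun n => by positivity) (fun n => ?_)
      tendsto_one_div_add_atTop_nhds_zero_nat
    have h1 : (2 * n.succ + 1).factorial =
        (2 * n + 3) * ((2 * n + 2) * (2 * n + 1).factorial) := rfl
    have hf : (0 : ℝ) < ((2 * n + 1).factorial : ℝ) := by positivity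
    simp only [c, norm_inv, Real.norm_natCast, h1]
    push_cast
    rw [div_le_div_iff₀ (by positivity) (by positivity)]
    field_simp
    have hn : (0 : ℝ) ≤ n := n.cast_nonneg
    nlinarith [mul_nonneg hn hn]
  have hp := (FormalMultilinearSeries.ofScalars ℝ c).hasFPowerSeriesOnBall (by simp [hrad])
  have han : AnalyticOnNhd ℝ (FormalMultilinearSeries.ofScalars ℝ c).sum univ := by
    have := hp.analyticOnNhd
    rwa [hrad, Metric.eball_top] at this
  have hsum : ∀ r : ℝ, HasSum (fun n => c n * r ^ n)
      ((FormalMultilinearSeries.ofScalars ℝ c).sum r) := by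
    intro r
    have := hp.hasSum (y := r) (by simp [hrad])
    simpa [FormalMultilinearSeries.ofScalars_apply_eq, mul_comm] using this
  refine ⟨_, han.contDiff, ?_, fun χ => ?_⟩
  · refine (hsum 0).unique ?_
    convert hasSum_single (f := fun n => c n * (0 : ℝ) ^ n) 0 ?_ using 1
    · simp [c]
    · intro n hn; simp [hn]
  · refine (Real.hasSum_sinh χ).unique ?_
    have hfun : (fun n : ℕ => χ ^ (2 * n + 1) / ((2 * n + 1).factorial : ℝ)) =
        fun n => χ * (c n * (χ ^ 2) ^ n) := by
      funext n
      rw [← pow_mul, pow_succ]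
      simp only [c]
      field_simp
    rw [hfun]
    exact (hsum (χ ^ 2)).mul_left χ

/-- Smooth functions `F`, `Q` with
`dχ² + S_k(χ)² dΩ² = F(|X|²) |dX|² + Q(|X|²) ⟨X, dX⟩²`. -/
structure IsProfile (k : ℤ) (F Q : ℝ → ℝ) : Prop where
  smooth_left : ContDiff ℝ ∞ F
  smooth_right : ContDiff ℝ ∞ Q
  sq : ∀ χ, Sk k χ ^ 2 = χ ^ 2 * F (χ ^ 2)
  zero : F 0 = 1
  add : ∀ r, F r + r * Q r = 1
  pos : ∀ r, 0 ≤ r → 0 < F r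

theorem exists_isProfile {k : ℤ} (hk : k = 0 ∨ k = -1) : ∃ F Q, IsProfile k F Q := by
  rcases hk with rfl | rfl
  · exact ⟨fun _ => 1, fun _ => 0, contDiff_const, contDiff_const, by simp [Sk], rfl, by simp,
      by simp⟩
  · obtain ⟨e, he, he0, hs⟩ := exists_sinh_eq_mul_entire
    have hN : ContDiff ℝ ∞ (fun x : ℝ × ℝ => 1 - e x.2 ^ 2) :=
      contDiff_const.sub ((he.comp contDiff_snd).pow 2)
    have hdiv : ContDiff ℝ ∞ (divSnd (fun x : ℝ × ℝ => 1 - e x.2 ^ 2)) := by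
      rw [← contDiffOn_univ]
      exact contDiffOn_divSnd (n := ⊤) isOpen_univ (fun _ _ _ _ => mem_univ _) hN.contDiffOn
    -- Here `F = e²`, and `F + r Q = 1` forces `Q = (1 - F)/r`, smooth as a Hadamard quotient with a
    -- dummy first variable.
    refine ⟨fun r => e r ^ 2, fun r => divSnd (fun x : ℝ × ℝ => 1 - e x.2 ^ 2) (0, r),
      he.pow 2, hdiv.comp (contDiff_const.prodMk contDiff_id), fun χ => ?_, by simp [he0],
      fun r => ?_, fun r hr => ?_⟩
    · simp [Sk, hs χ, mul_pow]
    · have := mul_divSnd (x := (0, r)) isOpen_univ (fun _ _ _ _ => mem_univ _)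
        (hN.of_le (by exact_mod_cast le_top)).contDiffOn (mem_univ _)
      simp only [he0] at this
      rw [this]; ring
    · rcases hr.eq_or_lt with rfl | hr
      · simp [he0]
      · have h1 := hs (√r)
        rw [Real.sq_sqrt hr.le] at h1
        have h2 : 0 < Real.sinh (√r) := Real.sinh_pos_iff.2 (Real.sqrt_pos.2 hr)
        have h3 : e r ≠ 0 := fun h => by rw [h1, h, mul_zero] at h2; exact lt_irrefl _ h2
        positivity

abbrev R3 : Type := EuclideanSpace ℝ (Fin 3)

variable {k : ℤ} {F Q : ℝ → ℝ}

/-- Collecting the terms of `dχ²` and `F (|dX|² - dχ²)` leaves `(1 - F)/r = Q` in front of `⟨X,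
dX⟩²`. The apparent singularity at `X = 0` is gone, so the metric can be differentiated there. -/
theorem IsProfile.spatialMetric_eq (h : IsProfile k F Q) (X v w : R3) :
    spatialMetric k X v w =
      F (‖X‖ ^ 2) * inner ℝ v w + Q (‖X‖ ^ 2) * inner ℝ X v * inner ℝ X w := by
  unfold spatialMetric dOmegaSq dChi
  split_ifs with hX
  · simp [hX, h.zero]
  · have hn : ‖X‖ ≠ 0 := norm_ne_zero_iff.2 hX
    have h1 := h.add (‖X‖ ^ 2)
    rw [h.sq]
    field_simp
    linear_combination (-inner ℝ X v * inner ℝ X w) * h1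

/-- The derivative of a component of the Robertson–Walker metric. -/
theorem IsProfile.fderiv_rwMetric (h : IsProfile k F Q) {a : ℝ → ℝ} {p : R4} {a' : ℝ}
    (ha : HasDerivAt a a' p.1) (v w z : R4) :
    fderiv ℝ (fun q => rwMetric k a q v w) p z =
      2 * a p.1 * a' * z.1 * spatialMetric k p.2 v.2 w.2
      + a p.1 ^ 2 * (2 * deriv F (‖p.2‖ ^ 2) * inner ℝ p.2 z.2 * inner ℝ v.2 w.2
        + 2 * deriv Q (‖p.2‖ ^ 2) * inner ℝ p.2 z.2 * inner ℝ p.2 v.2 * inner ℝ p.2 w.2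
        + Q (‖p.2‖ ^ 2) * (inner ℝ z.2 v.2 * inner ℝ p.2 w.2
          + inner ℝ p.2 v.2 * inner ℝ z.2 w.2)) := by
  have h2 : (fun q : R4 => rwMetric k a q v w) = fun q : R4 => -(v.1 * w.1) + a q.1 ^ 2 *
      (F (‖q.2‖ ^ 2) * inner ℝ v.2 w.2 + Q (‖q.2‖ ^ 2) * inner ℝ q.2 v.2 * inner ℝ q.2 w.2) := by
    funext q; rw [rwMetric, h.spatialMetric_eq]
  have hsnd : HasFDerivAt (fun q : R4 => q.2) (ContinuousLinearMap.snd ℝ ℝ R3) p :=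
    hasFDerivAt_snd
  have hfst : HasFDerivAt (fun q : R4 => q.1) (ContinuousLinearMap.fst ℝ ℝ R3) p :=
    hasFDerivAt_fst
  have ha2 : HasFDerivAt (fun q : R4 => a q.1) _ p := ha.comp_hasFDerivAt p hfst
  have hr := hsnd.norm_sq
  have hF : HasFDerivAt (fun q : R4 => F (‖q.2‖ ^ 2)) _ p :=
    ((h.smooth_left.differentiable (by simp) _).hasDerivAt).comp_hasFDerivAt p hr
  have hQ : HasFDerivAt (fun q : R4 => Q (‖q.2‖ ^ 2)) _ p :=
    ((h.smooth_right.differentiable (by simp) _).hasDerivAt).comp_hasFDerivAt p hr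
  have hv := hsnd.inner ℝ (hasFDerivAt_const v.2 p)
  have hw := hsnd.inner ℝ (hasFDerivAt_const w.2 p)
  have := ((ha2.pow 2).fun_mul ((hF.mul_const (inner ℝ v.2 w.2)).fun_add
    ((hQ.fun_mul hv).fun_mul hw))).const_add (-(v.1 * w.1))
  rw [h2, HasFDerivAt.fderiv this, h.spatialMetric_eq]
  simp
  ring

/-- The left-hand side of the geodesic equation, for the position `p`, the velocity `v` and the
acceleration `z`. -/
theorem IsProfile.geodesic_expr (h : IsProfile k F Q) {a : ℝ → ℝ} {p : R4} {a' : ℝ}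
    (ha : HasDerivAt a a' p.1) (v w z : R4) :
    rwMetric k a p z w + christoffel (rwMetric k a) p v v w =
      -(z.1 + a p.1 * a' * spatialMetric k p.2 v.2 v.2) * w.1
      + a p.1 ^ 2 * spatialMetric k p.2 z.2 w.2
      + 2 * a p.1 * a' * v.1 * spatialMetric k p.2 v.2 w.2
      + a p.1 ^ 2 * (2 * deriv F (‖p.2‖ ^ 2) * inner ℝ p.2 v.2 * inner ℝ v.2 w.2
        + (deriv Q (‖p.2‖ ^ 2) * inner ℝ p.2 v.2 ^ 2
          + (Q (‖p.2‖ ^ 2) - deriv F (‖p.2‖ ^ 2)) * inner ℝ v.2 v.2) * inner ℝ p.2 w.2) := by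
  unfold christoffel
  rw [h.fderiv_rwMetric ha, h.fderiv_rwMetric ha, rwMetric, real_inner_comm v.2 w.2]
  ring

/-- Differentiating the relation `F + r Q = 1`. -/
theorem IsProfile.deriv_add (h : IsProfile k F Q) (r : ℝ) :
    deriv F r + r * deriv Q r + Q r = 0 := by
  have hF := (h.smooth_left.differentiable (by simp) r).hasDerivAt
  have hQ := (h.smooth_right.differentiable (by simp) r).hasDerivAt
  have h1 := hF.fun_add ((hasDerivAt_id r).fun_mul hQ)
  have h2 : (fun x => F x + id x * Q x) = fun _ => 1 := funext h.add
  rw [h2] at h1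
  have := h1.unique (hasDerivAt_const r 1)
  simp only [id] at this
  linarith

/-- The relation `F + r Q = 1` makes the metric Euclidean when one argument is radial: the Gauss
lemma for `χ`. -/
theorem spatialMetric_radial (h : IsProfile k F Q) {n : R3} (hn : ‖n‖ = 1) (p v : ℝ) (w : R3) :
    spatialMetric k (p • n) (v • n) w = v * inner ℝ n w := by
  have h1 := h.add (p ^ 2)
  have hnn : (inner ℝ n n : ℝ) = 1 := by rw [real_inner_self_eq_norm_sq, hn]; norm_num
  rw [h.spatialMetric_eq]
  simp only [norm_smul, hn, mul_one, Real.norm_eq_abs, sq_abs, real_inner_smul_left,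
    real_inner_smul_right, hnn]
  linear_combination v * inner ℝ n w * h1

/-- The geodesic equation for radial motion. -/
theorem IsProfile.geodesic_expr_radial (h : IsProfile k F Q) {a : ℝ → ℝ} {t a' : ℝ}
    (ha : HasDerivAt a a' t) {n : R3} (hn : ‖n‖ = 1) (p t' p' t'' p'' : ℝ) (w : R4) :
    rwMetric k a (t, p • n) (t'', p'' • n) w
        + christoffel (rwMetric k a) (t, p • n) (t', p' • n) (t', p' • n) w =
      -(t'' + a t * a' * p' ^ 2) * w.1
      + (a t ^ 2 * p'' + 2 * a t * a' * t' * p') * inner ℝ n w.2 := by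
  have h1 := h.deriv_add (p ^ 2)
  have hnn : (inner ℝ n n : ℝ) = 1 := by rw [real_inner_self_eq_norm_sq, hn]; norm_num
  rw [h.geodesic_expr (p := (t, p • n)) ha]
  simp only [spatialMetric_radial h hn]
  simp only [norm_smul, hn, mul_one, Real.norm_eq_abs, sq_abs, real_inner_smul_left,
    real_inner_smul_right, hnn]
  linear_combination a t ^ 2 * p * p' ^ 2 * inner ℝ n w.2 * h1

/-! ### The scale factor and its inverse -/

/-- The values of the scale factor at positive times. -/
def scaleRange (a : ℝ → ℝ) : Set ℝ := a '' Ioi 0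

section ScaleFactor

variable {a : ℝ → ℝ}

theorem IsRegular.pos (ha : IsRegular a) {t : ℝ} (ht : 0 < t) : 0 < a t := by
  have := ha.strictMonoOn (mem_Ici.2 le_rfl) (mem_Ici.2 ht.le) ht
  rwa [ha.zero] at this

theorem IsRegular.hasDerivAt (ha : IsRegular a) {t : ℝ} (ht : 0 < t) : HasDerivAt a (deriv a t) t :=
  ((ha.contDiffOn.contDiffAt (Ioi_mem_nhds ht)).differentiableAt (by simp)).hasDerivAt

theorem IsRegular.hasDerivAt_deriv (ha : IsRegular a) {t : ℝ} (ht : 0 < t) :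
    HasDerivAt (deriv a) (deriv (deriv a) t) t :=
  (((ha.contDiffOn.deriv_of_isOpen (m := 1) isOpen_Ioi (by norm_num)).contDiffAt
    (Ioi_mem_nhds ht)).differentiableAt (by simp)).hasDerivAt

theorem IsRegular.deriv_pos (ha : IsRegular a) {t : ℝ} (ht : 0 < t) : 0 < deriv a t := by
  refine lt_of_le_of_ne ?_ (ha.deriv_ne_zero t ht).symm
  have h1 := ((ha.hasDerivAt ht).hasDerivWithinAt (s := Ici 0)).derivWithin
    (uniqueDiffOn_Ici 0 t ht.le)
  rw [← h1]
  exact ha.strictMonoOn.monotoneOn.derivWithin_nonneg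

theorem IsRegular.scaleInv_apply (ha : IsRegular a) {t : ℝ} (ht : 0 ≤ t) : scaleInv a (a t) = t :=
  ha.strictMonoOn.injOn.leftInvOn_invFunOn ht

theorem IsRegular.mem_scaleRange_of_le (ha : IsRegular a) {x z : ℝ}
    (hx : x ∈ scaleRange a) (hz : 0 < z)
    (hzx : z ≤ x) : z ∈ scaleRange a := by
  obtain ⟨t, ht, rfl⟩ := hx
  have ht : 0 < t := ht
  have hc : ContinuousOn a (Icc 0 t) := ha.continuousOn.mono Icc_subset_Ici_self
  obtain ⟨u, hu, rfl⟩ := intermediate_value_Icc ht.le hc (by rw [ha.zero]; exact ⟨hz.le, hzx⟩)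
  refine ⟨u, lt_of_le_of_ne hu.1 ?_, rfl⟩
  rintro rfl
  rw [ha.zero] at hz
  exact lt_irrefl _ hz

theorem IsRegular.fderiv_ker (ha : IsRegular a) {t : ℝ} (ht : t ∈ Ioi (0 : ℝ)) (v : ℝ)
    (h : fderiv ℝ a t v = 0) :
    v = 0 := by
  rw [(ha.hasDerivAt ht).hasFDerivAt.fderiv] at h
  simpa [ha.deriv_ne_zero t ht] using h

theorem IsRegular.isOpen_scaleRange (ha : IsRegular a) : IsOpen (scaleRange a) :=
  isOpen_image_of_fderiv_injective (n := 2) (by simp) isOpen_Ioi ha.contDiffOn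
    fun _ ht v => ha.fderiv_ker ht v

theorem IsRegular.contDiffOn_scaleInv (ha : IsRegular a) {n : WithTop ℕ∞} (hn : n ≠ 0)
    (h : ContDiffOn ℝ n a (Ioi 0)) : ContDiffOn ℝ n (scaleInv a) (scaleRange a) :=
  contDiffOn_leftInverse hn isOpen_Ioi h (fun _ ht v => ha.fderiv_ker ht v)
    fun _ ht => ha.scaleInv_apply (le_of_lt ht)

/-- The inverse `b` has the class of `a`, and one derivative is spent on `b'`. Since `b'` enters the
integrands of `ρ` and `χ`, this is where the class `C^(n+1)` of the chart originates. -/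
theorem IsRegular.contDiffOn_deriv_scaleInv (ha : IsRegular a) {n : ℕ∞}
    (h : ContDiffOn ℝ (n + 2) a (Ioi 0)) :
    ContDiffOn ℝ (n + 1) (deriv (scaleInv a)) (scaleRange a) :=
  (ha.contDiffOn_scaleInv (by simp) h).deriv_of_isOpen ha.isOpen_scaleRange
    (by rw [add_assoc, one_add_one_eq_two])

theorem IsRegular.contDiffOn_one_deriv_scaleInv (ha : IsRegular a) :
    ContDiffOn ℝ 1 (deriv (scaleInv a)) (scaleRange a) := by
  simpa using ha.contDiffOn_deriv_scaleInv (n := 0) (by simpa using ha.contDiffOn)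

theorem IsRegular.scaleInv_pos (ha : IsRegular a) {x : ℝ} (hx : x ∈ scaleRange a) :
    0 < scaleInv a x := by
  obtain ⟨t, ht, rfl⟩ := hx
  rw [ha.scaleInv_apply (le_of_lt ht)]
  exact ht

theorem IsRegular.apply_scaleInv (ha : IsRegular a) {x : ℝ} (hx : x ∈ scaleRange a) :
    a (scaleInv a x) = x := by
  obtain ⟨t, ht, rfl⟩ := hx
  rw [ha.scaleInv_apply (le_of_lt ht)]

theorem IsRegular.hasDerivAt_scaleInv (ha : IsRegular a) {x : ℝ} (hx : x ∈ scaleRange a) :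
    HasDerivAt (scaleInv a) (deriv (scaleInv a) x) x :=
  (((ha.contDiffOn_scaleInv (n := 2) (by simp) ha.contDiffOn).contDiffAt
    (ha.isOpen_scaleRange.mem_nhds hx)).differentiableAt (by simp)).hasDerivAt

theorem IsRegular.hasDerivAt_deriv_scaleInv (ha : IsRegular a) {x : ℝ} (hx : x ∈ scaleRange a) :
    HasDerivAt (deriv (scaleInv a)) (deriv (deriv (scaleInv a)) x) x :=
  ((ha.contDiffOn_one_deriv_scaleInv.contDiffAt
    (ha.isOpen_scaleRange.mem_nhds hx)).differentiableAt (by simp)).hasDerivAt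

theorem IsRegular.deriv_scaleInv (ha : IsRegular a) {x : ℝ} (hx : x ∈ scaleRange a) :
    deriv (scaleInv a) x = (deriv a (scaleInv a x))⁻¹ := by
  have hpos := ha.scaleInv_pos hx
  refine (HasDerivAt.of_local_left_inverse (ha.hasDerivAt_scaleInv hx).continuousAt
    (ha.hasDerivAt hpos) (ha.deriv_ne_zero _ hpos) ?_).deriv
  filter_upwards [ha.isOpen_scaleRange.mem_nhds hx] with z hz
  exact ha.apply_scaleInv hz

theorem IsRegular.deriv_scaleInv_pos (ha : IsRegular a) {x : ℝ} (hx : x ∈ scaleRange a) :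
    0 < deriv (scaleInv a) x := by
  rw [ha.deriv_scaleInv hx]
  exact inv_pos.2 (ha.deriv_pos (ha.scaleInv_pos hx))

/-- From `b' = 1/ȧ(b)` one gets `(x b'(x))' = ȧ⁻¹ (1 - a ä / ȧ²)` at the time `b(x)`. This is the
bound on the scale factor in the form that controls the Jacobian. -/
theorem IsRegular.deriv_mul_deriv_scaleInv_nonneg (ha : IsRegular a) {x : ℝ}
    (hx : x ∈ scaleRange a) :
    0 ≤ deriv (scaleInv a) x + x * deriv (deriv (scaleInv a)) x := by
  have hpos := ha.scaleInv_pos hx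
  have hd := ha.deriv_pos hpos
  have h1 : HasDerivAt (fun z => (deriv a (scaleInv a z))⁻¹) _ x :=
    ((ha.hasDerivAt_deriv hpos).comp x (ha.hasDerivAt_scaleInv hx)).inv hd.ne'
  have h2 : deriv (scaleInv a) =ᶠ[𝓝 x] fun z => (deriv a (scaleInv a z))⁻¹ := by
    filter_upwards [ha.isOpen_scaleRange.mem_nhds hx] with z hz
    exact ha.deriv_scaleInv hz
  have hb := ha.bound _ hpos
  rw [(h1.congr_of_eventuallyEq h2).deriv, ha.deriv_scaleInv hx]
  rw [ha.apply_scaleInv hx] at hb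
  simp only [Function.comp_apply]
  set d := deriv a (scaleInv a x)
  set d2 := deriv (deriv a) (scaleInv a x)
  have h3 : d⁻¹ + x * (-(d2 * d⁻¹) / d ^ 2) = d⁻¹ * (1 - x * d2 / d ^ 2) := by ring
  rw [h3]
  exact mul_nonneg (inv_nonneg.2 hd.le) (by linarith)

/-- The Hubble parameter is nonincreasing. -/
theorem IsRegular.antitoneOn_hubble (ha : IsRegular a) :
    AntitoneOn (fun t => deriv a t / a t) (Ioi 0) := by
  have hd : ∀ t ∈ Ioi (0 : ℝ), HasDerivAt (fun t => deriv a t / a t)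
      ((deriv (deriv a) t * a t - deriv a t * deriv a t) / a t ^ 2) t := fun t ht =>
    (ha.hasDerivAt_deriv ht).fun_div (ha.hasDerivAt ht) (ha.pos ht).ne'
  refine antitoneOn_of_deriv_nonpos (convex_Ioi 0)
    (fun t ht => (hd t ht).continuousAt.continuousWithinAt) ?_ ?_
  · rw [interior_Ioi]
    exact fun t ht => (hd t ht).differentiableAt.differentiableWithinAt
  · rw [interior_Ioi]
    intro t ht
    rw [(hd t ht).deriv]
    have hb := ha.bound t ht
    rw [div_le_one (by have := ha.deriv_pos ht; positivity)] at hb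
    exact div_nonpos_of_nonpos_of_nonneg (by nlinarith) (sq_nonneg _)

/-- `x b'(x)` is nondecreasing. -/
theorem IsRegular.mul_deriv_scaleInv_mono (ha : IsRegular a) {x z : ℝ}
    (hx : x ∈ scaleRange a) (hz : 0 < z)
    (hzx : z ≤ x) : z * deriv (scaleInv a) z ≤ x * deriv (scaleInv a) x := by
  have hz' := ha.mem_scaleRange_of_le hx hz hzx
  obtain ⟨t, ht, rfl⟩ := hx
  obtain ⟨u, hu, rfl⟩ := hz'
  rw [ha.deriv_scaleInv ⟨t, ht, rfl⟩, ha.deriv_scaleInv ⟨u, hu, rfl⟩,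
    ha.scaleInv_apply (le_of_lt ht), ha.scaleInv_apply (le_of_lt hu)]
  have hut : u ≤ t := 
    (ha.strictMonoOn.le_iff_le (mem_Ici.2 (le_of_lt hu)) (mem_Ici.2 (le_of_lt ht))).1 hzx
  have h1 := ha.antitoneOn_hubble hu ht hut
  have h2 := ha.deriv_pos hu
  have h3 := ha.deriv_pos ht
  have h4 := ha.pos hu
  have h5 := ha.pos ht
  simp only at h1
  rw [div_le_div_iff₀ h5 h4] at h1
  rw [← div_eq_mul_inv, ← div_eq_mul_inv, div_le_div_iff₀ h2 h3]
  linarith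

end ScaleFactor

/-! ### Derivatives of parametric integrals in two variables -/

section PartialDerivatives

variable {Ω : Set ((ℝ × ℝ) × ℝ)} {F : (ℝ × ℝ) × ℝ → ℝ} {x : ℝ × ℝ} {f' : ℝ → ℝ}

theorem fderiv_integral_unit (hΩ : IsOpen Ω) (hF : ContDiffOn ℝ 1 F Ω) (hx : x ∈ slab Ω)
    (v : ℝ × ℝ) :
    fderiv ℝ (fun x => ∫ s in (0 : ℝ)..1, F (x, s)) x v
      = ∫ s in (0 : ℝ)..1, fderiv ℝ F (x, s) (v, 0) := by
  have hF' : ContinuousOn (fun z => (fderiv ℝ F z).comp (ContinuousLinearMap.inl ℝ (ℝ × ℝ) ℝ)) Ω :=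
    (hF.continuousOn_fderiv_of_isOpen hΩ le_rfl).clm_comp continuousOn_const
  rw [(hasFDerivAt_integral_unit hΩ hF hx).fderiv,
    ContinuousLinearMap.intervalIntegral_apply (slice_intervalIntegrable hF' hx)]
  simp

/-- The total derivative of the kernel on a coordinate vector is identified, by uniqueness, with an
ordinary derivative in one variable, the form in which the kernels are differentiated below. -/
theorem fderiv_integral_unit_fst (hΩ : IsOpen Ω) (hF : ContDiffOn ℝ 1 F Ω) (hx : x ∈ slab Ω)
    (h : ∀ s ∈ Icc (0 : ℝ) 1, HasDerivAt (fun τ => F ((τ, x.2), s)) (f' s) x.1) :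
    fderiv ℝ (fun x => ∫ s in (0 : ℝ)..1, F (x, s)) x (1, 0) = ∫ s in (0 : ℝ)..1, f' s := by
  rw [fderiv_integral_unit hΩ hF hx]
  refine intervalIntegral.integral_congr fun s hs => ?_
  rw [uIcc_of_le zero_le_one] at hs
  have h1 : HasFDerivAt F (fderiv ℝ F (x, s)) (x, s) :=
    ((hF.contDiffAt (hΩ.mem_nhds (hx s hs))).differentiableAt one_ne_zero).hasFDerivAt
  have h2 : HasDerivAt (fun τ : ℝ => ((τ, x.2), s)) (((1 : ℝ), (0 : ℝ)), (0 : ℝ)) x.1 :=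
    ((hasDerivAt_id x.1).prodMk (hasDerivAt_const x.1 x.2)).prodMk (hasDerivAt_const x.1 s)
  exact (h1.comp_hasDerivAt x.1 h2).unique (h s hs)

theorem fderiv_integral_unit_snd (hΩ : IsOpen Ω) (hF : ContDiffOn ℝ 1 F Ω) (hx : x ∈ slab Ω)
    (h : ∀ s ∈ Icc (0 : ℝ) 1, HasDerivAt (fun r => F ((x.1, r), s)) (f' s) x.2) :
    fderiv ℝ (fun x => ∫ s in (0 : ℝ)..1, F (x, s)) x (0, 1) = ∫ s in (0 : ℝ)..1, f' s := by
  rw [fderiv_integral_unit hΩ hF hx]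
  refine intervalIntegral.integral_congr fun s hs => ?_
  rw [uIcc_of_le zero_le_one] at hs
  have h1 : HasFDerivAt F (fderiv ℝ F (x, s)) (x, s) :=
    ((hF.contDiffAt (hΩ.mem_nhds (hx s hs))).differentiableAt one_ne_zero).hasFDerivAt
  have h2 : HasDerivAt (fun r : ℝ => ((x.1, r), s)) (((0 : ℝ), (1 : ℝ)), (0 : ℝ)) x.2 :=
    ((hasDerivAt_const x.2 x.1).prodMk (hasDerivAt_id x.2)).prodMk (hasDerivAt_const x.2 s)
  exact (h1.comp_hasDerivAt x.2 h2).unique (h s hs)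

end PartialDerivatives

/-! ### The parametrization by `y = √(1 - 1 / σ)`

With `r = y²` and `σ = 1 / (1 - r)`, the functions `ρ_τ(σ) / y` and `χ(τ, σ) / y` extend across
`r = 0` as functions of `(τ, r)`. -/

/-- The argument `a(τ) √(1 - s² r)` at which the inverse scale factor is evaluated. -/
def scaleArg (a : ℝ → ℝ) (x : ℝ × ℝ) (s : ℝ) : ℝ := a x.1 * √(1 - s ^ 2 * x.2)

/-- `ρ_τ(σ) / y`. -/
def rhoRatio (a : ℝ → ℝ) (x : ℝ × ℝ) : ℝ :=
  a x.1 * ∫ s in (0 : ℝ)..1, deriv (scaleInv a) (scaleArg a x s)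

/-- `χ(τ, σ) / y`. -/
def chiRatio (a : ℝ → ℝ) (x : ℝ × ℝ) : ℝ :=
  ∫ s in (0 : ℝ)..1, deriv (scaleInv a) (scaleArg a x s) / (1 - s ^ 2 * x.2)

/-- The integral occurring in `g_ττ`, divided by `2 y`. -/
def accRatio (a : ℝ → ℝ) (x : ℝ × ℝ) : ℝ :=
  ∫ s in (0 : ℝ)..1, deriv (deriv (scaleInv a)) (scaleArg a x s) / √(1 - s ^ 2 * x.2)

/-- `t(τ, σ)`. -/
def timeFun (a : ℝ → ℝ) (x : ℝ × ℝ) : ℝ := scaleInv a (scaleArg a x 1)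

/-- The derivative of the inverse scale factor at `a(τ) / √σ`. -/
def rateFun (a : ℝ → ℝ) (x : ℝ × ℝ) : ℝ := deriv (scaleInv a) (scaleArg a x 1)

/-- The domain of the integrands. -/
def kernelDomain (a : ℝ → ℝ) : Set ((ℝ × ℝ) × ℝ) :=
  {z | 0 < z.1.1 ∧ z.2 ^ 2 * z.1.2 < 1 ∧ scaleArg a z.1 z.2 ∈ scaleRange a}

/-- The domain of the parameters `(τ, r)`; it contains a neighbourhood of `r = 0`. -/
def paramDomain (a : ℝ → ℝ) : Set (ℝ × ℝ) :=
  {x | 0 < x.1 ∧ x.2 < 1 ∧ scaleArg a x 1 ∈ scaleRange a}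

section Kernels

variable {a : ℝ → ℝ}

theorem IsRegular.continuousOn_Ioi (ha : IsRegular a) : ContinuousOn a (Ioi 0) :=
  ha.continuousOn.mono Ioi_subset_Ici_self

theorem contDiffOn_scaleArg {n : WithTop ℕ∞} (hn : ContDiffOn ℝ n a (Ioi 0)) :
    ContDiffOn ℝ n (fun z : (ℝ × ℝ) × ℝ => scaleArg a z.1 z.2)
      {z | 0 < z.1.1 ∧ z.2 ^ 2 * z.1.2 < 1} := by
  unfold scaleArg
  refine ContDiffOn.mul (hn.comp (t := Ioi 0) (by fun_prop) fun z hz => hz.1) ?_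
  exact ContDiffOn.sqrt (by fun_prop) fun z hz => (sub_pos.2 hz.2).ne'

theorem isOpen_preKernelDomain : IsOpen {z : (ℝ × ℝ) × ℝ | 0 < z.1.1 ∧ z.2 ^ 2 * z.1.2 < 1} := by
  rw [ofPred_and]
  exact (isOpen_lt (by fun_prop) (by fun_prop)).inter (isOpen_lt (by fun_prop) (by fun_prop))

theorem IsRegular.isOpen_kernelDomain (ha : IsRegular a) : IsOpen (kernelDomain a) := by
  have := (contDiffOn_scaleArg ha.contDiffOn).continuousOn.isOpen_inter_preimage
    isOpen_preKernelDomain ha.isOpen_scaleRange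
  have h : kernelDomain a = {z | 0 < z.1.1 ∧ z.2 ^ 2 * z.1.2 < 1} ∩
      (fun z => scaleArg a z.1 z.2) ⁻¹' scaleRange a := by
    ext z
    simp only [kernelDomain, mem_ofPred_eq, mem_inter_iff, mem_preimage, and_assoc]
  rwa [h]

theorem IsRegular.isOpen_paramDomain (ha : IsRegular a) : IsOpen (paramDomain a) := by
  have : paramDomain a = (fun x : ℝ × ℝ => (x, (1 : ℝ))) ⁻¹' kernelDomain a := by
    ext x; simp [paramDomain, kernelDomain]
  rw [this]
  exact ha.isOpen_kernelDomain.preimage (by fun_prop)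

/-- For `r ≤ 0` the argument `a(τ) √(1 - s² r)` is largest at `s = 1`, where it lies in the range by
assumption; for `r ≥ 0` it is at most `a(τ)`. The range contains every positive number below any of
its elements. -/
theorem IsRegular.mem_kernelDomain (ha : IsRegular a) {x : ℝ × ℝ} (hx : x ∈ paramDomain a)
    {s : ℝ} (hs : s ∈ Icc (0 : ℝ) 1) : (x, s) ∈ kernelDomain a := by
  obtain ⟨h1, h2, h3⟩ := hx
  have hA := ha.pos h1
  have hs2 : s ^ 2 ≤ 1 := pow_le_one₀ hs.1 hs.2
  have hlt : s ^ 2 * x.2 < 1 := by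
    rcases le_total x.2 0 with h | h
    · nlinarith [sq_nonneg s]
    · nlinarith
  have hpos : 0 < scaleArg a x s := mul_pos hA (Real.sqrt_pos.2 (by linarith))
  refine ⟨h1, hlt, ?_⟩
  rcases le_total x.2 0 with h | h
  · refine ha.mem_scaleRange_of_le h3 hpos ?_
    unfold scaleArg
    gcongr a x.1 * √(1 - ?_)
    nlinarith
  · refine ha.mem_scaleRange_of_le (x := a x.1) ⟨x.1, h1, rfl⟩ hpos ?_
    have : √(1 - s ^ 2 * x.2) ≤ 1 := Real.sqrt_le_one.2 (by nlinarith [sq_nonneg s])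
    unfold scaleArg
    nlinarith

theorem IsRegular.paramDomain_subset_slab (ha : IsRegular a) :
    paramDomain a ⊆ slab (kernelDomain a) := fun _ hx _ hs => ha.mem_kernelDomain hx hs

theorem IsRegular.mem_paramDomain (ha : IsRegular a) {τ r : ℝ} (hτ : 0 < τ) (h0 : 0 ≤ r)
    (h1 : r < 1) : (τ, r) ∈ paramDomain a := by
  have hA := ha.pos hτ
  have hs : 0 < √(1 - 1 ^ 2 * r) := Real.sqrt_pos.2 (by linarith)
  refine ⟨hτ, h1, ha.mem_scaleRange_of_le (x := a τ) ⟨τ, hτ, rfl⟩ (mul_pos hA hs) ?_⟩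
  have : √(1 - 1 ^ 2 * r) ≤ 1 := Real.sqrt_le_one.2 (by linarith)
  unfold scaleArg
  nlinarith

/-- The argument for `u r` at `s = 1` is the argument for `r` at `s = √u`. This is the
star-shapedness required by Hadamard's lemma. -/
theorem IsRegular.paramDomain_star (ha : IsRegular a) {x : ℝ × ℝ} (hx : x ∈ paramDomain a)
    {u : ℝ} (hu : u ∈ Icc (0 : ℝ) 1) : (x.1, u * x.2) ∈ paramDomain a := by
  have h := ha.mem_kernelDomain hx (s := √u) ⟨Real.sqrt_nonneg u, Real.sqrt_le_one.2 hu.2⟩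
  obtain ⟨h1, h2, h3⟩ := h
  simp only [Real.sq_sqrt hu.1, scaleArg] at h2 h3
  exact ⟨h1, h2, by simpa [scaleArg] using h3⟩

theorem IsRegular.contDiffOn_deriv_kernel (ha : IsRegular a) {n : ℕ∞}
    (h : ContDiffOn ℝ (n + 2) a (Ioi 0)) :
    ContDiffOn ℝ (n + 1) (fun z : (ℝ × ℝ) × ℝ => deriv (scaleInv a) (scaleArg a z.1 z.2))
      (kernelDomain a) := by
  have h1 : ContDiffOn ℝ (n + 1) a (Ioi 0) := h.of_le (by gcongr; exact one_le_two)
  exact (ha.contDiffOn_deriv_scaleInv h).comp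
    ((contDiffOn_scaleArg h1).mono fun z hz => ⟨hz.1, hz.2.1⟩) fun z hz => hz.2.2

theorem IsRegular.contDiffOn_chi_kernel (ha : IsRegular a) {n : ℕ∞}
    (h : ContDiffOn ℝ (n + 2) a (Ioi 0)) :
    ContDiffOn ℝ (n + 1) (fun z : (ℝ × ℝ) × ℝ =>
      deriv (scaleInv a) (scaleArg a z.1 z.2) / (1 - z.2 ^ 2 * z.1.2)) (kernelDomain a) :=
  (ha.contDiffOn_deriv_kernel h).div (by fun_prop) fun z hz => (sub_pos.2 hz.2.1).ne'

theorem IsRegular.contDiffOn_two (ha : IsRegular a) :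
    ContDiffOn ℝ ((0 : ℕ∞) + 2) a (Ioi 0) := by simpa using ha.contDiffOn

theorem contDiffOn_comp_fst {n : WithTop ℕ∞} (h : ContDiffOn ℝ n a (Ioi 0)) :
    ContDiffOn ℝ n (fun x : ℝ × ℝ => a x.1) (paramDomain a) :=
  h.comp contDiffOn_fst fun _ hx => hx.1

theorem IsRegular.contDiffOn_chiRatio (ha : IsRegular a) {n : ℕ∞}
    (h : ContDiffOn ℝ (n + 2) a (Ioi 0)) : ContDiffOn ℝ (n + 1) (chiRatio a) (paramDomain a) := by
  have := contDiffOn_integral_unit (n := n + 1) ha.isOpen_kernelDomain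
    (ha.contDiffOn_chi_kernel h)
  exact this.mono ha.paramDomain_subset_slab

theorem IsRegular.contDiffOn_rhoRatio (ha : IsRegular a) {n : ℕ∞}
    (h : ContDiffOn ℝ (n + 2) a (Ioi 0)) : ContDiffOn ℝ (n + 1) (rhoRatio a) (paramDomain a) := by
  have := contDiffOn_integral_unit (n := n + 1) ha.isOpen_kernelDomain
    (ha.contDiffOn_deriv_kernel h)
  exact (contDiffOn_comp_fst (h.of_le (by gcongr; exact one_le_two))).mul
    (this.mono ha.paramDomain_subset_slab)

theorem IsRegular.contDiffOn_timeFun (ha : IsRegular a) {n : ℕ∞}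
    (h : ContDiffOn ℝ (n + 2) a (Ioi 0)) : ContDiffOn ℝ (n + 1) (timeFun a) (paramDomain a) := by
  have h1 : ContDiffOn ℝ (n + 1) a (Ioi 0) := h.of_le (by gcongr; exact one_le_two)
  refine (ha.contDiffOn_scaleInv (by simp) h1).comp ?_ fun x hx => hx.2.2
  exact (contDiffOn_scaleArg h1).comp (f := fun x : ℝ × ℝ => (x, (1 : ℝ))) (by fun_prop)
    fun x hx => ⟨hx.1, by simpa using hx.2.1⟩

/-! #### Derivatives of the integrands -/

theorem hasDerivAt_scaleArg_fst {τ r s A' : ℝ} (h : HasDerivAt a A' τ) :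
    HasDerivAt (fun τ => scaleArg a (τ, r) s) (A' * √(1 - s ^ 2 * r)) τ :=
  h.mul_const √(1 - s ^ 2 * r)

theorem hasDerivAt_scaleArg_snd {τ r s : ℝ} (h : s ^ 2 * r < 1) :
    HasDerivAt (fun r => scaleArg a (τ, r) s) (-(a τ * s ^ 2 / (2 * √(1 - s ^ 2 * r)))) r := by
  have h1 : HasDerivAt (fun r => 1 - s ^ 2 * r) (-(s ^ 2)) r := by
    simpa using ((hasDerivAt_id r).const_mul (s ^ 2)).const_sub 1
  exact ((h1.sqrt (sub_pos.2 h).ne').const_mul (a τ)).congr_deriv (by ring)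

theorem hasDerivAt_scaleArg_segment {τ r s : ℝ} (h : s ^ 2 * r < 1) :
    HasDerivAt (fun s => scaleArg a (τ, r) s) (-(a τ * s * r / √(1 - s ^ 2 * r))) s := by
  have h1 : HasDerivAt (fun s => 1 - s ^ 2 * r) (-(2 * s * r)) s := by
    simpa using ((hasDerivAt_pow 2 s).mul_const r).const_sub 1
  exact ((h1.sqrt (sub_pos.2 h).ne').const_mul (a τ)).congr_deriv (by field_simp)

theorem IsRegular.continuousOn_deriv_deriv (ha : IsRegular a) :
    ContinuousOn (deriv (deriv (scaleInv a))) (scaleRange a) :=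
  ha.contDiffOn_one_deriv_scaleInv.continuousOn_deriv_of_isOpen ha.isOpen_scaleRange le_rfl

section Slice

variable {x : ℝ × ℝ}

theorem continuousOn_scaleArg_slice :
    ContinuousOn (fun s => scaleArg a x s) (Icc 0 1) := by
  unfold scaleArg; fun_prop

theorem IsRegular.continuousOn_deriv_slice (ha : IsRegular a) (hx : x ∈ paramDomain a) :
    ContinuousOn (fun s => deriv (scaleInv a) (scaleArg a x s)) (Icc 0 1) :=
  ha.contDiffOn_one_deriv_scaleInv.continuousOn.comp continuousOn_scaleArg_slice
    fun _ hs => (ha.mem_kernelDomain hx hs).2.2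

theorem IsRegular.continuousOn_deriv_deriv_slice (ha : IsRegular a) (hx : x ∈ paramDomain a) :
    ContinuousOn (fun s => deriv (deriv (scaleInv a)) (scaleArg a x s)) (Icc 0 1) :=
  ha.continuousOn_deriv_deriv.comp continuousOn_scaleArg_slice
    fun _ hs => (ha.mem_kernelDomain hx hs).2.2

theorem intervalIntegrable_unit {f : ℝ → ℝ} (h : ContinuousOn f (Icc 0 1)) :
    IntervalIntegrable f volume 0 1 :=
  ContinuousOn.intervalIntegrable (by rwa [uIcc_of_le zero_le_one])

theorem IsRegular.sqrt_ne_zero (ha : IsRegular a) (hx : x ∈ paramDomain a) {s : ℝ}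
    (hs : s ∈ Icc (0 : ℝ) 1) : √(1 - s ^ 2 * x.2) ≠ 0 :=
  (Real.sqrt_pos.2 (sub_pos.2 (ha.mem_kernelDomain hx hs).2.1)).ne'

theorem IsRegular.one_sub_ne_zero (ha : IsRegular a) (hx : x ∈ paramDomain a) {s : ℝ}
    (hs : s ∈ Icc (0 : ℝ) 1) : 1 - s ^ 2 * x.2 ≠ 0 :=
  (sub_pos.2 (ha.mem_kernelDomain hx hs).2.1).ne'

theorem IsRegular.continuousOn_acc_slice (ha : IsRegular a) (hx : x ∈ paramDomain a) :
    ContinuousOn (fun s => deriv (deriv (scaleInv a)) (scaleArg a x s) / √(1 - s ^ 2 * x.2))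
      (Icc 0 1) :=
  (ha.continuousOn_deriv_deriv_slice hx).div (by fun_prop) fun _ hs => ha.sqrt_ne_zero hx hs

/-- The derivative of `s b'(a(τ) √(1 - s² r))`. -/
theorem IsRegular.hasDerivAt_segment (ha : IsRegular a) (hx : x ∈ paramDomain a) {s : ℝ}
    (hs : s ∈ Icc (0 : ℝ) 1) :
    HasDerivAt (fun s => s * deriv (scaleInv a) (scaleArg a x s))
      (deriv (scaleInv a) (scaleArg a x s) - a x.1 * s ^ 2 * x.2 *
        (deriv (deriv (scaleInv a)) (scaleArg a x s) / √(1 - s ^ 2 * x.2))) s := by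
  obtain ⟨-, h2, h3⟩ := ha.mem_kernelDomain hx hs
  have h4 := (ha.hasDerivAt_deriv_scaleInv h3).comp s (hasDerivAt_scaleArg_segment (a := a) h2)
  refine ((hasDerivAt_id s).fun_mul h4).congr_deriv ?_
  simp only [id, Function.comp_apply]
  ring

/-- Integration by parts in `s`: it trades an integral of `b'` for a boundary term and an integral
of `b''`, and is the source of the relations between `rhoRatio`, `rateFun` and `accRatio`. -/
theorem IsRegular.integral_segment (ha : IsRegular a) (hx : x ∈ paramDomain a) :
    ∫ s in (0 : ℝ)..1, (deriv (scaleInv a) (scaleArg a x s) - a x.1 * s ^ 2 * x.2 *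
        (deriv (deriv (scaleInv a)) (scaleArg a x s) / √(1 - s ^ 2 * x.2))) = rateFun a x := by
  rw [intervalIntegral.integral_eq_sub_of_hasDerivAt (f := fun s => s *
    deriv (scaleInv a) (scaleArg a x s))]
  · simp [rateFun]
  · intro s hs
    rw [uIcc_of_le zero_le_one] at hs
    exact ha.hasDerivAt_segment hx hs
  · refine intervalIntegrable_unit ((ha.continuousOn_deriv_slice hx).sub ?_)
    exact ContinuousOn.mul (by fun_prop) (ha.continuousOn_acc_slice hx)

theorem IsRegular.hasDerivAt_kernel_fst (ha : IsRegular a) (hx : x ∈ paramDomain a) {s : ℝ}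
    (hs : s ∈ Icc (0 : ℝ) 1) :
    HasDerivAt (fun τ => deriv (scaleInv a) (scaleArg a (τ, x.2) s))
      (deriv (deriv (scaleInv a)) (scaleArg a x s) * (deriv a x.1 * √(1 - s ^ 2 * x.2))) x.1 := by
  obtain ⟨h1, -, h3⟩ := ha.mem_kernelDomain hx hs
  exact HasDerivAt.comp (h₂ := deriv (scaleInv a)) x.1 (ha.hasDerivAt_deriv_scaleInv h3)
    (hasDerivAt_scaleArg_fst (ha.hasDerivAt h1))

theorem IsRegular.hasDerivAt_kernel_snd (ha : IsRegular a) (hx : x ∈ paramDomain a) {s : ℝ}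
    (hs : s ∈ Icc (0 : ℝ) 1) :
    HasDerivAt (fun r => deriv (scaleInv a) (scaleArg a (x.1, r) s))
      (deriv (deriv (scaleInv a)) (scaleArg a x s) *
        -(a x.1 * s ^ 2 / (2 * √(1 - s ^ 2 * x.2)))) x.2 := by
  obtain ⟨-, h2, h3⟩ := ha.mem_kernelDomain hx hs
  exact HasDerivAt.comp (h₂ := deriv (scaleInv a)) x.2 (ha.hasDerivAt_deriv_scaleInv h3)
    (hasDerivAt_scaleArg_snd h2)

theorem IsRegular.fderiv_chiRatio_fst (ha : IsRegular a) (hx : x ∈ paramDomain a) :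
    fderiv ℝ (chiRatio a) x (1, 0) = deriv a x.1 * accRatio a x := by
  have h := fderiv_integral_unit_fst (F := fun z : (ℝ × ℝ) × ℝ =>
      deriv (scaleInv a) (scaleArg a z.1 z.2) / (1 - z.2 ^ 2 * z.1.2)) ha.isOpen_kernelDomain
    (by simpa using ha.contDiffOn_chi_kernel ha.contDiffOn_two) (ha.paramDomain_subset_slab hx)
    (f' := fun s => deriv a x.1 *
      (deriv (deriv (scaleInv a)) (scaleArg a x s) / √(1 - s ^ 2 * x.2))) ?_
  · rw [intervalIntegral.integral_const_mul] at h
    exact h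
  · intro s hs
    obtain ⟨h1, h2, h3⟩ := ha.mem_kernelDomain hx hs
    have h4 := ha.hasDerivAt_kernel_fst hx hs
    refine (h4.div_const (1 - s ^ 2 * x.2)).congr_deriv ?_
    have h5 : √(1 - s ^ 2 * x.2) ^ 2 = 1 - s ^ 2 * x.2 := Real.sq_sqrt (sub_pos.2 h2).le
    have h6 := ha.sqrt_ne_zero hx hs
    nth_rewrite 2 [← h5]
    field_simp

theorem IsRegular.differentiableAt_chiRatio (ha : IsRegular a) (hx : x ∈ paramDomain a) :
    DifferentiableAt ℝ (chiRatio a) x :=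
  ((ha.contDiffOn_chiRatio ha.contDiffOn_two).contDiffAt
    (ha.isOpen_paramDomain.mem_nhds hx)).differentiableAt (by simp)

theorem IsRegular.differentiableAt_rhoRatio (ha : IsRegular a) (hx : x ∈ paramDomain a) :
    DifferentiableAt ℝ (rhoRatio a) x :=
  ((ha.contDiffOn_rhoRatio ha.contDiffOn_two).contDiffAt
    (ha.isOpen_paramDomain.mem_nhds hx)).differentiableAt (by simp)

theorem IsRegular.fderiv_rhoRatio (ha : IsRegular a) (hx : x ∈ paramDomain a) (v : ℝ × ℝ) :
    fderiv ℝ (rhoRatio a) x v =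
      deriv a x.1 * v.1 * (∫ s in (0 : ℝ)..1, deriv (scaleInv a) (scaleArg a x s))
      + a x.1 * fderiv ℝ (fun x => ∫ s in (0 : ℝ)..1, deriv (scaleInv a) (scaleArg a x s)) x v := by
  have h0 : HasFDerivAt (fun x : ℝ × ℝ => x.1) (ContinuousLinearMap.fst ℝ ℝ ℝ) x :=
    hasFDerivAt_fst
  have h1 := (ha.hasDerivAt hx.1).comp_hasFDerivAt x h0
  have h2 := (hasFDerivAt_integral_unit (F := fun z : (ℝ × ℝ) × ℝ =>
      deriv (scaleInv a) (scaleArg a z.1 z.2)) ha.isOpen_kernelDomain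
    (by simpa using ha.contDiffOn_deriv_kernel ha.contDiffOn_two)
    (ha.paramDomain_subset_slab hx)).differentiableAt.hasFDerivAt
  have h3 := (h1.fun_mul h2).fderiv
  change fderiv ℝ (rhoRatio a) x = _ at h3
  rw [h3]
  simp
  ring

/-- Differentiation produces `∫ b'' √(1 - s² r)`. Writing the root as `1/√(1 - s² r) - s² r/√(1 - s²
r)` splits off `accRatio`, and `integral_segment` absorbs the rest. -/
theorem IsRegular.fderiv_rhoRatio_fst (ha : IsRegular a) (hx : x ∈ paramDomain a) :
    fderiv ℝ (rhoRatio a) x (1, 0) =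
      deriv a x.1 * (rateFun a x + a x.1 * accRatio a x) := by
  have h := fderiv_integral_unit_fst (F := fun z : (ℝ × ℝ) × ℝ =>
      deriv (scaleInv a) (scaleArg a z.1 z.2)) ha.isOpen_kernelDomain
    (by simpa using ha.contDiffOn_deriv_kernel ha.contDiffOn_two) (ha.paramDomain_subset_slab hx)
    (f' := fun s => deriv a x.1 *
      (deriv (deriv (scaleInv a)) (scaleArg a x s) * √(1 - s ^ 2 * x.2))) ?_
  · rw [ha.fderiv_rhoRatio hx, h, intervalIntegral.integral_const_mul, ← ha.integral_segment hx,
      accRatio]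
    have i1 := intervalIntegrable_unit (ha.continuousOn_deriv_slice hx)
    have i3 := intervalIntegrable_unit (ha.continuousOn_acc_slice hx)
    have i4 : IntervalIntegrable (fun s => a x.1 * s ^ 2 * x.2 *
        (deriv (deriv (scaleInv a)) (scaleArg a x s) / √(1 - s ^ 2 * x.2))) volume 0 1 :=
      intervalIntegrable_unit (ContinuousOn.mul (by fun_prop) (ha.continuousOn_acc_slice hx))
    have key : (∫ s in (0 : ℝ)..1, deriv (deriv (scaleInv a)) (scaleArg a x s)
        * √(1 - s ^ 2 * x.2)) * a x.1 =
        (∫ s in (0 : ℝ)..1, deriv (deriv (scaleInv a)) (scaleArg a x s) / √(1 - s ^ 2 * x.2))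
          * a x.1 - ∫ s in (0 : ℝ)..1, a x.1 * s ^ 2 * x.2 *
        (deriv (deriv (scaleInv a)) (scaleArg a x s) / √(1 - s ^ 2 * x.2)) := by
      rw [← intervalIntegral.integral_mul_const, ← intervalIntegral.integral_mul_const,
        ← intervalIntegral.integral_sub (i3.mul_const _) i4]
      refine intervalIntegral.integral_congr fun s hs => ?_
      rw [uIcc_of_le zero_le_one] at hs
      have h5 : √(1 - s ^ 2 * x.2) ^ 2 = 1 - s ^ 2 * x.2 :=
        Real.sq_sqrt (sub_pos.2 (ha.mem_kernelDomain hx hs).2.1).le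
      have h6 := ha.sqrt_ne_zero hx hs
      field_simp
      linear_combination a x.1 * deriv (deriv (scaleInv a)) (scaleArg a x s) * h5
    rw [intervalIntegral.integral_sub i1 i4]
    linear_combination deriv a x.1 * key
  · exact fun s hs => (ha.hasDerivAt_kernel_fst hx hs).congr_deriv (by ring)

/-- With `r = y²` the left-hand side is `d/dy (y P(τ, y²))`, so this is `dρ/dy = a b'` in a form
that persists at `r = 0`. It serves to eliminate `∂_r P`. -/
theorem IsRegular.rhoRatio_add (ha : IsRegular a) (hx : x ∈ paramDomain a) :
    rhoRatio a x + 2 * x.2 * fderiv ℝ (rhoRatio a) x (0, 1) = a x.1 * rateFun a x := by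
  have h := fderiv_integral_unit_snd (F := fun z : (ℝ × ℝ) × ℝ =>
      deriv (scaleInv a) (scaleArg a z.1 z.2)) ha.isOpen_kernelDomain
    (by simpa using ha.contDiffOn_deriv_kernel ha.contDiffOn_two) (ha.paramDomain_subset_slab hx)
    (f' := fun s => -(a x.1 * s ^ 2 / 2) *
      (deriv (deriv (scaleInv a)) (scaleArg a x s) / √(1 - s ^ 2 * x.2))) ?_
  · have i1 := intervalIntegrable_unit (ha.continuousOn_deriv_slice hx)
    have i4 : IntervalIntegrable (fun s => -(a x.1 * s ^ 2 / 2) *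
        (deriv (deriv (scaleInv a)) (scaleArg a x s) / √(1 - s ^ 2 * x.2))) volume 0 1 :=
      intervalIntegrable_unit (ContinuousOn.mul (by fun_prop) (ha.continuousOn_acc_slice hx))
    have key : rateFun a x = (∫ s in (0 : ℝ)..1, deriv (scaleInv a) (scaleArg a x s)) +
        (∫ s in (0 : ℝ)..1, -(a x.1 * s ^ 2 / 2) *
        (deriv (deriv (scaleInv a)) (scaleArg a x s) / √(1 - s ^ 2 * x.2))) * (2 * x.2) := by
      rw [← ha.integral_segment hx, ← intervalIntegral.integral_mul_const,
        ← intervalIntegral.integral_add i1 (i4.mul_const _)]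
      refine intervalIntegral.integral_congr fun s _ => ?_
      ring
    rw [ha.fderiv_rhoRatio hx, h, key, rhoRatio]
    ring
  · intro s hs
    obtain ⟨h1, h2, h3⟩ := ha.mem_kernelDomain hx hs
    have h4 := ha.hasDerivAt_kernel_snd hx hs
    exact h4.congr_deriv (by ring)

/-- The analogue of `rhoRatio_add` for `dχ/dy = b'/(1 - y²)`, from integrating the `s`-derivative of
`s b'/(1 - s² r)`. -/
theorem IsRegular.chiRatio_add (ha : IsRegular a) (hx : x ∈ paramDomain a) :
    chiRatio a x + 2 * x.2 * fderiv ℝ (chiRatio a) x (0, 1) = rateFun a x / (1 - x.2) := by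
  have h := fderiv_integral_unit_snd (F := fun z : (ℝ × ℝ) × ℝ =>
      deriv (scaleInv a) (scaleArg a z.1 z.2) / (1 - z.2 ^ 2 * z.1.2)) ha.isOpen_kernelDomain
    (by simpa using ha.contDiffOn_chi_kernel ha.contDiffOn_two) (ha.paramDomain_subset_slab hx)
    (f' := fun s => (-(a x.1 * s ^ 2 / 2) *
      (deriv (deriv (scaleInv a)) (scaleArg a x s) / √(1 - s ^ 2 * x.2)) * (1 - s ^ 2 * x.2)
      + deriv (scaleInv a) (scaleArg a x s) * s ^ 2) / (1 - s ^ 2 * x.2) ^ 2) ?_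
  · have i1 : IntervalIntegrable (fun s => deriv (scaleInv a) (scaleArg a x s) /
        (1 - s ^ 2 * x.2)) volume 0 1 :=
      intervalIntegrable_unit ((ha.continuousOn_deriv_slice hx).div (by fun_prop)
        fun s hs => ha.one_sub_ne_zero hx hs)
    have i2 : IntervalIntegrable (fun s => (-(a x.1 * s ^ 2 / 2) *
      (deriv (deriv (scaleInv a)) (scaleArg a x s) / √(1 - s ^ 2 * x.2)) * (1 - s ^ 2 * x.2)
      + deriv (scaleInv a) (scaleArg a x s) * s ^ 2) / (1 - s ^ 2 * x.2) ^ 2) volume 0 1 := by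
      refine intervalIntegrable_unit (ContinuousOn.div (ContinuousOn.add (ContinuousOn.mul
        (ContinuousOn.mul (by fun_prop) (ha.continuousOn_acc_slice hx)) (by fun_prop))
        ((ha.continuousOn_deriv_slice hx).mul (by fun_prop))) (by fun_prop) ?_)
      exact fun s hs => pow_ne_zero 2 (ha.one_sub_ne_zero hx hs)
    have hd : ∀ s ∈ uIcc (0 : ℝ) 1, HasDerivAt (fun s => s * deriv (scaleInv a) (scaleArg a x s)
        / (1 - s ^ 2 * x.2)) (deriv (scaleInv a) (scaleArg a x s) / (1 - s ^ 2 * x.2) +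
        (-(a x.1 * s ^ 2 / 2) * (deriv (deriv (scaleInv a)) (scaleArg a x s)
          / √(1 - s ^ 2 * x.2)) * (1 - s ^ 2 * x.2)
      + deriv (scaleInv a) (scaleArg a x s) * s ^ 2) / (1 - s ^ 2 * x.2) ^ 2 * (2 * x.2)) s := by
      intro s hs
      rw [uIcc_of_le zero_le_one] at hs
      have h0 := ha.one_sub_ne_zero hx hs
      have h1 : HasDerivAt (fun s => 1 - s ^ 2 * x.2) (-(2 * s * x.2)) s := by
        simpa using ((hasDerivAt_pow 2 s).mul_const x.2).const_sub 1
      refine ((ha.hasDerivAt_segment hx hs).fun_div h1 h0).congr_deriv ?_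
      field_simp
      ring
    have key := intervalIntegral.integral_eq_sub_of_hasDerivAt hd (i1.add (i2.mul_const _))
    rw [intervalIntegral.integral_add i1 (i2.mul_const _), intervalIntegral.integral_mul_const,
      ← h] at key
    simp only [one_pow, one_mul, zero_mul, zero_div, sub_zero] at key
    change chiRatio a x + fderiv ℝ (chiRatio a) x (0, 1) * _ = rateFun a x / (1 - x.2) at key
    rw [← key]
    ring
  · intro s hs
    obtain ⟨h1, h2, h3⟩ := ha.mem_kernelDomain hx hs
    have h4 := ha.hasDerivAt_kernel_snd hx hs
    have h5 : HasDerivAt (fun r => 1 - s ^ 2 * r) (-(s ^ 2)) x.2 := by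
      simpa using ((hasDerivAt_id x.2).const_mul (s ^ 2)).const_sub 1
    exact (h4.fun_div h5 (ha.one_sub_ne_zero hx hs)).congr_deriv (by ring)

/-- The factor whose square gives `g_ττ` is positive. -/
theorem IsRegular.rateFun_add_pos (ha : IsRegular a) (hx : x ∈ paramDomain a) (h0 : 0 ≤ x.2) :
    0 < rateFun a x + a x.1 * x.2 * accRatio a x := by
  have i2 : IntervalIntegrable (fun s => deriv (scaleInv a) (scaleArg a x s) + scaleArg a x s *
      deriv (deriv (scaleInv a)) (scaleArg a x s)) volume 0 1 :=
    intervalIntegrable_unit ((ha.continuousOn_deriv_slice hx).add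
      (continuousOn_scaleArg_slice.mul (ha.continuousOn_deriv_deriv_slice hx)))
  have i4 : IntervalIntegrable (fun s => deriv (scaleInv a) (scaleArg a x s) -
      a x.1 * s ^ 2 * x.2 *
        (deriv (deriv (scaleInv a)) (scaleArg a x s) / √(1 - s ^ 2 * x.2))) volume 0 1 :=
    intervalIntegrable_unit ((ha.continuousOn_deriv_slice hx).sub
      (ContinuousOn.mul (by fun_prop) (ha.continuousOn_acc_slice hx)))
  have key : a x.1 * accRatio a x = (∫ s in (0 : ℝ)..1, (deriv (scaleInv a) (scaleArg a x s) +
      scaleArg a x s * deriv (deriv (scaleInv a)) (scaleArg a x s))) - rateFun a x := by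
    rw [← ha.integral_segment hx, accRatio, ← intervalIntegral.integral_const_mul,
      ← intervalIntegral.integral_sub i2 i4]
    refine intervalIntegral.integral_congr fun s hs => ?_
    rw [uIcc_of_le zero_le_one] at hs
    have h5 : √(1 - s ^ 2 * x.2) ^ 2 = 1 - s ^ 2 * x.2 :=
      Real.sq_sqrt (sub_pos.2 (ha.mem_kernelDomain hx hs).2.1).le
    have h6 := ha.sqrt_ne_zero hx hs
    have h7 : scaleArg a x s = a x.1 * √(1 - s ^ 2 * x.2) := rfl
    generalize deriv (deriv (scaleInv a)) (scaleArg a x s) = e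
    rw [h7]
    field_simp
    linear_combination (-(a x.1 * e)) * h5
  have hnn : 0 ≤ ∫ s in (0 : ℝ)..1, (deriv (scaleInv a) (scaleArg a x s) +
      scaleArg a x s * deriv (deriv (scaleInv a)) (scaleArg a x s)) :=
    intervalIntegral.integral_nonneg zero_le_one fun s hs =>
      ha.deriv_mul_deriv_scaleInv_nonneg (ha.mem_kernelDomain hx hs).2.2
  have hβ : 0 < rateFun a x := ha.deriv_scaleInv_pos hx.2.2
  have h1 := hx.2.1
  -- A convex combination, for `0 ≤ r < 1`, of `b' > 0` and of the average of `(x b'(x))' ≥ 0`, with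
  -- positive weight on the former.
  have h2 : rateFun a x + a x.1 * x.2 * accRatio a x = (1 - x.2) * rateFun a x + x.2 *
      (∫ s in (0 : ℝ)..1, (deriv (scaleInv a) (scaleArg a x s) +
      scaleArg a x s * deriv (deriv (scaleInv a)) (scaleArg a x s))) := by
    linear_combination x.2 * key
  rw [h2]
  have h3 := mul_pos (sub_pos.2 h1) hβ
  have h4 := mul_nonneg h0 hnn
  linarith

theorem IsRegular.rhoRatio_pos (ha : IsRegular a) (hx : x ∈ paramDomain a) : 0 < rhoRatio a x :=
  mul_pos (ha.pos hx.1) (intervalIntegral.intervalIntegral_pos_of_pos_on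
    (intervalIntegrable_unit (ha.continuousOn_deriv_slice hx))
    (fun _ hs => ha.deriv_scaleInv_pos (ha.mem_kernelDomain hx (Ioo_subset_Icc_self hs)).2.2)
    one_pos)

theorem IsRegular.chiRatio_pos (ha : IsRegular a) (hx : x ∈ paramDomain a) : 0 < chiRatio a x :=
  intervalIntegral.intervalIntegral_pos_of_pos_on
    (intervalIntegrable_unit ((ha.continuousOn_deriv_slice hx).div (by fun_prop)
        fun s hs => ha.one_sub_ne_zero hx hs))
    (fun _ hs => div_pos
      (ha.deriv_scaleInv_pos (ha.mem_kernelDomain hx (Ioo_subset_Icc_self hs)).2.2)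
      (sub_pos.2 (ha.mem_kernelDomain hx (Ioo_subset_Icc_self hs)).2.1))
    one_pos

theorem IsRegular.rateFun_pos (ha : IsRegular a) (hx : x ∈ paramDomain a) : 0 < rateFun a x :=
  ha.deriv_scaleInv_pos hx.2.2

/-- The derivative of `t(τ, σ)`. -/
theorem IsRegular.fderiv_timeFun (ha : IsRegular a) (hx : x ∈ paramDomain a) (v : ℝ × ℝ) :
    fderiv ℝ (timeFun a) x v = rateFun a x * (deriv a x.1 * √(1 - x.2) * v.1
      - a x.1 / (2 * √(1 - x.2)) * v.2) := by
  have hd : DifferentiableAt ℝ (timeFun a) x :=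
    ((ha.contDiffOn_timeFun ha.contDiffOn_two).contDiffAt
      (ha.isOpen_paramDomain.mem_nhds hx)).differentiableAt (by simp)
  obtain ⟨h1, h2, h3⟩ := hx
  have g1 : HasDerivAt (fun τ : ℝ => (τ, x.2)) ((1 : ℝ), (0 : ℝ)) x.1 :=
    (hasDerivAt_id x.1).prodMk (hasDerivAt_const x.1 x.2)
  have g2 : HasDerivAt (fun r : ℝ => (x.1, r)) ((0 : ℝ), (1 : ℝ)) x.2 :=
    (hasDerivAt_const x.2 x.1).prodMk (hasDerivAt_id x.2)
  have e1 : HasDerivAt (fun τ => timeFun a (τ, x.2)) (fderiv ℝ (timeFun a) x (1, 0)) x.1 :=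
    HasFDerivAt.comp_hasDerivAt (l := timeFun a) x.1 hd.hasFDerivAt g1
  have e2 : HasDerivAt (fun r => timeFun a (x.1, r)) (fderiv ℝ (timeFun a) x (0, 1)) x.2 :=
    HasFDerivAt.comp_hasDerivAt (l := timeFun a) x.2 hd.hasFDerivAt g2
  have f1 := e1.unique ((ha.hasDerivAt_scaleInv h3).comp x.1
    (hasDerivAt_scaleArg_fst (r := x.2) (ha.hasDerivAt h1)))
  have f2 := e2.unique ((ha.hasDerivAt_scaleInv h3).comp x.2
    (hasDerivAt_scaleArg_snd (τ := x.1) (by simpa using h2)))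
  have hv : v = v.1 • ((1 : ℝ), (0 : ℝ)) + v.2 • ((0 : ℝ), (1 : ℝ)) := by
    ext <;> simp
  rw [hv, map_add, map_smul, map_smul, f1, f2]
  simp [rateFun]
  ring

end Slice

end Kernels

/-! ### The substitution `s = 1 / (1 - w²)` -/

theorem hasDerivAt_substitution {w : ℝ} (h : w ^ 2 < 1) :
    HasDerivAt (fun w : ℝ => (1 - w ^ 2)⁻¹) (2 * w / (1 - w ^ 2) ^ 2) w := by
  have h1 : HasDerivAt (fun w : ℝ => 1 - w ^ 2) (-(2 * w)) w := by
    simpa using (hasDerivAt_pow 2 w).const_sub 1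
  exact (h1.fun_inv (sub_pos.2 h).ne').congr_deriv (by ring)

theorem strictMonoOn_substitution : StrictMonoOn (fun w : ℝ => (1 - w ^ 2)⁻¹) (Ico 0 1) := by
  intro u hu v hv huv
  have h1 : u ^ 2 < v ^ 2 := pow_lt_pow_left₀ huv hu.1 two_ne_zero
  have h2 : v ^ 2 < 1 := pow_lt_one₀ hv.1 hv.2 two_ne_zero
  exact (inv_lt_inv₀ (by linarith) (by linarith)).2 (by linarith)

theorem substitution_sqrt {σ : ℝ} (hσ : 1 ≤ σ) :
    √(1 - σ⁻¹) ∈ Ico (0 : ℝ) 1 ∧ (1 - √(1 - σ⁻¹) ^ 2)⁻¹ = σ := by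
  have h0 : 0 < σ := by linarith
  have h1 : 0 ≤ 1 - σ⁻¹ := sub_nonneg.2 (inv_le_one_of_one_le₀ hσ)
  refine ⟨⟨Real.sqrt_nonneg _, ?_⟩, ?_⟩
  · rw [Real.sqrt_lt' one_pos]
    have := inv_pos.2 h0
    linarith
  · rw [Real.sq_sqrt h1]; simp

theorem one_le_substitution {y : ℝ} (hy : y ∈ Ico (0 : ℝ) 1) : 1 ≤ (1 - y ^ 2)⁻¹ := by
  have h2 : y ^ 2 < 1 := pow_lt_one₀ hy.1 hy.2 two_ne_zero
  exact (one_le_inv₀ (by linarith)).2 (by nlinarith [sq_nonneg y])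

theorem image_substitution_Ioc {y : ℝ} (hy : y ∈ Ico (0 : ℝ) 1) :
    (fun w : ℝ => (1 - w ^ 2)⁻¹) '' Ioc 0 y = Ioc 1 (1 - y ^ 2)⁻¹ := by
  have hm := strictMonoOn_substitution
  have h0 : (0 : ℝ) ∈ Ico (0 : ℝ) 1 := ⟨le_rfl, one_pos⟩
  ext σ
  constructor
  · rintro ⟨w, hw, rfl⟩
    have hw' : w ∈ Ico (0 : ℝ) 1 := ⟨hw.1.le, hw.2.trans_lt hy.2⟩
    exact ⟨by simpa using hm h0 hw' hw.1, hm.monotoneOn hw' hy hw.2⟩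
  · rintro ⟨h1, h2⟩
    obtain ⟨h3, h4⟩ := substitution_sqrt h1.le
    refine ⟨√(1 - σ⁻¹), ⟨?_, ?_⟩, h4⟩
    · exact Real.sqrt_pos.2 (sub_pos.2 (inv_lt_one_of_one_lt₀ h1))
    · rw [← hm.le_iff_le h3 hy]
      simpa only [h4] using h2

theorem image_substitution_Ioo :
    (fun w : ℝ => (1 - w ^ 2)⁻¹) '' Ioo 0 1 = Ioi 1 := by
  have h0 : (0 : ℝ) ∈ Ico (0 : ℝ) 1 := ⟨le_rfl, one_pos⟩
  ext σ
  constructor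
  · rintro ⟨w, hw, rfl⟩
    simpa using strictMonoOn_substitution h0 ⟨hw.1.le, hw.2⟩ hw.1
  · intro h1
    have h1 : 1 < σ := h1
    obtain ⟨h3, h4⟩ := substitution_sqrt h1.le
    exact ⟨√(1 - σ⁻¹), ⟨Real.sqrt_pos.2 (sub_pos.2 (inv_lt_one_of_one_lt₀ h1)), h3.2⟩, h4⟩

/-- Change of variables on a subset of `(0, 1)`, in terms of a function `f` equal to the
transformed integrand. -/
theorem integral_substitution_set {S : Set ℝ} (hS : MeasurableSet S) (hS1 : S ⊆ Ioo 0 1)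
    {g f : ℝ → ℝ} (h : ∀ w ∈ Ioo (0 : ℝ) 1, 2 * w / (1 - w ^ 2) ^ 2 * g (1 - w ^ 2)⁻¹ = f w) :
    ∫ s in (fun w : ℝ => (1 - w ^ 2)⁻¹) '' S, g s = ∫ w in S, f w := by
  have hlt : ∀ w ∈ S, w ^ 2 < 1 := fun w hw =>
    pow_lt_one₀ (hS1 hw).1.le (hS1 hw).2 two_ne_zero
  have hinj : InjOn (fun w : ℝ => (1 - w ^ 2)⁻¹) S :=
    strictMonoOn_substitution.injOn.mono (hS1.trans Ioo_subset_Ico_self)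
  rw [integral_image_eq_integral_abs_deriv_smul hS
    (fun w hw => (hasDerivAt_substitution (hlt w hw)).hasDerivWithinAt) hinj]
  refine setIntegral_congr_fun hS fun w hw => ?_
  have h0 := (hS1 hw).1
  simp only [smul_eq_mul]
  rw [abs_of_nonneg (by positivity), h w (hS1 hw)]

theorem integral_substitution {g f : ℝ → ℝ} {y : ℝ} (hy : y ∈ Ico (0 : ℝ) 1)
    (h : ∀ w ∈ Ioo (0 : ℝ) 1, 2 * w / (1 - w ^ 2) ^ 2 * g (1 - w ^ 2)⁻¹ = f w) :
    ∫ s in (1 : ℝ)..(1 - y ^ 2)⁻¹, g s = ∫ w in (0 : ℝ)..y, f w := by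
  rw [intervalIntegral.integral_of_le (one_le_substitution hy),
    intervalIntegral.integral_of_le hy.1, ← image_substitution_Ioc hy]
  exact integral_substitution_set measurableSet_Ioc
    (fun w hw => ⟨hw.1, hw.2.trans_lt hy.2⟩) h

theorem substitution_facts {w : ℝ} (hw : w ∈ Ioo (0 : ℝ) 1) :
    0 < √(1 - w ^ 2) ∧ 1 - w ^ 2 = √(1 - w ^ 2) ^ 2 ∧ √((1 - w ^ 2)⁻¹) = (√(1 - w ^ 2))⁻¹ ∧
      √((1 - w ^ 2)⁻¹ - 1) = w / √(1 - w ^ 2) ∧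
      ((1 - w ^ 2)⁻¹) ^ (3 / 2 : ℝ) = (√(1 - w ^ 2))⁻¹ ^ 3 := by
  have h1 : 0 < 1 - w ^ 2 := sub_pos.2 (pow_lt_one₀ hw.1.le hw.2 two_ne_zero)
  refine ⟨Real.sqrt_pos.2 h1, (Real.sq_sqrt h1.le).symm, Real.sqrt_inv _, ?_, ?_⟩
  · have : (1 - w ^ 2)⁻¹ - 1 = w ^ 2 / (1 - w ^ 2) := by field_simp; ring
    rw [this, Real.sqrt_div' _ h1.le, Real.sqrt_sq hw.1.le]
  · have h2 : 0 ≤ (1 - w ^ 2)⁻¹ := inv_nonneg.2 h1.le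
    rw [← Real.sqrt_inv, Real.sqrt_eq_rpow]
    generalize (1 - w ^ 2)⁻¹ = z at h2
    rw [← Real.rpow_natCast, ← Real.rpow_mul h2]
    norm_num

section Identification

variable {a : ℝ → ℝ} {τ y : ℝ}

/-- The Jacobian supplies a factor `w` that cancels the one in `√(s - 1) = w / √(1 - w²)`; the
singularity at `s = 1` disappears. -/
theorem rho_integrand {w : ℝ} (hw : w ∈ Ioo (0 : ℝ) 1) :
    2 * w / (1 - w ^ 2) ^ 2 * (deriv (scaleInv a) (a τ / √((1 - w ^ 2)⁻¹)) *
      (1 / (((1 - w ^ 2)⁻¹) ^ (3 / 2 : ℝ) * √((1 - w ^ 2)⁻¹ - 1))))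
      = 2 * deriv (scaleInv a) (a τ * √(1 - w ^ 2)) := by
  obtain ⟨h1, h2, h3, h4, h5⟩ := substitution_facts hw
  have h0 := hw.1
  rw [h3, h4, h5, div_inv_eq_mul]
  nth_rewrite 1 [h2]
  field_simp

theorem chi_integrand {w : ℝ} (hw : w ∈ Ioo (0 : ℝ) 1) :
    2 * w / (1 - w ^ 2) ^ 2 * (deriv (scaleInv a) (a τ / √((1 - w ^ 2)⁻¹)) *
      (1 / (√((1 - w ^ 2)⁻¹) * √((1 - w ^ 2)⁻¹ - 1))))
      = 2 * (deriv (scaleInv a) (a τ * √(1 - w ^ 2)) / (1 - w ^ 2)) := by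
  obtain ⟨h1, h2, h3, h4, h5⟩ := substitution_facts hw
  have h0 := hw.1
  rw [h3, h4, div_inv_eq_mul]
  nth_rewrite 1 [h2]
  nth_rewrite 6 [h2]
  field_simp

theorem acc_integrand {w : ℝ} (hw : w ∈ Ioo (0 : ℝ) 1) :
    2 * w / (1 - w ^ 2) ^ 2 * (deriv (deriv (scaleInv a)) (a τ / √((1 - w ^ 2)⁻¹)) /
      ((1 - w ^ 2)⁻¹ * √((1 - w ^ 2)⁻¹ - 1)))
      = 2 * (deriv (deriv (scaleInv a)) (a τ * √(1 - w ^ 2)) / √(1 - w ^ 2)) := by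
  obtain ⟨h1, h2, h3, h4, h5⟩ := substitution_facts hw
  have h0 := hw.1
  rw [h3, h4, div_inv_eq_mul]
  nth_rewrite 1 [h2]
  nth_rewrite 3 [h2]
  field_simp

theorem mul_rhoRatio (a : ℝ → ℝ) (τ y : ℝ) : y * rhoRatio a (τ, y ^ 2) =
    a τ * ∫ w in (0 : ℝ)..y, deriv (scaleInv a) (a τ * √(1 - w ^ 2)) := by
  have := intervalIntegral.smul_integral_comp_mul_left (a := 0) (b := 1)
    (fun w => deriv (scaleInv a) (a τ * √(1 - w ^ 2))) y
  simp only [mul_zero, mul_one, smul_eq_mul] at this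
  rw [← this, rhoRatio]
  simp only [scaleArg, mul_pow, mul_comm (_ ^ 2) (y ^ 2)]
  ring

theorem mul_chiRatio (a : ℝ → ℝ) (τ y : ℝ) : y * chiRatio a (τ, y ^ 2) =
    ∫ w in (0 : ℝ)..y, deriv (scaleInv a) (a τ * √(1 - w ^ 2)) / (1 - w ^ 2) := by
  have := intervalIntegral.smul_integral_comp_mul_left (a := 0) (b := 1)
    (fun w => deriv (scaleInv a) (a τ * √(1 - w ^ 2)) / (1 - w ^ 2)) y
  simp only [mul_zero, mul_one, smul_eq_mul] at this
  rw [← this, chiRatio]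
  simp only [scaleArg, mul_pow, mul_comm (_ ^ 2) (y ^ 2)]

theorem mul_accRatio (a : ℝ → ℝ) (τ y : ℝ) : y * accRatio a (τ, y ^ 2) =
    ∫ w in (0 : ℝ)..y, deriv (deriv (scaleInv a)) (a τ * √(1 - w ^ 2)) / √(1 - w ^ 2) := by
  have := intervalIntegral.smul_integral_comp_mul_left (a := 0) (b := 1)
    (fun w => deriv (deriv (scaleInv a)) (a τ * √(1 - w ^ 2)) / √(1 - w ^ 2)) y
  simp only [mul_zero, mul_one, smul_eq_mul] at this
  rw [← this, accRatio]
  simp only [scaleArg, mul_pow, mul_comm (_ ^ 2) (y ^ 2)]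

theorem rhoOf_substitution (hy : y ∈ Ico (0 : ℝ) 1) :
    rhoOf a τ (1 - y ^ 2)⁻¹ = y * rhoRatio a (τ, y ^ 2) := by
  rw [rhoOf, integral_substitution hy fun w hw => rho_integrand hw, mul_rhoRatio,
    intervalIntegral.integral_const_mul]
  ring

theorem chiOf_substitution (hy : y ∈ Ico (0 : ℝ) 1) :
    chiOf a τ (1 - y ^ 2)⁻¹ = y * chiRatio a (τ, y ^ 2) := by
  rw [chiOf, integral_substitution hy fun w hw => chi_integrand hw, mul_chiRatio,
    intervalIntegral.integral_const_mul]
  ring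

theorem acc_substitution (hy : y ∈ Ico (0 : ℝ) 1) :
    ∫ s in (1 : ℝ)..(1 - y ^ 2)⁻¹, deriv (deriv (scaleInv a)) (a τ / √s) / (s * √(s - 1))
      = 2 * (y * accRatio a (τ, y ^ 2)) := by
  rw [integral_substitution hy fun w hw => acc_integrand hw, mul_accRatio,
    intervalIntegral.integral_const_mul]

theorem tOf_substitution : tOf a τ (1 - y ^ 2)⁻¹ = timeFun a (τ, y ^ 2) := by
  rw [tOf, timeFun, scaleArg, Real.sqrt_inv, div_inv_eq_mul]
  simp

theorem radius_eq : radius a τ =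
    a τ * ∫ w in (0 : ℝ)..1, deriv (scaleInv a) (a τ * √(1 - w ^ 2)) := by
  rw [radius, ← image_substitution_Ioo, integral_substitution_set measurableSet_Ioo subset_rfl
    fun w hw => rho_integrand hw, intervalIntegral.integral_of_le zero_le_one,
    integral_Ioc_eq_integral_Ioo, integral_const_mul]
  ring

end Identification

/-! ### The proper radius -/

section Radius

variable {a : ℝ → ℝ} {τ : ℝ}

theorem sq_mem_paramDomain (ha : IsRegular a) (hτ : 0 < τ) {y : ℝ} (hy : y ∈ Ioo (-1 : ℝ) 1) :
    (τ, y ^ 2) ∈ paramDomain a :=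
  ha.mem_paramDomain hτ (sq_nonneg y) (by rw [sq_lt_one_iff_abs_lt_one]; exact abs_lt.2 hy)

theorem IsRegular.hasDerivAt_mul_rhoRatio (ha : IsRegular a) (hτ : 0 < τ) {y : ℝ}
    (hy : y ∈ Ioo (-1 : ℝ) 1) :
    HasDerivAt (fun y => y * rhoRatio a (τ, y ^ 2)) (a τ * rateFun a (τ, y ^ 2)) y := by
  have hx := sq_mem_paramDomain ha hτ hy
  have h1 : HasDerivAt (fun y : ℝ => (τ, y ^ 2)) ((2 * y) • ((0 : ℝ), (1 : ℝ))) y := by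
    refine ((hasDerivAt_const y τ).prodMk (hasDerivAt_pow 2 y)).congr_deriv ?_
    simp
  have h2 := HasFDerivAt.comp_hasDerivAt (l := rhoRatio a) y
    (ha.differentiableAt_rhoRatio hx).hasFDerivAt h1
  refine ((hasDerivAt_id y).fun_mul h2).congr_deriv ?_
  rw [map_smul, ← ha.rhoRatio_add hx]
  simp only [id, Function.comp_apply, smul_eq_mul]
  ring

theorem IsRegular.hasDerivAt_mul_chiRatio (ha : IsRegular a) (hτ : 0 < τ) {y : ℝ}
    (hy : y ∈ Ioo (-1 : ℝ) 1) :
    HasDerivAt (fun y => y * chiRatio a (τ, y ^ 2)) (rateFun a (τ, y ^ 2) / (1 - y ^ 2)) y := by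
  have hx := sq_mem_paramDomain ha hτ hy
  have h1 : HasDerivAt (fun y : ℝ => (τ, y ^ 2)) ((2 * y) • ((0 : ℝ), (1 : ℝ))) y := by
    refine ((hasDerivAt_const y τ).prodMk (hasDerivAt_pow 2 y)).congr_deriv ?_
    simp
  have h2 := HasFDerivAt.comp_hasDerivAt (l := chiRatio a) y
    (ha.differentiableAt_chiRatio hx).hasFDerivAt h1
  refine ((hasDerivAt_id y).fun_mul h2).congr_deriv ?_
  rw [map_smul, ← ha.chiRatio_add hx]
  simp only [id, Function.comp_apply, smul_eq_mul]
  ring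

theorem IsRegular.strictMonoOn_mul_rhoRatio (ha : IsRegular a) (hτ : 0 < τ) :
    StrictMonoOn (fun y => y * rhoRatio a (τ, y ^ 2)) (Ioo (-1) 1) := by
  refine strictMonoOn_of_deriv_pos (convex_Ioo _ _) (fun y hy =>
    (ha.hasDerivAt_mul_rhoRatio hτ hy).continuousAt.continuousWithinAt) fun y hy => ?_
  rw [interior_Ioo] at hy
  rw [(ha.hasDerivAt_mul_rhoRatio hτ hy).deriv]
  exact mul_pos (ha.pos hτ) (ha.rateFun_pos (sq_mem_paramDomain ha hτ hy))

theorem Ico_subset_Ioo_neg_one : Ico (0 : ℝ) 1 ⊆ Ioo (-1) 1 :=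
  fun _ hy => ⟨by linarith [hy.1], hy.2⟩

/-- Monotonicity of `x b'(x)` gives `b'(a √(1 - w²)) ≤ b'(a)/√(1 - w²)`, and the bound is a multiple
of the derivative of `arcsin`. Hence the proper radius is finite and `radius` is a genuine integral,
not the default value `0`. -/
theorem IsRegular.integrableOn_deriv_scaleInv (ha : IsRegular a) (hτ : 0 < τ) :
    IntervalIntegrable (fun w => deriv (scaleInv a) (a τ * √(1 - w ^ 2))) volume 0 1 := by
  have hA := ha.pos hτ
  have hmem : ∀ w ∈ Ioo (0 : ℝ) 1, 0 < √(1 - w ^ 2) ∧ a τ * √(1 - w ^ 2) ∈ scaleRange a ∧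
      a τ * √(1 - w ^ 2) ≤ a τ := by
    intro w hw
    have h1 := (substitution_facts hw).1
    have h2 : √(1 - w ^ 2) ≤ 1 := Real.sqrt_le_one.2 (by nlinarith [sq_nonneg w])
    have h3 : a τ * √(1 - w ^ 2) ≤ a τ := by nlinarith
    exact ⟨h1, ha.mem_scaleRange_of_le ⟨τ, hτ, rfl⟩ (mul_pos hA h1) h3, h3⟩
  have harc : IntegrableOn (fun w : ℝ => 1 / √(1 - w ^ 2)) (Ioc 0 1) := by
    refine intervalIntegral.integrableOn_deriv_of_nonneg Real.continuous_arcsin.continuousOn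
      (fun w hw => ?_) (fun w _ => by positivity)
    exact Real.hasDerivAt_arcsin (by linarith [hw.1]) hw.2.ne
  rw [intervalIntegrable_iff_integrableOn_Ioo_of_le zero_le_one]
  refine Integrable.mono' ((harc.mono_set Ioo_subset_Ioc_self).const_mul
    (deriv (scaleInv a) (a τ))) ?_ ?_
  · refine ContinuousOn.aestronglyMeasurable ?_ measurableSet_Ioo
    exact ha.contDiffOn_one_deriv_scaleInv.continuousOn.comp (by fun_prop)
      fun w hw => (hmem w hw).2.1
  · rw [ae_restrict_iff' measurableSet_Ioo]
    refine Eventually.of_forall fun w hw => ?_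
    obtain ⟨h1, h2, h3⟩ := hmem w hw
    rw [Real.norm_of_nonneg (ha.deriv_scaleInv_pos h2).le]
    have := ha.mul_deriv_scaleInv_mono ⟨τ, hτ, rfl⟩ (mul_pos hA h1) h3
    rw [mul_one_div, le_div_iff₀ h1]
    nlinarith

theorem IsRegular.mul_rhoRatio_lt_radius (ha : IsRegular a) (hτ : 0 < τ) {y : ℝ}
    (hy : y ∈ Ico (0 : ℝ) 1) : y * rhoRatio a (τ, y ^ 2) < radius a τ := by
  have hA := ha.pos hτ
  have hi := ha.integrableOn_deriv_scaleInv hτ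
  have h01 : (0 : ℝ) ∈ uIcc (0 : ℝ) 1 := left_mem_uIcc
  have h11 : (1 : ℝ) ∈ uIcc (0 : ℝ) 1 := right_mem_uIcc
  have hyu : y ∈ uIcc (0 : ℝ) 1 := by rw [uIcc_of_le zero_le_one]; exact ⟨hy.1, hy.2.le⟩
  have i1 := hi.mono_set (uIcc_subset_uIcc h01 hyu)
  have i2 := hi.mono_set (uIcc_subset_uIcc hyu h11)
  rw [mul_rhoRatio, radius_eq, ← intervalIntegral.integral_add_adjacent_intervals i1 i2]
  have : 0 < ∫ w in y..1, deriv (scaleInv a) (a τ * √(1 - w ^ 2)) := by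
    refine intervalIntegral.intervalIntegral_pos_of_pos_on i2 (fun w hw => ?_) hy.2
    have hx := sq_mem_paramDomain ha hτ (y := w) ⟨by linarith [hw.1, hy.1], hw.2⟩
    simpa [rateFun, scaleArg] using ha.rateFun_pos hx
  nlinarith

/-- Integrability makes the primitive continuous up to `y = 1`, so the intermediate value theorem
applies on `[0, 1]`; the endpoint is excluded because there the value is the radius itself. -/
theorem IsRegular.exists_mul_rhoRatio_eq (ha : IsRegular a) (hτ : 0 < τ) {ρ : ℝ} (h0 : 0 ≤ ρ)
    (h1 : ρ < radius a τ) : ∃ y ∈ Ico (0 : ℝ) 1, y * rhoRatio a (τ, y ^ 2) = ρ := by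
  have hi := ha.integrableOn_deriv_scaleInv hτ
  have hc : ContinuousOn (fun y => a τ * ∫ w in (0 : ℝ)..y,
      deriv (scaleInv a) (a τ * √(1 - w ^ 2))) (Icc 0 1) := by
    refine continuousOn_const.mul ?_
    have := intervalIntegral.continuousOn_primitive_interval' hi left_mem_uIcc
    rwa [uIcc_of_le zero_le_one] at this
  obtain ⟨y, hy, rfl⟩ := intermediate_value_Icc zero_le_one hc
    (show ρ ∈ Icc _ _ from ⟨by simpa using h0, by rw [← radius_eq]; exact h1.le⟩)
  refine ⟨y, ⟨hy.1, lt_of_le_of_ne hy.2 ?_⟩, mul_rhoRatio a τ y⟩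
  rintro rfl
  simp only [← radius_eq] at h1
  exact lt_irrefl _ h1

theorem IsRegular.injOn_rhoOf (ha : IsRegular a) (hτ : 0 < τ) : InjOn (rhoOf a τ) (Ici 1) := by
  intro σ hσ σ' hσ' h
  obtain ⟨h1, h2⟩ := substitution_sqrt hσ
  obtain ⟨h1', h2'⟩ := substitution_sqrt hσ'
  rw [← h2, ← h2', rhoOf_substitution h1, rhoOf_substitution h1'] at h
  have := (ha.strictMonoOn_mul_rhoRatio hτ).injOn (Ico_subset_Ioo_neg_one h1)
    (Ico_subset_Ioo_neg_one h1') h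
  rw [← h2, ← h2', this]

theorem IsRegular.sigmaOf_eq (ha : IsRegular a) (hτ : 0 < τ) {y : ℝ} (hy : y ∈ Ico (0 : ℝ) 1) :
    sigmaOf a τ (y * rhoRatio a (τ, y ^ 2)) = (1 - y ^ 2)⁻¹ := by
  rw [← rhoOf_substitution hy, sigmaOf]
  exact (ha.injOn_rhoOf hτ).leftInvOn_invFunOn (mem_Ici.2 (one_le_substitution hy))

end Radius

/-! ### The auxiliary coordinates `(τ, y ω)` -/

/-- The range of the auxiliary coordinates `(τ, y ω)`. -/
def auxDomain : Set R4 := {q | 0 < q.1 ∧ ‖q.2‖ < 1}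

/-- The parameters `(τ, r)`, `r = |y|²`. -/
def auxParam (q : R4) : ℝ × ℝ := (q.1, ‖q.2‖ ^ 2)

/-- From auxiliary to Fermi coordinates. -/
def auxToFermi (a : ℝ → ℝ) (q : R4) : R4 := (q.1, rhoRatio a (auxParam q) • q.2)

/-- From auxiliary to cosmological coordinates. -/
def auxToCosmo (a : ℝ → ℝ) (q : R4) : R4 := (timeFun a (auxParam q), chiRatio a (auxParam q) • q.2)

section Aux

variable {a : ℝ → ℝ}

theorem isOpen_auxDomain : IsOpen auxDomain := by
  have : auxDomain = {q : R4 | 0 < q.1} ∩ {q : R4 | ‖q.2‖ < 1} := rfl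
  rw [this]
  exact (isOpen_lt (by fun_prop) (by fun_prop)).inter (isOpen_lt (by fun_prop) (by fun_prop))

theorem contDiff_auxParam {n : WithTop ℕ∞} : ContDiff ℝ n auxParam :=
  contDiff_fst.prodMk (contDiff_snd.norm_sq ℝ)

theorem norm_mem_Ico {q : R4} (hq : q ∈ auxDomain) : ‖q.2‖ ∈ Ico (0 : ℝ) 1 :=
  ⟨norm_nonneg _, hq.2⟩

theorem IsRegular.auxParam_mem (ha : IsRegular a) {q : R4} (hq : q ∈ auxDomain) :
    auxParam q ∈ paramDomain a :=
  sq_mem_paramDomain ha hq.1 (Ico_subset_Ioo_neg_one (norm_mem_Ico hq))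

theorem fderiv_auxParam (q : R4) (v : R4) :
    fderiv ℝ auxParam q v = (v.1, 2 * inner ℝ q.2 v.2) := by
  have hsnd : HasFDerivAt (fun q : R4 => q.2) (ContinuousLinearMap.snd ℝ ℝ R3) q :=
    hasFDerivAt_snd
  have hfst : HasFDerivAt (fun q : R4 => q.1) (ContinuousLinearMap.fst ℝ ℝ R3) q :=
    hasFDerivAt_fst
  have h : HasFDerivAt auxParam _ q := hfst.prodMk hsnd.norm_sq
  rw [h.fderiv]
  simp

theorem IsRegular.contDiffOn_auxToFermi (ha : IsRegular a) {n : ℕ∞}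
    (h : ContDiffOn ℝ (n + 2) a (Ioi 0)) : ContDiffOn ℝ (n + 1) (auxToFermi a) auxDomain :=
  contDiffOn_fst.prodMk (((ha.contDiffOn_rhoRatio h).comp contDiff_auxParam.contDiffOn
    fun _ hq => ha.auxParam_mem hq).smul contDiffOn_snd)

theorem IsRegular.contDiffOn_auxToCosmo (ha : IsRegular a) {n : ℕ∞}
    (h : ContDiffOn ℝ (n + 2) a (Ioi 0)) : ContDiffOn ℝ (n + 1) (auxToCosmo a) auxDomain :=
  ((ha.contDiffOn_timeFun h).comp contDiff_auxParam.contDiffOn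
    fun _ hq => ha.auxParam_mem hq).prodMk
    (((ha.contDiffOn_chiRatio h).comp contDiff_auxParam.contDiffOn
    fun _ hq => ha.auxParam_mem hq).smul contDiffOn_snd)

theorem fderiv_comp_auxParam {f : ℝ × ℝ → ℝ} {q : R4} (hf : DifferentiableAt ℝ f (auxParam q))
    (v : R4) :
    DifferentiableAt ℝ (fun q => f (auxParam q)) q ∧
    fderiv ℝ (fun q => f (auxParam q)) q v = fderiv ℝ f (auxParam q) (1, 0) * v.1
      + fderiv ℝ f (auxParam q) (0, 1) * (2 * inner ℝ q.2 v.2) := by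
  have h1 := (contDiff_auxParam (n := 1)).differentiable (by simp) q
  have h2 : HasFDerivAt (fun q => f (auxParam q)) _ q := hf.hasFDerivAt.comp q h1.hasFDerivAt
  refine ⟨h2.differentiableAt, ?_⟩
  rw [h2.fderiv, ContinuousLinearMap.comp_apply, fderiv_auxParam]
  have : (v.1, 2 * inner ℝ q.2 v.2) = v.1 • ((1 : ℝ), (0 : ℝ)) +
      (2 * inner ℝ q.2 v.2) • ((0 : ℝ), (1 : ℝ)) := by simp
  rw [this, map_add, map_smul, map_smul]
  simp only [smul_eq_mul]
  ring

theorem IsRegular.fderiv_auxToFermi (ha : IsRegular a) {q : R4} (hq : q ∈ auxDomain) (v : R4) :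
    fderiv ℝ (auxToFermi a) q v = (v.1, rhoRatio a (auxParam q) • v.2 +
      (deriv a q.1 * (rateFun a (auxParam q) + a q.1 * accRatio a (auxParam q)) * v.1
        + fderiv ℝ (rhoRatio a) (auxParam q) (0, 1) * (2 * inner ℝ q.2 v.2)) • q.2) := by
  have hx := ha.auxParam_mem hq
  obtain ⟨h1, h2⟩ := fderiv_comp_auxParam (ha.differentiableAt_rhoRatio hx) v
  have hsnd : HasFDerivAt (fun q : R4 => q.2) (ContinuousLinearMap.snd ℝ ℝ R3) q :=
    hasFDerivAt_snd
  have hfst : HasFDerivAt (fun q : R4 => q.1) (ContinuousLinearMap.fst ℝ ℝ R3) q :=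
    hasFDerivAt_fst
  have h : HasFDerivAt (auxToFermi a) _ q := hfst.prodMk (h1.hasFDerivAt.fun_smul hsnd)
  rw [h.fderiv]
  have h3 := ha.fderiv_rhoRatio_fst hx
  simp only [ContinuousLinearMap.prod_apply, ContinuousLinearMap.coe_fst',
    add_apply, smul_apply, ContinuousLinearMap.coe_snd',
    ContinuousLinearMap.smulRight_apply, h2, h3]
  rfl

theorem IsRegular.differentiableAt_timeFun (ha : IsRegular a) {x : ℝ × ℝ}
    (hx : x ∈ paramDomain a) : DifferentiableAt ℝ (timeFun a) x :=
  ((ha.contDiffOn_timeFun ha.contDiffOn_two).contDiffAt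
    (ha.isOpen_paramDomain.mem_nhds hx)).differentiableAt (by simp)

theorem IsRegular.fderiv_auxToCosmo (ha : IsRegular a) {q : R4} (hq : q ∈ auxDomain) (v : R4) :
    fderiv ℝ (auxToCosmo a) q v =
      (rateFun a (auxParam q) * (deriv a q.1 * √(1 - ‖q.2‖ ^ 2) * v.1
        - a q.1 / √(1 - ‖q.2‖ ^ 2) * inner ℝ q.2 v.2),
      chiRatio a (auxParam q) • v.2 +
      (deriv a q.1 * accRatio a (auxParam q) * v.1
        + fderiv ℝ (chiRatio a) (auxParam q) (0, 1) * (2 * inner ℝ q.2 v.2)) • q.2) := by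
  have hx := ha.auxParam_mem hq
  obtain ⟨h1, h2⟩ := fderiv_comp_auxParam (ha.differentiableAt_chiRatio hx) v
  obtain ⟨h3, h4⟩ := fderiv_comp_auxParam (ha.differentiableAt_timeFun hx) v
  have hsnd : HasFDerivAt (fun q : R4 => q.2) (ContinuousLinearMap.snd ℝ ℝ R3) q :=
    hasFDerivAt_snd
  have h : HasFDerivAt (auxToCosmo a) _ q := h3.hasFDerivAt.prodMk (h1.hasFDerivAt.fun_smul hsnd)
  rw [h.fderiv]
  simp only [ContinuousLinearMap.prod_apply,
    add_apply, smul_apply, ContinuousLinearMap.coe_snd',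
    ContinuousLinearMap.smulRight_apply, h2, h4, ha.fderiv_chiRatio_fst hx, ha.fderiv_timeFun hx]
  refine Prod.ext ?_ rfl
  simp only [auxParam]
  ring

/-- Pairing the spatial part with `q.2` isolates the radial component, which `rhoRatio_add`
multiplies by the positive number `dρ/dy`; what remains is a nonzero multiple of `v.2`. -/
theorem IsRegular.auxToFermi_ker (ha : IsRegular a) {q : R4} (hq : q ∈ auxDomain) (v : R4)
    (hv : fderiv ℝ (auxToFermi a) q v = 0) : v = 0 := by
  have hx := ha.auxParam_mem hq
  rw [ha.fderiv_auxToFermi hq, Prod.mk_eq_zero] at hv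
  obtain ⟨h1, h2⟩ := hv
  rw [h1] at h2
  have h3 := congrArg (fun z => inner ℝ q.2 z) h2
  simp only [inner_add_right, inner_smul_right, inner_zero_right,
    real_inner_self_eq_norm_sq] at h3
  have h4 := ha.rhoRatio_add hx
  have h5 : (a q.1 * rateFun a (auxParam q)) * inner ℝ q.2 v.2 = 0 := by
    change rhoRatio a (auxParam q) + 2 * ‖q.2‖ ^ 2 * _ = a q.1 * _ at h4
    rw [← h4]
    linear_combination h3
  have h6 := (mul_eq_zero.1 h5).resolve_left
    (mul_pos (ha.pos hq.1) (ha.rateFun_pos hx)).ne'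
  rw [h6] at h2
  have h7 : rhoRatio a (auxParam q) • v.2 = 0 := by simpa using h2
  exact Prod.ext h1 ((smul_eq_zero.1 h7).resolve_left (ha.rhoRatio_pos hx).ne')

theorem IsRegular.auxToCosmo_ker (ha : IsRegular a) {q : R4} (hq : q ∈ auxDomain) (v : R4)
    (hv : fderiv ℝ (auxToCosmo a) q v = 0) : v = 0 := by
  have hx := ha.auxParam_mem hq
  have hA := ha.pos hq.1
  have hA' := ha.deriv_pos hq.1
  have hβ := ha.rateFun_pos hx
  have hr : (0 : ℝ) < 1 - ‖q.2‖ ^ 2 := sub_pos.2 hx.2.1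
  have hc : 0 < √(1 - ‖q.2‖ ^ 2) := Real.sqrt_pos.2 hr
  have hc2 : √(1 - ‖q.2‖ ^ 2) ^ 2 = 1 - ‖q.2‖ ^ 2 := Real.sq_sqrt hr.le
  rw [ha.fderiv_auxToCosmo hq, Prod.mk_eq_zero] at hv
  obtain ⟨h1, h2⟩ := hv
  replace h1 := (mul_eq_zero.1 h1).resolve_left hβ.ne'
  have h3 := congrArg (fun z => inner ℝ q.2 z) h2
  simp only [inner_add_right, inner_smul_right, inner_zero_right,
    real_inner_self_eq_norm_sq] at h3
  have h4 := ha.chiRatio_add hx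
  change chiRatio a (auxParam q) + 2 * ‖q.2‖ ^ 2 * _ = _ / (1 - ‖q.2‖ ^ 2) at h4
  set α : ℝ := inner ℝ q.2 v.2
  set β := rateFun a (auxParam q)
  set K := accRatio a (auxParam q)
  have hα : a q.1 * α = deriv a q.1 * (1 - ‖q.2‖ ^ 2) * v.1 := by
    rw [sub_eq_zero] at h1
    field_simp at h1
    rw [hc2] at h1
    linarith
  have h5 : α * β / (1 - ‖q.2‖ ^ 2) + ‖q.2‖ ^ 2 * deriv a q.1 * K * v.1 = 0 := by
    rw [mul_div_assoc, ← h4]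
    linear_combination h3
  have hpos := ha.rateFun_add_pos hx (sq_nonneg _)
  change 0 < β + a q.1 * ‖q.2‖ ^ 2 * K at hpos
  -- Eliminating the radial component `α` between the time and the radial equations leaves `v.1`
  -- times the positive factor of `rateFun_add_pos`.
  have h6 : deriv a q.1 * (β + a q.1 * ‖q.2‖ ^ 2 * K) * v.1 = 0 := by
    field_simp at h5
    have h7 : (1 - ‖q.2‖ ^ 2) * (deriv a q.1 * (β + a q.1 * ‖q.2‖ ^ 2 * K) * v.1) = 0 := by
      linear_combination (a q.1) * h5 - β * hα
    exact (mul_eq_zero.1 h7).resolve_left hr.ne'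
  have hv1 : v.1 = 0 := (mul_eq_zero.1 h6).resolve_left (mul_pos hA' hpos).ne'
  have hα0 : α = 0 := by
    rw [hv1, mul_zero] at hα
    exact (mul_eq_zero.1 hα).resolve_left hA.ne'
  rw [hv1, hα0] at h2
  have h7 : chiRatio a (auxParam q) • v.2 = 0 := by simpa using h2
  exact Prod.ext hv1 ((smul_eq_zero.1 h7).resolve_left (ha.chiRatio_pos hx).ne')

theorem norm_auxToFermi (ha : IsRegular a) {q : R4} (hq : q ∈ auxDomain) :
    ‖(auxToFermi a q).2‖ = ‖q.2‖ * rhoRatio a (q.1, ‖q.2‖ ^ 2) := by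
  have := ha.rhoRatio_pos (ha.auxParam_mem hq)
  rw [auxToFermi, norm_smul, Real.norm_of_nonneg this.le, mul_comm]
  rfl

theorem norm_auxToCosmo (ha : IsRegular a) {q : R4} (hq : q ∈ auxDomain) :
    ‖(auxToCosmo a q).2‖ = ‖q.2‖ * chiRatio a (q.1, ‖q.2‖ ^ 2) := by
  have := ha.chiRatio_pos (ha.auxParam_mem hq)
  rw [auxToCosmo, norm_smul, Real.norm_of_nonneg this.le, mul_comm]
  rfl

theorem IsRegular.sigmaOf_auxToFermi (ha : IsRegular a) {q : R4} (hq : q ∈ auxDomain) :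
    sigmaOf a q.1 ‖(auxToFermi a q).2‖ = (1 - ‖q.2‖ ^ 2)⁻¹ := by
  rw [norm_auxToFermi ha hq, ha.sigmaOf_eq hq.1 (norm_mem_Ico hq)]

theorem IsRegular.fermiPoint_auxToFermi (ha : IsRegular a) {q : R4} (hq : q ∈ auxDomain) :
    fermiPoint a (auxToFermi a q) = auxToCosmo a q := by
  have h1 : fermiPoint a (auxToFermi a q) = (tOf a q.1 (sigmaOf a q.1 ‖(auxToFermi a q).2‖),
      (chiOf a q.1 (sigmaOf a q.1 ‖(auxToFermi a q).2‖) / ‖(auxToFermi a q).2‖) •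
        (auxToFermi a q).2) := rfl
  rw [h1, ha.sigmaOf_auxToFermi hq, chiOf_substitution (norm_mem_Ico hq), tOf_substitution,
    norm_auxToFermi ha hq]
  refine Prod.ext rfl ?_
  change _ • (rhoRatio a (auxParam q) • q.2) = chiRatio a (auxParam q) • q.2
  -- At the origin `fermiPoint` divides by zero, harmlessly, since the quotient multiplies the zero
  -- vector.
  by_cases h0 : q.2 = 0
  · simp [h0]
  · rw [smul_smul]
    congr 1
    have h2 : ‖q.2‖ ≠ 0 := norm_ne_zero_iff.2 h0
    have h3 := (ha.rhoRatio_pos (ha.auxParam_mem hq)).ne'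
    simp only [auxParam] at h3 ⊢
    field_simp

theorem IsRegular.image_auxToFermi (ha : IsRegular a) :
    auxToFermi a '' auxDomain = fermiRange a := by
  ext p
  constructor
  · rintro ⟨q, hq, rfl⟩
    refine ⟨hq.1, ?_⟩
    rw [norm_auxToFermi ha hq]
    exact ha.mul_rhoRatio_lt_radius hq.1 (norm_mem_Ico hq)
  · rintro ⟨h1, h2⟩
    obtain ⟨y, hy, hρ⟩ := ha.exists_mul_rhoRatio_eq h1 (norm_nonneg p.2) h2
    have hP := ha.rhoRatio_pos (sq_mem_paramDomain ha h1 (Ico_subset_Ioo_neg_one hy))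
    have hn : ‖(rhoRatio a (p.1, y ^ 2))⁻¹ • p.2‖ = y := by
      rw [norm_smul, norm_inv, Real.norm_of_nonneg hP.le, ← hρ]
      field_simp
    refine ⟨(p.1, (rhoRatio a (p.1, y ^ 2))⁻¹ • p.2), ⟨h1, by rw [hn]; exact hy.2⟩, ?_⟩
    simp only [auxToFermi, auxParam, hn]
    rw [smul_smul, mul_inv_cancel₀ hP.ne', one_smul]

theorem IsRegular.injOn_auxToFermi (ha : IsRegular a) : InjOn (auxToFermi a) auxDomain := by
  intro q hq q' hq' h
  have h1 : (auxToFermi a q).1 = (auxToFermi a q').1 := congrArg Prod.fst h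
  change q.1 = q'.1 at h1
  have h2 : ‖(auxToFermi a q).2‖ = ‖(auxToFermi a q').2‖ := by rw [h]
  rw [norm_auxToFermi ha hq, norm_auxToFermi ha hq', ← h1] at h2
  have h3 := (ha.strictMonoOn_mul_rhoRatio hq.1).injOn
    (Ico_subset_Ioo_neg_one (norm_mem_Ico hq)) (Ico_subset_Ioo_neg_one (norm_mem_Ico hq')) h2
  have h4 : auxParam q = auxParam q' := by simp only [auxParam, h1, h3]
  have h5 : rhoRatio a (auxParam q) • q.2 = rhoRatio a (auxParam q') • q'.2 :=
    congrArg Prod.snd h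
  rw [← h4] at h5
  exact Prod.ext h1 (smul_right_injective _ (ha.rhoRatio_pos (ha.auxParam_mem hq)).ne' h5)

theorem IsRegular.fermiDomain_eq (ha : IsRegular a) :
    fermiDomain a = auxToCosmo a '' auxDomain := by
  rw [fermiDomain, ← ha.image_auxToFermi, image_image]
  exact image_congr fun q hq => ha.fermiPoint_auxToFermi hq

end Aux

/-! ### Uniqueness of the coordinates of an event -/

/-- The squared radial coordinate of the event at time `t` on the slice of `τ`. -/
def chiSq (a : ℝ → ℝ) (t τ : ℝ) : ℝ :=
  (1 - (a t / a τ) ^ 2) * chiRatio a (τ, 1 - (a t / a τ) ^ 2) ^ 2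

section Uniqueness

variable {a : ℝ → ℝ}

theorem IsRegular.ratio_mem (ha : IsRegular a) {t τ : ℝ} (ht : 0 < t) (h : t ≤ τ) :
    0 < a t / a τ ∧ a t / a τ ≤ 1 := by
  have h1 := ha.pos ht
  have h2 := ha.pos (ht.trans_le h)
  refine ⟨div_pos h1 h2, (div_le_one h2).2 ?_⟩
  exact ha.strictMonoOn.monotoneOn (mem_Ici.2 ht.le) (mem_Ici.2 (ht.le.trans h)) h

theorem IsRegular.one_sub_ratio_sq (ha : IsRegular a) {t τ : ℝ} (ht : 0 < t) (h : t ≤ τ) :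
    0 ≤ 1 - (a t / a τ) ^ 2 ∧ 1 - (a t / a τ) ^ 2 < 1 := by
  obtain ⟨h1, h2⟩ := ha.ratio_mem ht h
  exact ⟨sub_nonneg.2 (pow_le_one₀ h1.le h2), by linarith [pow_pos h1 2]⟩

/-- At fixed `t` one has `dr/dτ = 2 (1 - r) ȧ/a`, and the identities for `G` give `d(χ²)/dτ = 2 G
(ȧ/a) (b' + a r K)`, positive by `rateFun_add_pos`. Working with `χ²` avoids the square root at `τ =
t`. -/
theorem IsRegular.hasDerivAt_chiSq (ha : IsRegular a) {t τ : ℝ} (ht : 0 < t) (h : t ≤ τ) :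
    ∃ H' > 0, HasDerivAt (chiSq a t) H' τ := by
  have hτ := ht.trans_le h
  have hA := ha.pos hτ
  have hA' := ha.deriv_pos hτ
  obtain ⟨hr0, hr1⟩ := ha.one_sub_ratio_sq ht h
  have hx := ha.mem_paramDomain hτ hr0 hr1
  have h1 : HasDerivAt (fun τ => 1 - (a t / a τ) ^ 2)
      (2 * (1 - (1 - (a t / a τ) ^ 2)) * deriv a τ / a τ) τ := by
    refine ((((hasDerivAt_const τ (a t)).fun_div (ha.hasDerivAt hτ) hA.ne').fun_pow
      2).const_sub 1).congr_deriv ?_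
    simp only [Nat.cast_ofNat, Nat.reduceSub, pow_one]
    field_simp
    ring
  have h2 := HasFDerivAt.comp_hasDerivAt (l := chiRatio a) τ
    (ha.differentiableAt_chiRatio hx).hasFDerivAt ((hasDerivAt_id τ).prodMk h1)
  have h3 := h1.fun_mul (h2.fun_pow 2)
  refine ⟨_, ?_, h3⟩
  have hpos := ha.rateFun_add_pos hx hr0
  have hG := ha.chiRatio_pos hx
  have h4 := ha.chiRatio_add hx
  have h5 := ha.fderiv_chiRatio_fst hx
  simp only [Function.comp_apply, id] at h4 h5 hpos ⊢
  set r := 1 - (a t / a τ) ^ 2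
  have hv : ((1 : ℝ), 2 * (1 - r) * deriv a τ / a τ) = (1 : ℝ) • ((1 : ℝ), (0 : ℝ)) +
      (2 * (1 - r) * deriv a τ / a τ) • ((0 : ℝ), (1 : ℝ)) := by simp
  have hr : 1 - r ≠ 0 := by linarith
  rw [hv, map_add, map_smul, map_smul, h5]
  have h6 : 0 < 2 * chiRatio a (τ, r) * (deriv a τ / a τ) *
      (rateFun a (τ, r) + a τ * r * accRatio a (τ, r)) := by positivity
  convert h6 using 1
  rw [eq_div_iff hr] at h4
  simp only [smul_eq_mul]
  field_simp
  linear_combination 2 * chiRatio a (τ, r) * h4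

theorem IsRegular.strictMonoOn_chiSq (ha : IsRegular a) {t : ℝ} (ht : 0 < t) :
    StrictMonoOn (chiSq a t) (Ici t) := by
  refine strictMonoOn_of_deriv_pos (convex_Ici t) (fun τ hτ => ?_) fun τ hτ => ?_
  · obtain ⟨H', -, h⟩ := ha.hasDerivAt_chiSq ht hτ
    exact h.continuousAt.continuousWithinAt
  · rw [interior_Ici] at hτ
    obtain ⟨H', h0, h⟩ := ha.hasDerivAt_chiSq ht (le_of_lt hτ)
    rwa [h.deriv]

theorem IsRegular.aux_time (ha : IsRegular a) {q : R4} (hq : q ∈ auxDomain) :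
    0 < timeFun a (auxParam q) ∧ timeFun a (auxParam q) ≤ q.1 ∧
      a (timeFun a (auxParam q)) = a q.1 * √(1 - ‖q.2‖ ^ 2) ∧
      1 - (a (timeFun a (auxParam q)) / a q.1) ^ 2 = ‖q.2‖ ^ 2 := by
  have hx := ha.auxParam_mem hq
  have hA := ha.pos hq.1
  have h1 : 0 < timeFun a (auxParam q) := ha.scaleInv_pos hx.2.2
  have h2 : a (timeFun a (auxParam q)) = a q.1 * √(1 - ‖q.2‖ ^ 2) := by
    rw [timeFun, ha.apply_scaleInv hx.2.2, scaleArg]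
    simp [auxParam]
  have h3 : √(1 - ‖q.2‖ ^ 2) ≤ 1 := Real.sqrt_le_one.2 (by nlinarith [sq_nonneg ‖q.2‖])
  refine ⟨h1, ?_, h2, ?_⟩
  · refine (ha.strictMonoOn.le_iff_le (mem_Ici.2 h1.le) (mem_Ici.2 (le_of_lt hq.1))).1 ?_
    rw [h2]
    nlinarith
  · have h4 : (0 : ℝ) < 1 - ‖q.2‖ ^ 2 := sub_pos.2 hx.2.1
    rw [h2, mul_div_cancel_left₀ _ hA.ne', Real.sq_sqrt h4.le]
    ring

theorem IsRegular.chiSq_aux (ha : IsRegular a) {q : R4} (hq : q ∈ auxDomain) :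
    chiSq a (auxToCosmo a q).1 q.1 = ‖(auxToCosmo a q).2‖ ^ 2 := by
  rw [norm_auxToCosmo ha hq, chiSq]
  change (1 - (a (timeFun a (auxParam q)) / a q.1) ^ 2) *
    chiRatio a (q.1, 1 - (a (timeFun a (auxParam q)) / a q.1) ^ 2) ^ 2 = _
  rw [(ha.aux_time hq).2.2.2]
  ring

/-- Distinct slices do not meet: at a given `t` the parameter `r` is a function of `τ`, and strict
monotonicity of `χ²` in `τ` then fixes `τ`. -/
theorem IsRegular.injOn_auxToCosmo (ha : IsRegular a) : InjOn (auxToCosmo a) auxDomain := by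
  intro q hq q' hq' h
  obtain ⟨h1, h2, -, h3⟩ := ha.aux_time hq
  obtain ⟨-, h2', -, h3'⟩ := ha.aux_time hq'
  have ht : timeFun a (auxParam q) = timeFun a (auxParam q') := congrArg Prod.fst h
  have h4 := ha.chiSq_aux hq
  rw [h, ← ha.chiSq_aux hq'] at h4
  have h5 : q.1 = q'.1 := (ha.strictMonoOn_chiSq h1).injOn h2 (by rw [ht]; exact h2')
    (by rw [ht]; exact h4)
  have h6 : auxParam q = auxParam q' := by
    rw [auxParam, auxParam, ← h3, ← h3', ← ht, h5]
  have h7 : chiRatio a (auxParam q) • q.2 = chiRatio a (auxParam q') • q'.2 :=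
    congrArg Prod.snd h
  rw [← h6] at h7
  exact Prod.ext h5 (smul_right_injective _ (ha.chiRatio_pos (ha.auxParam_mem hq)).ne' h7)

theorem IsRegular.injOn_fermiPoint (ha : IsRegular a) : InjOn (fermiPoint a) (fermiRange a) := by
  rw [← ha.image_auxToFermi]
  rintro _ ⟨q, hq, rfl⟩ _ ⟨q', hq', rfl⟩ h
  rw [ha.fermiPoint_auxToFermi hq, ha.fermiPoint_auxToFermi hq'] at h
  rw [ha.injOn_auxToCosmo hq hq' h]

theorem IsRegular.fermiCoord_auxToCosmo (ha : IsRegular a) {q : R4} (hq : q ∈ auxDomain) :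
    fermiCoord a (auxToCosmo a q) = auxToFermi a q := by
  rw [← ha.fermiPoint_auxToFermi hq]
  exact ha.injOn_fermiPoint.leftInvOn_invFunOn (by
    rw [← ha.image_auxToFermi]; exact mem_image_of_mem _ hq)

end Uniqueness

/-! ### Regularity of the coordinate maps -/

section Regularity

variable {a : ℝ → ℝ}

theorem IsRegular.isOpen_fermiRange (ha : IsRegular a) : IsOpen (fermiRange a) := by
  rw [← ha.image_auxToFermi]
  exact isOpen_image_of_fderiv_injective (by simp) isOpen_auxDomain
    (ha.contDiffOn_auxToFermi ha.contDiffOn_two) fun q hq v => ha.auxToFermi_ker hq v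

theorem IsRegular.isOpen_fermiDomain (ha : IsRegular a) : IsOpen (fermiDomain a) := by
  rw [ha.fermiDomain_eq]
  exact isOpen_image_of_fderiv_injective (by simp) isOpen_auxDomain
    (ha.contDiffOn_auxToCosmo ha.contDiffOn_two) fun q hq v => ha.auxToCosmo_ker hq v

/-- On its range `fermiPoint` is `auxToCosmo` after the inverse of `auxToFermi`, so the regularity
of `sigmaOf` and of the quotient by `‖q.2‖` never has to be studied. -/
theorem IsRegular.contDiffOn_fermiPoint (ha : IsRegular a) {n : ℕ∞}
    (h : ContDiffOn ℝ (n + 2) a (Ioi 0)) : ContDiffOn ℝ (n + 1) (fermiPoint a) (fermiRange a) := by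
  have hl : ∀ q ∈ auxDomain, Function.invFunOn (auxToFermi a) auxDomain (auxToFermi a q) = q :=
    fun q hq => ha.injOn_auxToFermi.leftInvOn_invFunOn hq
  have h1 := contDiffOn_leftInverse (by simp) isOpen_auxDomain (ha.contDiffOn_auxToFermi h)
    (fun q hq v => ha.auxToFermi_ker hq v) hl
  rw [← ha.image_auxToFermi]
  refine ((ha.contDiffOn_auxToCosmo h).comp h1 ?_).congr ?_
  · rintro _ ⟨q, hq, rfl⟩
    rwa [hl q hq]
  · rintro _ ⟨q, hq, rfl⟩
    rw [Function.comp_apply, hl q hq, ha.fermiPoint_auxToFermi hq]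

theorem IsRegular.contDiffOn_fermiCoord (ha : IsRegular a) {n : ℕ∞}
    (h : ContDiffOn ℝ (n + 2) a (Ioi 0)) :
    ContDiffOn ℝ (n + 1) (fermiCoord a) (fermiDomain a) := by
  have hl : ∀ q ∈ auxDomain, Function.invFunOn (auxToCosmo a) auxDomain (auxToCosmo a q) = q :=
    fun q hq => ha.injOn_auxToCosmo.leftInvOn_invFunOn hq
  have h1 := contDiffOn_leftInverse (by simp) isOpen_auxDomain (ha.contDiffOn_auxToCosmo h)
    (fun q hq v => ha.auxToCosmo_ker hq v) hl
  rw [ha.fermiDomain_eq]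
  refine ((ha.contDiffOn_auxToFermi h).comp h1 ?_).congr ?_
  · rintro _ ⟨q, hq, rfl⟩
    rwa [hl q hq]
  · rintro _ ⟨q, hq, rfl⟩
    rw [Function.comp_apply, hl q hq, ha.fermiCoord_auxToCosmo hq]

theorem IsRegular.fermiCoord_image (ha : IsRegular a) :
    fermiCoord a '' fermiDomain a = fermiRange a := by
  rw [ha.fermiDomain_eq, ← ha.image_auxToFermi, image_image]
  exact image_congr fun q hq => ha.fermiCoord_auxToCosmo hq

/-- The chain rule for `auxToCosmo = fermiPoint ∘ auxToFermi`. Every tangent vector being an image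
under the derivative of `auxToFermi`, this determines the derivative of `fermiPoint`. -/
theorem IsRegular.fderiv_fermiPoint_aux (ha : IsRegular a) {q : R4} (hq : q ∈ auxDomain) (v : R4) :
    fderiv ℝ (fermiPoint a) (auxToFermi a q) (fderiv ℝ (auxToFermi a) q v)
      = fderiv ℝ (auxToCosmo a) q v := by
  have hp : auxToFermi a q ∈ fermiRange a := by
    rw [← ha.image_auxToFermi]; exact mem_image_of_mem _ hq
  have h1 : DifferentiableAt ℝ (fermiPoint a) (auxToFermi a q) :=
    ((ha.contDiffOn_fermiPoint ha.contDiffOn_two).contDiffAt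
      (ha.isOpen_fermiRange.mem_nhds hp)).differentiableAt (by simp)
  have h2 : DifferentiableAt ℝ (auxToFermi a) q :=
    ((ha.contDiffOn_auxToFermi ha.contDiffOn_two).contDiffAt
      (isOpen_auxDomain.mem_nhds hq)).differentiableAt (by simp)
  have h3 : auxToCosmo a =ᶠ[𝓝 q] fermiPoint a ∘ auxToFermi a := by
    filter_upwards [isOpen_auxDomain.mem_nhds hq] with z hz
    exact (ha.fermiPoint_auxToFermi hz).symm
  rw [h3.fderiv_eq, fderiv_comp q h1 h2]
  rfl

theorem IsRegular.fderiv_auxToFermi_surjective (ha : IsRegular a) {q : R4} (hq : q ∈ auxDomain)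
    (u : R4) : ∃ v, fderiv ℝ (auxToFermi a) q v = u := by
  obtain ⟨L, hL⟩ := exists_equiv_of_injective _ fun v => ha.auxToFermi_ker hq v
  exact ⟨L.symm u, by rw [← hL]; simp⟩

end Regularity

/-! ### The tetrad along the worldline -/

section Tetrad

variable {a : ℝ → ℝ} {τ : ℝ}

theorem zero_mem_auxDomain (hτ : 0 < τ) : ((τ, 0) : R4) ∈ auxDomain := ⟨hτ, by simp⟩

theorem auxToFermi_zero : auxToFermi a (τ, 0) = (τ, 0) := by simp [auxToFermi]

theorem auxParam_zero : auxParam (τ, 0) = (τ, 0) := by simp [auxParam]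

theorem IsRegular.auxToCosmo_zero (ha : IsRegular a) (hτ : 0 < τ) :
    auxToCosmo a (τ, 0) = (τ, 0) := by
  simp [auxToCosmo, timeFun, scaleArg, auxParam_zero, ha.scaleInv_apply hτ.le]

theorem IsRegular.rateFun_zero (ha : IsRegular a) (hτ : 0 < τ) :
    rateFun a (τ, 0) = (deriv a τ)⁻¹ := by
  simp only [rateFun, scaleArg, mul_zero, sub_zero, Real.sqrt_one, mul_one]
  rw [ha.deriv_scaleInv ⟨τ, hτ, rfl⟩, ha.scaleInv_apply hτ.le]

theorem IsRegular.fderiv_fermiPoint_zero (ha : IsRegular a) (hτ : 0 < τ) (u : R4) :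
    fderiv ℝ (fermiPoint a) (τ, 0) u = (u.1, (a τ)⁻¹ • u.2) := by
  have hq := zero_mem_auxDomain hτ
  have hx := ha.auxParam_mem hq
  have hA := (ha.pos hτ).ne'
  have hA' := ha.deriv_ne_zero τ hτ
  have h1 := ha.rhoRatio_add hx
  have h2 := ha.chiRatio_add hx
  -- At the origin `P = a/ȧ` and `G = 1/ȧ`; the factor `ȧ/a` is chosen so that the derivative of
  -- `auxToFermi` returns `u`.
  have h3 := ha.fderiv_fermiPoint_aux hq (u.1, (deriv a τ / a τ) • u.2)
  rw [ha.fderiv_auxToFermi hq, ha.fderiv_auxToCosmo hq] at h3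
  rw [auxParam_zero] at *
  simp only [mul_zero, zero_mul, add_zero, sub_zero, div_one, ha.rateFun_zero hτ] at h1 h2
  simp only [h1, h2, auxToFermi_zero, inner_zero_left, mul_zero, smul_zero, add_zero, norm_zero,
    ne_eq, OfNat.ofNat_ne_zero, not_false_eq_true, zero_pow, sub_zero, Real.sqrt_one, mul_one,
    ha.rateFun_zero hτ, smul_smul] at h3
  have e1 : a τ * (deriv a τ)⁻¹ * (deriv a τ / a τ) = 1 := by field_simp
  have e2 : (deriv a τ)⁻¹ * (deriv a τ / a τ) = (a τ)⁻¹ := by field_simp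
  have e3 : (deriv a τ)⁻¹ * (deriv a τ * u.1) = u.1 := by field_simp
  rw [e1, e2, e3, one_smul] at h3
  exact h3

theorem IsRegular.fermiFrame_zero (ha : IsRegular a) (hτ : 0 < τ) :
    fermiFrame a 0 τ = (1, 0) := by
  rw [fermiFrame, ha.fderiv_fermiPoint_zero hτ]
  simp

theorem IsRegular.fermiFrame_succ (ha : IsRegular a) (hτ : 0 < τ) (j : Fin 3) :
    fermiFrame a j.succ τ = (0, (a τ)⁻¹ • EuclideanSpace.single j 1) := by
  rw [fermiFrame, ha.fderiv_fermiPoint_zero hτ]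
  simp

theorem spatialMetric_zero (k : ℤ) (v w : R3) : spatialMetric k 0 v w = inner ℝ v w := by
  simp [spatialMetric]

theorem IsRegular.isParallelTetrad (ha : IsRegular a) {k : ℤ} (hk : k = 0 ∨ k = -1) :
    IsParallelTetrad (rwMetric k a) (Ioi 0) comoving (fermiFrame a) := by
  obtain ⟨F, Q, hFQ⟩ := exists_isProfile hk
  -- The spatial metric is even in `X`, so on the worldline only its time derivative survives.
  have hd : ∀ τ : ℝ, 0 < τ → ∀ v w z : R4,
      fderiv ℝ (fun q => rwMetric k a q v w) (comoving τ) z =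
        2 * a τ * deriv a τ * z.1 * inner ℝ v.2 w.2 := by
    intro τ hτ v w z
    rw [hFQ.fderiv_rwMetric (p := comoving τ) (ha.hasDerivAt hτ)]
    simp [comoving, spatialMetric_zero]
  refine ⟨fun τ hτ => ?_, fun τ hτ i j => ?_, fun τ hτ i => ?_⟩
  · rw [ha.fermiFrame_zero hτ]
    exact (hasDerivAt_id τ).prodMk (hasDerivAt_const τ (0 : R3))
  · have hA := (ha.pos hτ).ne'
    refine Fin.cases ?_ (fun i => ?_) i <;> refine Fin.cases ?_ (fun j => ?_) j
    · rw [ha.fermiFrame_zero hτ]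
      simp [rwMetric, comoving, spatialMetric_zero]
    · rw [ha.fermiFrame_zero hτ, ha.fermiFrame_succ hτ]
      simp [rwMetric, comoving, spatialMetric_zero, (Fin.succ_ne_zero j).symm]
    · rw [ha.fermiFrame_zero hτ, ha.fermiFrame_succ hτ]
      simp [rwMetric, comoving, spatialMetric_zero]
    · rw [ha.fermiFrame_succ hτ, ha.fermiFrame_succ hτ]
      simp only [rwMetric, comoving, spatialMetric_zero, real_inner_smul_left,
        real_inner_smul_right, EuclideanSpace.inner_single_left, Fin.succ_inj, Fin.succ_ne_zero,
        if_false, mul_zero, neg_zero, zero_add]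
      by_cases hij : i = j
      · subst hij
        simp
        field_simp
      · simp [hij]
  · refine Fin.cases ?_ (fun i => ?_) i
    · refine ⟨0, ?_, fun w => ?_⟩
      · refine (hasDerivAt_const τ ((1, 0) : R4)).congr_of_eventuallyEq ?_
        filter_upwards [Ioi_mem_nhds hτ] with t ht
        exact ha.fermiFrame_zero ht
      · rw [christoffel, hd τ hτ, hd τ hτ, ha.fermiFrame_zero hτ]
        simp [rwMetric, comoving, spatialMetric_zero]
    · have hA := (ha.pos hτ).ne'
      refine ⟨(0, (-(deriv a τ) / a τ ^ 2) • EuclideanSpace.single i 1), ?_, fun w => ?_⟩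
      · have h1 : HasDerivAt (fun t => ((0 : ℝ), (a t)⁻¹ • (EuclideanSpace.single i (1 : ℝ) : R3)))
            (0, (-(deriv a τ) / a τ ^ 2) • EuclideanSpace.single i 1) τ :=
          (hasDerivAt_const τ (0 : ℝ)).prodMk (((ha.hasDerivAt hτ).fun_inv hA).smul_const _)
        refine h1.congr_of_eventuallyEq ?_
        filter_upwards [Ioi_mem_nhds hτ] with t ht
        exact ha.fermiFrame_succ ht i
      · rw [christoffel, hd τ hτ, hd τ hτ, hd τ hτ, ha.fermiFrame_zero hτ, ha.fermiFrame_succ hτ]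
        simp only [rwMetric, comoving, spatialMetric_zero, real_inner_smul_left, inner_zero_left]
        field_simp
        ring

end Tetrad

/-! ### The event horizon -/

/-- The conformal time elapsed since `τ`. -/
def conformal (a : ℝ → ℝ) (τ t : ℝ) : ℝ := ∫ s in τ..t, 1 / a s

/-- The radial coordinate of the event at time `t` on the slice of `τ`. -/
def chiAt (a : ℝ → ℝ) (τ t : ℝ) : ℝ :=
  √(1 - (a t / a τ) ^ 2) * chiRatio a (τ, √(1 - (a t / a τ) ^ 2) ^ 2)

/-- The form of all comparisons below: a difference that vanishes at one endpoint has a derivative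
of known sign. -/
theorem le_of_hasDerivAt_nonpos {f f' : ℝ → ℝ} {t τ : ℝ} (htτ : t ≤ τ)
    (hc : ContinuousOn f (Icc t τ)) (hd : ∀ s ∈ Ioo t τ, HasDerivAt f (f' s) s)
    (hf' : ∀ s ∈ Ioo t τ, f' s ≤ 0) : f τ ≤ f t := by
  refine antitoneOn_of_deriv_nonpos (convex_Icc t τ) hc ?_ ?_ (left_mem_Icc.2 htτ)
    (right_mem_Icc.2 htτ) htτ
  · rw [interior_Icc]
    exact fun s hs => (hd s hs).differentiableAt.differentiableWithinAt
  · rw [interior_Icc]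
    intro s hs
    rw [(hd s hs).deriv]
    exact hf' s hs

section Horizon

variable {a : ℝ → ℝ} {t τ : ℝ}

theorem IsRegular.continuousOn_inv (ha : IsRegular a) : ContinuousOn (fun s => 1 / a s) (Ioi 0) :=
  continuousOn_const.div ha.continuousOn_Ioi fun _ hs => (ha.pos hs).ne'

theorem uIcc_subset_Ioi (ht : 0 < t) (hτ : 0 < τ) : uIcc t τ ⊆ Ioi 0 :=
  fun _ hs => (lt_min ht hτ).trans_le hs.1

theorem IsRegular.intervalIntegrable_inv (ha : IsRegular a) (ht : 0 < t) (hτ : 0 < τ) :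
    IntervalIntegrable (fun s => 1 / a s) volume t τ :=
  (ha.continuousOn_inv.mono (uIcc_subset_Ioi ht hτ)).intervalIntegrable

theorem IsRegular.hasDerivAt_conformal (ha : IsRegular a) (hτ : 0 < τ) (ht : 0 < t) :
    HasDerivAt (conformal a τ) (1 / a t) t :=
  intervalIntegral.integral_hasDerivAt_right (ha.intervalIntegrable_inv hτ ht)
    (ha.continuousOn_inv.stronglyMeasurableAtFilter isOpen_Ioi t ht)
    (ha.continuousOn_inv.continuousAt (Ioi_mem_nhds ht))

theorem IsRegular.hasDerivAt_slope (ha : IsRegular a) (ht : 0 < t) (h : t < τ) :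
    0 < √(1 - (a t / a τ) ^ 2) ∧ √(1 - (a t / a τ) ^ 2) < 1 ∧
    √(1 - (a t / a τ) ^ 2) ^ 2 = 1 - (a t / a τ) ^ 2 ∧
    HasDerivAt (fun t => √(1 - (a t / a τ) ^ 2))
      (-(a t / a τ * (deriv a t / a τ) / √(1 - (a t / a τ) ^ 2))) t := by
  have h1 := ha.pos ht
  have h2 := ha.pos (ht.trans h)
  have h3 : a t / a τ < 1 :=
    (div_lt_one h2).2 (ha.strictMonoOn (mem_Ici.2 ht.le) (mem_Ici.2 (ht.trans h).le) h)
  have h4 : 0 < 1 - (a t / a τ) ^ 2 := sub_pos.2 (pow_lt_one₀ (div_pos h1 h2).le h3 two_ne_zero)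
  refine ⟨Real.sqrt_pos.2 h4, ?_, Real.sq_sqrt h4.le, ?_⟩
  · rw [Real.sqrt_lt' one_pos]
    have := pow_pos (div_pos h1 h2) 2
    linarith
  · refine ((((ha.hasDerivAt ht).div_const (a τ)).fun_pow 2).const_sub 1 |>.sqrt
      h4.ne').congr_deriv ?_
    simp only [Nat.cast_ofNat, Nat.reduceSub, pow_one]
    field_simp

theorem IsRegular.rateFun_slope (ha : IsRegular a) (ht : 0 < t) (h : t ≤ τ) :
    rateFun a (τ, √(1 - (a t / a τ) ^ 2) ^ 2) = (deriv a t)⁻¹ := by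
  obtain ⟨h1, h2⟩ := ha.one_sub_ratio_sq ht h
  have hA := ha.pos (ht.trans_le h)
  have h7 : √(1 - (1 - (a t / a τ) ^ 2)) = a t / a τ := by
    rw [sub_sub_cancel, Real.sqrt_sq (ha.ratio_mem ht h).1.le]
  rw [Real.sq_sqrt h1, rateFun, scaleArg, one_pow, one_mul]
  simp only
  rw [h7, mul_div_cancel₀ _ hA.ne', ha.deriv_scaleInv ⟨t, ht, rfl⟩, ha.scaleInv_apply ht.le]

theorem IsRegular.hasDerivAt_chiAt (ha : IsRegular a) (ht : 0 < t) (h : t < τ) :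
    HasDerivAt (chiAt a τ) (-(1 / (a t * √(1 - (a t / a τ) ^ 2)))) t := by
  obtain ⟨h1, h2, h3, h4⟩ := ha.hasDerivAt_slope ht h
  have hτ := ht.trans h
  have hA := ha.pos hτ
  have hat := ha.pos ht
  have h5 := HasDerivAt.comp t (ha.hasDerivAt_mul_chiRatio hτ ⟨by linarith, h2⟩) h4
  refine h5.congr_deriv ?_
  have h6 := ha.rateFun_slope ht h.le
  rw [h6]
  nth_rewrite 1 [h3]
  rw [sub_sub_cancel]
  have hd := ha.deriv_ne_zero t ht
  field_simp

theorem IsRegular.continuousOn_chiAt (ha : IsRegular a) (hτ : 0 < τ) (ht : 0 < t) :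
    ContinuousOn (chiAt a τ) (Icc t τ) := by
  have hy : ContinuousOn (fun s => √(1 - (a s / a τ) ^ 2)) (Icc t τ) :=
    (continuousOn_const.sub (((ha.continuousOn_Ioi.mono fun s hs =>
      ht.trans_le hs.1).div_const _).pow 2)).sqrt
  refine ContinuousOn.comp (t := Ioo (-1) 1) (g := fun y => y * chiRatio a (τ, y ^ 2))
    (fun y hy => (ha.hasDerivAt_mul_chiRatio hτ hy).continuousAt.continuousWithinAt) hy ?_
  intro s hs
  obtain ⟨h0, h1⟩ := ha.one_sub_ratio_sq (ht.trans_le hs.1) hs.2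
  refine ⟨by linarith [Real.sqrt_nonneg (1 - (a s / a τ) ^ 2)], ?_⟩
  rwa [Real.sqrt_lt' one_pos, one_pow]

theorem IsRegular.chiAt_self (ha : IsRegular a) (hτ : 0 < τ) : chiAt a τ τ = 0 := by
  simp [chiAt, div_self (ha.pos hτ).ne']

theorem IsRegular.continuousOn_conformal (ha : IsRegular a) (hτ : 0 < τ) (ht : 0 < t) {T : ℝ} :
    ContinuousOn (conformal a τ) (Icc t T) := fun _ hs =>
  (ha.hasDerivAt_conformal hτ (ht.trans_le hs.1)).continuousAt.continuousWithinAt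

/-- Slices are spacelike: `|dχ/dt| = 1/(a y) ≥ 1/a` because `y ≤ 1`, so between the same times the
radial coordinate changes by at least as much as along a light ray. -/
theorem IsRegular.neg_conformal_le_chiAt (ha : IsRegular a) (ht : 0 < t) (h : t ≤ τ) :
    -conformal a τ t ≤ chiAt a τ t := by
  have hτ := ht.trans_le h
  have := le_of_hasDerivAt_nonpos (f := fun s => chiAt a τ s + conformal a τ s) h
    ((ha.continuousOn_chiAt hτ ht).add (ha.continuousOn_conformal hτ ht))
    (fun s hs => (ha.hasDerivAt_chiAt (ht.trans hs.1) hs.2).fun_add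
      (ha.hasDerivAt_conformal hτ (ht.trans hs.1))) fun s hs => ?_
  · simp only [ha.chiAt_self hτ, conformal, intervalIntegral.integral_same] at this
    simp only [conformal]
    linarith
  · obtain ⟨h1, h2, -, -⟩ := ha.hasDerivAt_slope (ht.trans hs.1) hs.2
    have h3 := ha.pos (ht.trans hs.1)
    have h4 : 1 / a s ≤ 1 / (a s * √(1 - (a s / a τ) ^ 2)) :=
      one_div_le_one_div_of_le (mul_pos h3 h1) (by nlinarith)
    linarith

/-- The excess over a light ray is `∫ (1/y - 1) ds/a`. Before `τ` the Hubble parameter is at least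
its value at `τ`, so the factor `(a(τ)/ȧ(τ)) (ȧ/a) ≥ 1` may be inserted; with `x = a(s)/a(τ)` the
integrand is then the exact derivative of `ȧ(τ)⁻¹ (1 - y)/x`. -/
theorem IsRegular.chiAt_le (ha : IsRegular a) (ht : 0 < t) (h : t ≤ τ) :
    chiAt a τ t ≤ -conformal a τ t +
      (deriv a τ)⁻¹ * (1 - (1 - √(1 - (a t / a τ) ^ 2)) / (a t / a τ)) := by
  have hτ := ht.trans_le h
  have hA := ha.pos hτ
  have hA' := ha.deriv_pos hτ
  have hyc : ContinuousOn (fun s => (1 - √(1 - (a s / a τ) ^ 2)) / (a s / a τ)) (Icc t τ) := by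
    have hac : ContinuousOn (fun s => a s / a τ) (Icc t τ) :=
      (ha.continuousOn_Ioi.mono fun s hs => ht.trans_le hs.1).div_const _
    exact (continuousOn_const.sub (continuousOn_const.sub (hac.pow 2)).sqrt).div hac
      fun s hs => (div_pos (ha.pos (ht.trans_le hs.1)) hA).ne'
  have := le_of_hasDerivAt_nonpos (f := fun s => -conformal a τ s +
      (deriv a τ)⁻¹ * (1 - (1 - √(1 - (a s / a τ) ^ 2)) / (a s / a τ)) - chiAt a τ s)
      (f' := fun s => (1 / √(1 - (a s / a τ) ^ 2) - 1) / a s *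
        (1 - a τ / deriv a τ * (deriv a s / a s))) h
    (((ha.continuousOn_conformal hτ ht).neg.add (continuousOn_const.mul
      (continuousOn_const.sub hyc))).sub (ha.continuousOn_chiAt hτ ht)) (fun s hs => ?_)
    fun s hs => ?_
  · simp only [ha.chiAt_self hτ, conformal, intervalIntegral.integral_same,
      div_self hA.ne'] at this
    simp only [conformal]
    simp only [one_pow, sub_self, Real.sqrt_zero, sub_zero, div_one, mul_zero, add_zero,
      neg_zero] at this
    linarith
  · have hs0 := ht.trans hs.1
    obtain ⟨h1, h2, h3, h4⟩ := ha.hasDerivAt_slope hs0 hs.2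
    have has := ha.pos hs0
    have h5 := (h4.const_sub 1).fun_div ((ha.hasDerivAt hs0).div_const (a τ))
      (div_pos has hA).ne'
    refine ((((ha.hasDerivAt_conformal hτ hs0).fun_neg.fun_add
      ((h5.const_sub 1).const_mul (deriv a τ)⁻¹))).fun_sub
      (ha.hasDerivAt_chiAt hs0 hs.2)).congr_deriv ?_
    set y := √(1 - (a s / a τ) ^ 2)
    have h6 : a s ^ 2 = a τ ^ 2 * (1 - y ^ 2) := by
      rw [h3]; field_simp; ring
    field_simp
    linear_combination (-deriv a s) * h6
  · have hs0 := ht.trans hs.1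
    obtain ⟨h1, h2, h3, h4⟩ := ha.hasDerivAt_slope hs0 hs.2
    have has := ha.pos hs0
    have h5 := ha.antitoneOn_hubble hs0 hτ hs.2.le
    simp only at h5
    refine mul_nonpos_of_nonneg_of_nonpos (div_nonneg (sub_nonneg.2 ?_) has.le) (sub_nonpos.2 ?_)
    · exact (one_le_div h1).2 h2.le
    · have : a τ / deriv a τ * (deriv a τ / a τ) = 1 := by field_simp
      rw [← this]
      exact mul_le_mul_of_nonneg_left h5 (div_pos hA hA').le

/-- After `τ` the Hubble comparison reverses: inserting `(a(τ)/ȧ(τ)) (ȧ/a) ≤ 1` into `∫ ds/a` makes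
the integrand exact. -/
theorem IsRegular.conformal_ge (ha : IsRegular a) (hτ : 0 < τ) {T : ℝ} (hT : τ ≤ T) :
    (deriv a τ)⁻¹ * (1 - a τ / a T) ≤ conformal a τ T := by
  have hA := ha.pos hτ
  have hA' := ha.deriv_pos hτ
  have hac : ContinuousOn a (Icc τ T) := ha.continuousOn_Ioi.mono fun s hs => hτ.trans_le hs.1
  have := le_of_hasDerivAt_nonpos (f := fun s => (deriv a τ)⁻¹ * (1 - a τ / a s) - conformal a τ s)
    (f' := fun s => (a τ / deriv a τ * (deriv a s / a s) - 1) / a s) hT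
    ((continuousOn_const.mul (continuousOn_const.sub (continuousOn_const.div hac
      fun s hs => (ha.pos (hτ.trans_le hs.1)).ne'))).sub (ha.continuousOn_conformal hτ hτ))
    (fun s hs => ?_) fun s hs => ?_
  · simp only [conformal, intervalIntegral.integral_same, div_self hA.ne'] at this
    simp only [conformal]
    linarith
  · have hs0 := hτ.trans hs.1
    have has := ha.pos hs0
    refine (((((hasDerivAt_const s (a τ)).fun_div (ha.hasDerivAt hs0) has.ne').const_sub
      1).const_mul (deriv a τ)⁻¹).fun_sub (ha.hasDerivAt_conformal hτ hs0)).congr_deriv ?_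
    field_simp
    ring
  · have hs0 := hτ.trans hs.1
    have h5 := ha.antitoneOn_hubble hτ hs0 hs.1.le
    simp only at h5
    refine div_nonpos_of_nonpos_of_nonneg (sub_nonpos.2 ?_) (ha.pos hs0).le
    have : a τ / deriv a τ * (deriv a τ / a τ) = 1 := by field_simp
    rw [← this]
    exact mul_le_mul_of_nonneg_left h5 (div_pos hA hA').le

theorem IsRegular.conformal_ge_of_le (ha : IsRegular a) (hτ : 0 < τ) {T M : ℝ} (hT : τ ≤ T)
    (hM : ∀ s, τ ≤ s → a s ≤ M) : (T - τ) / M ≤ conformal a τ T := by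
  have := le_of_hasDerivAt_nonpos (f := fun s => (s - τ) / M - conformal a τ s) hT
    ((by fun_prop : ContinuousOn (fun s : ℝ => (s - τ) / M) (Icc τ T)).sub
      (ha.continuousOn_conformal hτ hτ))
    (fun s hs => (((hasDerivAt_id s).sub_const τ).div_const M).fun_sub
      (ha.hasDerivAt_conformal hτ (hτ.trans hs.1))) fun s hs => ?_
  · simp only [conformal, intervalIntegral.integral_same, sub_self, zero_div] at this
    simp only [conformal]
    linarith
  · exact sub_nonpos.2 (one_div_le_one_div_of_le (ha.pos (hτ.trans hs.1)) (hM s hs.1.le))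

/-- Either `a(τ)/a(T)` falls below `ε` for some `T`, and `conformal_ge` suffices, or `a` stays
bounded by `a(τ)/ε` and the conformal time grows at least linearly. -/
theorem IsRegular.exists_conformal_gt (ha : IsRegular a) (hτ : 0 < τ) {ε : ℝ} (hε : 0 < ε) :
    ∃ T, τ ≤ T ∧ (deriv a τ)⁻¹ * (1 - ε) < conformal a τ T := by
  have hA := ha.pos hτ
  have hi := inv_pos.2 (ha.deriv_pos hτ)
  by_cases hb : ∃ T, τ ≤ T ∧ a τ / a T < ε
  · obtain ⟨T, hT, h⟩ := hb
    exact ⟨T, hT, lt_of_lt_of_le (mul_lt_mul_of_pos_left (by linarith) hi)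
      (ha.conformal_ge hτ hT)⟩
  · push Not at hb
    have hM : ∀ s, τ ≤ s → a s ≤ a τ / ε := by
      intro s hs
      have h1 := ha.pos (hτ.trans_le hs)
      have h2 := (le_div_iff₀ h1).1 (hb s hs)
      rw [le_div_iff₀ hε]
      linarith
    have hM0 : 0 < a τ / ε := div_pos hA hε
    -- With `a` bounded by `M = a(τ)/ε`, a time span `M ȧ(τ)⁻¹` yields conformal time at least
    -- `ȧ(τ)⁻¹`, above the target.
    have hT : τ ≤ τ + a τ / ε * (deriv a τ)⁻¹ := by
      have := mul_pos hM0 hi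
      linarith
    refine ⟨_, hT, lt_of_lt_of_le ?_ (ha.conformal_ge_of_le hτ hT hM)⟩
    rw [add_sub_cancel_left, mul_div_cancel_left₀ _ hM0.ne']
    nlinarith

/-- The bound of `chiAt_le` exceeds the conformal time from `t` to `τ` by `ȧ(τ)⁻¹ (1 - ε)`, with `ε
= (1 - y)/x > 0`. Light continuing beyond `τ` more than makes up for this. -/
theorem IsRegular.chiAt_lt_conformal (ha : IsRegular a) (ht : 0 < t) (h : t ≤ τ) :
    ∃ T, t ≤ T ∧ chiAt a τ t < conformal a t T := by
  have hτ := ht.trans_le h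
  obtain ⟨h1, h2⟩ := ha.ratio_mem ht h
  have hy : √(1 - (a t / a τ) ^ 2) < 1 := by
    rw [Real.sqrt_lt' one_pos]
    have := pow_pos h1 2
    linarith
  obtain ⟨T, hT, hlt⟩ := ha.exists_conformal_gt hτ
    (div_pos (sub_pos.2 hy) h1 : 0 < (1 - √(1 - (a t / a τ) ^ 2)) / (a t / a τ))
  refine ⟨T, h.trans hT, ?_⟩
  have h3 := ha.chiAt_le ht h
  have h4 : conformal a t T = -conformal a τ t + conformal a τ T := by
    rw [conformal, conformal, conformal, ← intervalIntegral.integral_symm,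
      intervalIntegral.integral_add_adjacent_intervals (ha.intervalIntegrable_inv ht hτ)
        (ha.intervalIntegrable_inv hτ (hτ.trans_le hT))]
  linarith

theorem IsRegular.ofReal_conformal (ha : IsRegular a) (ht : 0 < t) {T : ℝ} (h : t ≤ T) :
    ENNReal.ofReal (conformal a t T) = ∫⁻ s in Ioc t T, ENNReal.ofReal (1 / a s) := by
  have hi := ha.intervalIntegrable_inv ht (ht.trans_le h)
  rw [intervalIntegrable_iff_integrableOn_Ioc_of_le h] at hi
  rw [conformal, intervalIntegral.integral_of_le h, ofReal_integral_eq_lintegral_ofReal hi]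
  rw [EventuallyLE, ae_restrict_iff' measurableSet_Ioc]
  exact Eventually.of_forall fun s hs => (one_div_pos.2 (ha.pos (ht.trans hs.1))).le

theorem IsRegular.ofReal_conformal_le (ha : IsRegular a) (ht : 0 < t) {T : ℝ} (h : t ≤ T) :
    ENNReal.ofReal (conformal a t T) ≤ chiHoriz a t := by
  rw [ha.ofReal_conformal ht h]
  exact lintegral_mono_set Ioc_subset_Ioi_self

theorem IsRegular.exists_lt_conformal (ha : IsRegular a) (ht : 0 < t) {x : ℝ}
    (h : ENNReal.ofReal x < chiHoriz a t) : ∃ T, t ≤ T ∧ x < conformal a t T := by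
  have hU : Ioi t = ⋃ n : ℕ, Ioc t (t + n) := by
    ext s
    simp only [mem_Ioi, mem_iUnion, mem_Ioc]
    refine ⟨fun hs => ?_, fun ⟨n, hn⟩ => hn.1⟩
    obtain ⟨n, hn⟩ := exists_nat_ge (s - t)
    exact ⟨n, hs, by linarith⟩
  have hdir : Directed (· ⊆ ·) fun n : ℕ => Ioc t (t + n) :=
    Monotone.directed_le fun m n hmn => Ioc_subset_Ioc_right (by gcongr)
  rw [chiHoriz, hU, setLIntegral_iUnion_of_directed _ hdir, lt_iSup_iff] at h
  obtain ⟨n, hn⟩ := h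
  have hT : t ≤ t + n := le_add_of_nonneg_right n.cast_nonneg
  rw [← ha.ofReal_conformal ht hT] at hn
  exact ⟨t + n, hT, (ENNReal.ofReal_lt_ofReal_iff'.1 hn).1⟩

theorem IsRegular.fermiDomain_eq_horizon (ha : IsRegular a) :
    fermiDomain a = {p | p ∈ spacetime ∧ ENNReal.ofReal ‖p.2‖ < chiHoriz a p.1} := by
  rw [ha.fermiDomain_eq]
  ext p
  constructor
  · rintro ⟨q, hq, rfl⟩
    obtain ⟨h1, h2, -, h3⟩ := ha.aux_time hq
    refine ⟨h1, ?_⟩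
    obtain ⟨T, hT, hlt⟩ := ha.chiAt_lt_conformal h1 h2
    have h4 : ‖(auxToCosmo a q).2‖ = chiAt a q.1 (timeFun a (auxParam q)) := by
      rw [norm_auxToCosmo ha hq, chiAt, h3, Real.sqrt_sq (norm_nonneg _)]
    rw [h4]
    refine lt_of_lt_of_le ?_ (ha.ofReal_conformal_le h1 hT)
    rw [ENNReal.ofReal_lt_ofReal_iff_of_nonneg (by rw [← h4]; exact norm_nonneg _)]
    exact hlt
  · rintro ⟨ht, hlt⟩
    have ht : 0 < p.1 := ht
    obtain ⟨T, hT, h1⟩ := ha.exists_lt_conformal ht hlt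
    have h2 := ha.neg_conformal_le_chiAt ht hT
    have h3 : conformal a p.1 T = -conformal a T p.1 := by
      rw [conformal, conformal, intervalIntegral.integral_symm]
    have h4 : ‖p.2‖ ≤ chiAt a T p.1 := by linarith
    have h5 : chiSq a p.1 T = chiAt a T p.1 ^ 2 := by
      rw [chiSq, chiAt, mul_pow, Real.sq_sqrt (ha.one_sub_ratio_sq ht hT).1]
    have h6 : chiSq a p.1 p.1 = 0 := by simp [chiSq, div_self (ha.pos ht).ne']
    have hc : ContinuousOn (chiSq a p.1) (Icc p.1 T) := fun s hs => by
      obtain ⟨H', -, h⟩ := ha.hasDerivAt_chiSq ht hs.1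
      exact h.continuousAt.continuousWithinAt
    -- Intermediate value theorem in `τ` at fixed time `p.1`: the slice of `τ = p.1` has `χ = 0`
    -- there, and the slice of `T` already reaches at least `‖p.2‖`.
    obtain ⟨τ, hτ, h7⟩ := intermediate_value_Icc hT hc
      (show ‖p.2‖ ^ 2 ∈ Icc _ _ from ⟨by rw [h6]; positivity, by rw [h5]; gcongr⟩)
    have hτ0 := ht.trans_le hτ.1
    obtain ⟨h8, h9⟩ := ha.one_sub_ratio_sq ht hτ.1
    have hG := ha.chiRatio_pos (ha.mem_paramDomain hτ0 h8 h9)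
    have hA := ha.pos hτ0
    have hn : ‖(chiRatio a (τ, 1 - (a p.1 / a τ) ^ 2))⁻¹ • p.2‖ ^ 2
        = 1 - (a p.1 / a τ) ^ 2 := by
      rw [norm_smul, mul_pow, ← h7, norm_inv, Real.norm_of_nonneg hG.le, chiSq]
      generalize chiRatio a (τ, 1 - (a p.1 / a τ) ^ 2) = G at hG
      field_simp
    refine ⟨(τ, (chiRatio a (τ, 1 - (a p.1 / a τ) ^ 2))⁻¹ • p.2), ⟨hτ0, ?_⟩, ?_⟩
    · refine (sq_lt_one_iff₀ (norm_nonneg _)).1 ?_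
      simp only [hn]
      exact h9
    · simp only [auxToCosmo, auxParam, hn]
      refine Prod.ext ?_ ?_
      · simp only [timeFun, scaleArg, one_pow, one_mul, sub_sub_cancel]
        rw [Real.sqrt_sq (div_pos (ha.pos ht) hA).le, mul_div_cancel₀ _ hA.ne',
          ha.scaleInv_apply ht.le]
      · simp only
        rw [smul_smul, mul_inv_cancel₀ hG.ne', one_smul]

/-- The integral of `1/a` between two positive times is finite, so an infinite horizon at one time
is infinite at every time. -/
theorem IsRegular.fermiDomain_eq_spacetime (ha : IsRegular a)
    (h : ∃ t₀, 0 < t₀ ∧ chiHoriz a t₀ = ⊤) : fermiDomain a = spacetime := by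
  obtain ⟨t₀, ht₀, htop⟩ := h
  have hall : ∀ t, 0 < t → chiHoriz a t = ⊤ := by
    intro t ht
    rcases le_total t t₀ with h | h
    · refine top_unique ?_
      rw [← htop]
      exact lintegral_mono_set (Ioi_subset_Ioi h)
    · have h1 : chiHoriz a t₀ ≤ ENNReal.ofReal (conformal a t₀ t) + chiHoriz a t := by
        rw [ha.ofReal_conformal ht₀ h, chiHoriz, chiHoriz, ← Ioc_union_Ioi_eq_Ioi h]
        exact lintegral_union_le _ _ _
      rw [htop, top_le_iff, ENNReal.add_eq_top] at h1
      exact h1.resolve_left ENNReal.ofReal_ne_top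
  rw [ha.fermiDomain_eq_horizon]
  ext p
  refine ⟨fun hp => hp.1, fun hp => ⟨hp, ?_⟩⟩
  rw [hall p.1 hp]
  exact ENNReal.ofReal_lt_top

end Horizon

/-! ### The radial geodesics -/

section Geodesics

variable {a : ℝ → ℝ} {τ : ℝ}

theorem IsRegular.sum_fermiFrame (ha : IsRegular a) (hτ : 0 < τ) (x : R3) :
    ∑ j : Fin 3, x j • fermiFrame a j.succ τ = (0, (a τ)⁻¹ • x) := by
  simp only [ha.fermiFrame_succ hτ]
  refine Prod.ext ?_ ?_
  · simp [Prod.fst_sum]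
  · rw [Prod.snd_sum]
    ext i
    simp [mul_comm, Pi.single_apply]

theorem IsRegular.hasDerivAt_timeFun_sq (ha : IsRegular a) (hτ : 0 < τ) {y : ℝ}
    (hy : y ∈ Ioo (-1 : ℝ) 1) :
    HasDerivAt (fun y => timeFun a (τ, y ^ 2))
      (-(a τ * rateFun a (τ, y ^ 2) * y / √(1 - y ^ 2))) y := by
  have hx := sq_mem_paramDomain ha hτ hy
  have h1 : HasDerivAt (fun y : ℝ => (τ, y ^ 2)) ((0 : ℝ), 2 * y) y := by
    refine ((hasDerivAt_const y τ).prodMk (hasDerivAt_pow 2 y)).congr_deriv ?_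
    simp
  have h2 := HasFDerivAt.comp_hasDerivAt (l := timeFun a) y
    (ha.differentiableAt_timeFun hx).hasFDerivAt h1
  refine h2.congr_deriv ?_
  rw [ha.fderiv_timeFun hx]
  simp only
  ring

/-- Reparametrization of the radial variable `y` by proper length. -/
theorem IsRegular.exists_lengthParam (ha : IsRegular a) (hτ : 0 < τ) {Y : ℝ}
    (hY : Y ∈ Ico (0 : ℝ) 1) :
    ∃ y : ℝ → ℝ, y 0 = 0 ∧ y 1 = Y ∧ ∀ s ∈ Icc (0 : ℝ) 1, y s ∈ Ioo (-1 : ℝ) 1 ∧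
      HasDerivAt y (Y * rhoRatio a (τ, Y ^ 2) / (a τ * rateFun a (τ, y s ^ 2))) s := by
  -- Proper length is `R(y)` and the affine parameter is `s = R(y)/R(Y)`. Inverting on the symmetric
  -- interval makes `y = 0` interior, so the derivative at `s = 0` is two-sided.
  set R : ℝ → ℝ := fun y => y * rhoRatio a (τ, y ^ 2) with hR
  have hmono := ha.strictMonoOn_mul_rhoRatio hτ
  set g := Function.invFunOn R (Ioo (-1) 1) with hg
  have hl : ∀ y ∈ Ioo (-1 : ℝ) 1, g (R y) = y := fun y hy => hmono.injOn.leftInvOn_invFunOn hy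
  have hRd : ∀ y ∈ Ioo (-1 : ℝ) 1, HasDerivAt R (a τ * rateFun a (τ, y ^ 2)) y :=
    fun y hy => ha.hasDerivAt_mul_rhoRatio hτ hy
  have hpos : ∀ y ∈ Ioo (-1 : ℝ) 1, a τ * rateFun a (τ, y ^ 2) ≠ 0 := fun y hy =>
    (mul_pos (ha.pos hτ) (ha.rateFun_pos (sq_mem_paramDomain ha hτ hy))).ne'
  have hRc : ContDiffOn ℝ 1 R (Ioo (-1) 1) := by
    have h1 : ContDiffOn ℝ 1 (rhoRatio a) (paramDomain a) := by
      simpa using ha.contDiffOn_rhoRatio ha.contDiffOn_two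
    exact contDiffOn_id.mul (h1.comp (f := fun y : ℝ => (τ, y ^ 2)) (by fun_prop)
      fun y hy => sq_mem_paramDomain ha hτ hy)
  have hker : ∀ y ∈ Ioo (-1 : ℝ) 1, ∀ v, fderiv ℝ R y v = 0 → v = 0 := by
    intro y hy v hv
    rw [(hRd y hy).hasFDerivAt.fderiv] at hv
    have hv' : v * (a τ * rateFun a (τ, y ^ 2)) = 0 := by simpa using hv
    exact (mul_eq_zero.1 hv').resolve_right (hpos y hy)
  have hopen := isOpen_image_of_fderiv_injective one_ne_zero isOpen_Ioo hRc hker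
  have hgc := contDiffOn_leftInverse one_ne_zero isOpen_Ioo hRc hker hl
  have hgd : ∀ y ∈ Ioo (-1 : ℝ) 1, HasDerivAt g (a τ * rateFun a (τ, y ^ 2))⁻¹ (R y) := by
    intro y hy
    have hmem : R '' Ioo (-1) 1 ∈ 𝓝 (R y) := hopen.mem_nhds (mem_image_of_mem _ hy)
    refine HasDerivAt.of_local_left_inverse (hgc.continuousOn.continuousAt hmem)
      (by rw [hl y hy]; exact hRd y hy) (hpos y hy) ?_
    filter_upwards [hmem]
    rintro _ ⟨z, hz, rfl⟩
    rw [hl z hz]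
  have hY' := Ico_subset_Ioo_neg_one hY
  refine ⟨fun s => g (s * R Y), ?_, ?_, fun s hs => ?_⟩
  · have := hl 0 (by norm_num)
    simpa [hR] using this
  · simp only [one_mul]
    exact hl Y hY'
  · have hc : ContinuousOn R (Icc 0 Y) :=
      hRc.continuousOn.mono fun z hz => ⟨by linarith [hz.1], hz.2.trans_lt hY.2⟩
    have hRY : 0 ≤ R Y :=
      mul_nonneg hY.1 (ha.rhoRatio_pos (sq_mem_paramDomain ha hτ hY')).le
    obtain ⟨z, hz, hzs⟩ := intermediate_value_Icc hY.1 hc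
      (show s * R Y ∈ Icc (R 0) (R Y) from
        ⟨by simpa [hR] using mul_nonneg hs.1 hRY, mul_le_of_le_one_left hRY hs.2⟩)
    have hz' : z ∈ Ioo (-1 : ℝ) 1 := ⟨by linarith [hz.1], hz.2.trans_lt hY.2⟩
    simp only [← hzs, hl z hz']
    refine ⟨hz', ?_⟩
    have h1 := hgd z hz'
    rw [hzs] at h1
    have h2 : HasDerivAt (fun s => s * R Y) (R Y) s := by
      simpa using (hasDerivAt_id s).mul_const (R Y)
    refine (h1.comp s h2).congr_deriv ?_
    rw [hR]
    ring

/-- The points of the chart are reached by the exponential map. -/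
theorem IsRegular.isExp_aux (ha : IsRegular a) {k : ℤ} (hk : k = 0 ∨ k = -1) {q : R4}
    (hq : q ∈ auxDomain) :
    IsExp (rwMetric k a) spacetime (comoving q.1)
      (∑ j : Fin 3, (auxToFermi a q).2 j • fermiFrame a j.succ q.1) (auxToCosmo a q) := by
  obtain ⟨F, Q, hFQ⟩ := exists_isProfile hk
  have hτ := hq.1
  have hA := ha.pos hτ
  rw [ha.sum_fermiFrame hτ]
  obtain ⟨n, hn, hnq⟩ : ∃ n : R3, ‖n‖ = 1 ∧ q.2 = ‖q.2‖ • n := by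
    by_cases h0 : q.2 = 0
    -- Any unit vector serves as direction when the radial variable is zero.
    · exact ⟨EuclideanSpace.single 0 1, by simp, by simp [h0]⟩
    · refine ⟨‖q.2‖⁻¹ • q.2, norm_smul_inv_norm h0, ?_⟩
      rw [smul_smul, mul_inv_cancel₀ (norm_ne_zero_iff.2 h0), one_smul]
  set τ := q.1
  set Y := ‖q.2‖
  obtain ⟨y, hy0, hy1, hy⟩ := ha.exists_lengthParam hτ (norm_mem_Ico hq)
  set ρ := Y * rhoRatio a (τ, Y ^ 2)
  -- Substituting `y' = ρ/(a b')` into `dt/dy` and `dχ/dy` cancels `b'`, so the velocity depends on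
  -- `y` alone and the acceleration needs only `y'`.
  refine ⟨fun s => (timeFun a (τ, y s ^ 2), (y s * chiRatio a (τ, y s ^ 2)) • n),
    fun s => (-(ρ * (y s / √(1 - y s ^ 2))), (ρ / a τ * (1 - y s ^ 2)⁻¹) • n),
    fun s => (-(ρ * (ρ / (a τ * rateFun a (τ, y s ^ 2)) / √(1 - y s ^ 2) ^ 3)),
      (ρ / a τ * (2 * y s / (1 - y s ^ 2) ^ 2 * (ρ / (a τ * rateFun a (τ, y s ^ 2))))) • n),
    fun s hs => ?_, ?_, ?_, ?_⟩
  · obtain ⟨hys, hyd⟩ := hy s hs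
    have hx := sq_mem_paramDomain ha hτ hys
    have hβ := ha.rateFun_pos hx
    have hr : 0 < 1 - y s ^ 2 := sub_pos.2 hx.2.1
    have hc := Real.sqrt_pos.2 hr
    have hc2 : √(1 - y s ^ 2) ^ 2 = 1 - y s ^ 2 := Real.sq_sqrt hr.le
    have ht : 0 < timeFun a (τ, y s ^ 2) := ha.scaleInv_pos hx.2.2
    have hat : a (timeFun a (τ, y s ^ 2)) = a τ * √(1 - y s ^ 2) := by
      rw [timeFun, ha.apply_scaleInv hx.2.2, scaleArg]
      simp
    have hat' : deriv a (timeFun a (τ, y s ^ 2)) = (rateFun a (τ, y s ^ 2))⁻¹ := by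
      rw [rateFun, ha.deriv_scaleInv hx.2.2, inv_inv]
      rfl
    refine ⟨ht, HasDerivAt.hasDerivWithinAt ?_, HasDerivAt.hasDerivWithinAt ?_, fun w => ?_⟩
    · refine HasDerivAt.prodMk ?_ (HasDerivAt.smul_const ?_ n)
      · refine (HasDerivAt.comp s (ha.hasDerivAt_timeFun_sq hτ hys) hyd).congr_deriv ?_
        field_simp
      · refine (HasDerivAt.comp s (ha.hasDerivAt_mul_chiRatio hτ hys) hyd).congr_deriv ?_
        field_simp
    · refine HasDerivAt.prodMk ?_ (HasDerivAt.smul_const ?_ n)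
      · have h1 : HasDerivAt (fun y : ℝ => 1 - y ^ 2) (-(2 * y s)) (y s) := by
          simpa using (hasDerivAt_pow 2 (y s)).const_sub 1
        have h2 := (hasDerivAt_id (y s)).fun_div (h1.sqrt hr.ne') hc.ne'
        refine ((HasDerivAt.comp s h2 hyd).const_mul ρ).neg.congr_deriv ?_
        simp only [id]
        field_simp
        rw [hc2]
        ring
      · exact ((HasDerivAt.comp s (hasDerivAt_substitution hx.2.1) hyd).const_mul (ρ / a τ))
    · rw [hFQ.geodesic_expr_radial (ha.hasDerivAt ht) hn, hat, hat']
      have e1 : -(ρ * (ρ / (a τ * rateFun a (τ, y s ^ 2)) / √(1 - y s ^ 2) ^ 3)) +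
          a τ * √(1 - y s ^ 2) * (rateFun a (τ, y s ^ 2))⁻¹ *
            (ρ / a τ * (1 - y s ^ 2)⁻¹) ^ 2 = 0 := by
        rw [← hc2, Real.sqrt_sq hc.le]
        field_simp
        ring
      have e2 : (a τ * √(1 - y s ^ 2)) ^ 2 *
          (ρ / a τ * (2 * y s / (1 - y s ^ 2) ^ 2 * (ρ / (a τ * rateFun a (τ, y s ^ 2))))) +
          2 * (a τ * √(1 - y s ^ 2)) * (rateFun a (τ, y s ^ 2))⁻¹ *
            -(ρ * (y s / √(1 - y s ^ 2))) * (ρ / a τ * (1 - y s ^ 2)⁻¹) = 0 := by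
        rw [← hc2, Real.sqrt_sq hc.le]
        field_simp
        ring
      rw [e1, e2]
      ring
  · simp only [hy0]
    refine Prod.ext ?_ (by simp [comoving])
    simp [timeFun, scaleArg, ha.scaleInv_apply hτ.le, comoving]
  · simp only [hy0]
    refine Prod.ext (by simp) ?_
    have h1 : (auxToFermi a q).2 = rhoRatio a (τ, Y ^ 2) • q.2 := rfl
    rw [h1, hnq, smul_smul, smul_smul]
    congr 1
    simp only [ρ]
    field_simp
    simp
  · simp only [hy1]
    refine Prod.ext rfl ?_
    change (Y * chiRatio a (τ, Y ^ 2)) • n = chiRatio a (τ, Y ^ 2) • q.2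
    rw [mul_comm, mul_smul, ← hnq]

end Geodesics

/-! ### Geodesics orthogonal to the worldline are radial -/

theorem hasDerivWithinAt_Ici_of_unit {E : Type*} [NormedAddCommGroup E] [NormedSpace ℝ E]
    {f : ℝ → E} {f' : E} {s : ℝ} (hs : s ∈ Ico (0 : ℝ) 1)
    (h : HasDerivWithinAt f f' (Icc 0 1) s) : HasDerivWithinAt f f' (Ici s) s :=
  h.mono_of_mem_nhdsWithin (Icc_mem_nhdsGE_of_mem hs)

theorem eq_of_hasDerivWithinAt_zero {f : ℝ → ℝ}
    (h : ∀ s ∈ Icc (0 : ℝ) 1, HasDerivWithinAt f 0 (Icc 0 1) s) :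
    ∀ s ∈ Icc (0 : ℝ) 1, f s = f 0 :=
  constant_of_has_deriv_right_zero (fun s hs => (h s hs).continuousWithinAt)
    fun s hs => hasDerivWithinAt_Ici_of_unit hs (h s (Ico_subset_Icc_self hs))

/-- Uniqueness for linear second-order equations with zero initial data. -/
theorem eq_zero_of_linear_ode {y y' A B : ℝ → ℝ} (hA : ContinuousOn A (Icc 0 1))
    (hB : ContinuousOn B (Icc 0 1))
    (hy : ∀ s ∈ Icc (0 : ℝ) 1, HasDerivWithinAt y (y' s) (Icc 0 1) s)
    (hy' : ∀ s ∈ Icc (0 : ℝ) 1, HasDerivWithinAt y' (A s * y' s + B s * y s) (Icc 0 1) s)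
    (h0 : y 0 = 0) (h0' : y' 0 = 0) : ∀ s ∈ Icc (0 : ℝ) 1, y s = 0 ∧ y' s = 0 := by
  obtain ⟨CA, hCA⟩ := isCompact_Icc.exists_bound_of_continuousOn hA
  obtain ⟨CB, hCB⟩ := isCompact_Icc.exists_bound_of_continuousOn hB
  have hd : ∀ s ∈ Icc (0 : ℝ) 1, HasDerivWithinAt (fun s => (y s, y' s))
      (y' s, A s * y' s + B s * y s) (Icc 0 1) s := fun s hs => (hy s hs).prodMk (hy' s hs)
  have h := norm_le_gronwallBound_of_norm_deriv_right_le (f := fun s => (y s, y' s))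
    (f' := fun s => (y' s, A s * y' s + B s * y s)) (δ := 0) (K := 1 + CA + CB) (ε := 0)
    (fun s hs => (hd s hs).continuousWithinAt)
    (fun s hs => hasDerivWithinAt_Ici_of_unit hs (hd s (Ico_subset_Icc_self hs)))
    (by simp [h0, h0']) (fun s hs => ?_)
  · intro s hs
    have h1 := h s hs
    rw [gronwallBound_ε0, zero_mul] at h1
    have h2 := norm_le_zero_iff.1 h1
    exact Prod.mk_eq_zero.1 h2
  · have hs' := Ico_subset_Icc_self hs
    have h1 : ‖y s‖ ≤ ‖(y s, y' s)‖ := norm_fst_le (y s, y' s)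
    have h2 : ‖y' s‖ ≤ ‖(y s, y' s)‖ := norm_snd_le (y s, y' s)
    have h3 := hCA s hs'
    have h4 := hCB s hs'
    have hCA0 := (norm_nonneg _).trans h3
    have hCB0 := (norm_nonneg _).trans h4
    have hN := norm_nonneg (y s, y' s)
    have h5 : ‖A s * y' s + B s * y s‖ ≤ CA * ‖(y s, y' s)‖ + CB * ‖(y s, y' s)‖ := by
      refine (norm_add_le _ _).trans ?_
      rw [norm_mul, norm_mul]
      gcongr
    rw [add_zero, Prod.norm_def]
    refine max_le ?_ ?_
    · simp only
      nlinarith [mul_nonneg hCA0 hN, mul_nonneg hCB0 hN]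
    · simp only
      nlinarith [mul_nonneg hCA0 hN, mul_nonneg hCB0 hN]

/-! ### The geodesic equation transverse to the initial direction -/

section Radial

variable {k : ℤ} {F Q : ℝ → ℝ}

/-- The spatial part of the geodesic equation, solved for the acceleration. -/
theorem IsProfile.acceleration_eq (h : IsProfile k F Q) {a : ℝ → ℝ} {p : R4} {a' : ℝ}
    (ha : HasDerivAt a a' p.1) (ha0 : a p.1 ≠ 0) {v z : R4}
    (hgeo : ∀ w, rwMetric k a p z w + christoffel (rwMetric k a) p v v w = 0) (m : R3) :
    inner ℝ m z.2 =
      -(2 * (a' / a p.1) * v.1 * F (‖p.2‖ ^ 2) + 2 * deriv F (‖p.2‖ ^ 2) * inner ℝ p.2 v.2)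
        / F (‖p.2‖ ^ 2) * inner ℝ m v.2
      + -(Q (‖p.2‖ ^ 2) * -(2 * (a' / a p.1) * v.1 * inner ℝ p.2 v.2
            + 2 * deriv F (‖p.2‖ ^ 2) * inner ℝ p.2 v.2 ^ 2
            + (deriv Q (‖p.2‖ ^ 2) * inner ℝ p.2 v.2 ^ 2
              + (Q (‖p.2‖ ^ 2) - deriv F (‖p.2‖ ^ 2)) * inner ℝ v.2 v.2) * ‖p.2‖ ^ 2)
          + 2 * (a' / a p.1) * v.1 * Q (‖p.2‖ ^ 2) * inner ℝ p.2 v.2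
          + (deriv Q (‖p.2‖ ^ 2) * inner ℝ p.2 v.2 ^ 2
            + (Q (‖p.2‖ ^ 2) - deriv F (‖p.2‖ ^ 2)) * inner ℝ v.2 v.2))
        / F (‖p.2‖ ^ 2) * inner ℝ m p.2 := by
  have hF := (h.pos (‖p.2‖ ^ 2) (sq_nonneg _)).ne'
  have hadd := h.add (‖p.2‖ ^ 2)
  have key : ∀ w : R3, F (‖p.2‖ ^ 2) * inner ℝ w z.2
      + Q (‖p.2‖ ^ 2) * inner ℝ p.2 z.2 * inner ℝ w p.2
      + 2 * (a' / a p.1) * v.1 * (F (‖p.2‖ ^ 2) * inner ℝ w v.2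
        + Q (‖p.2‖ ^ 2) * inner ℝ p.2 v.2 * inner ℝ w p.2)
      + 2 * deriv F (‖p.2‖ ^ 2) * inner ℝ p.2 v.2 * inner ℝ w v.2
      + (deriv Q (‖p.2‖ ^ 2) * inner ℝ p.2 v.2 ^ 2
          + (Q (‖p.2‖ ^ 2) - deriv F (‖p.2‖ ^ 2)) * inner ℝ v.2 v.2) * inner ℝ w p.2 = 0 := by
    intro w
    have h1 := hgeo (0, w)
    rw [h.geodesic_expr ha, h.spatialMetric_eq, h.spatialMetric_eq, h.spatialMetric_eq] at h1
    simp only [mul_zero, zero_add] at h1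
    rw [real_inner_comm w z.2, real_inner_comm w v.2, real_inner_comm w p.2] at h1
    have h2 : a p.1 ^ 2 ≠ 0 := pow_ne_zero 2 ha0
    refine (mul_eq_zero.1 (?_ : a p.1 ^ 2 * _ = 0)).resolve_left h2
    rw [← h1]
    field_simp
    ring
  -- Testing against the position itself gives `⟨X, z⟩` explicitly, since `F + r Q = 1`.
  -- Substituting it leaves only terms proportional to `⟨m, v⟩` or `⟨m, X⟩`.
  have hX := key p.2
  have hm := key m
  rw [real_inner_self_eq_norm_sq] at hX
  generalize ‖p.2‖ ^ 2 = r at *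
  have hκ : (inner ℝ p.2 z.2 : ℝ) = -(2 * (a' / a p.1) * v.1 * inner ℝ p.2 v.2
            + 2 * deriv F r * inner ℝ p.2 v.2 ^ 2
            + (deriv Q r * inner ℝ p.2 v.2 ^ 2
              + (Q r - deriv F r) * inner ℝ v.2 v.2) * r) := by
    linear_combination hX - (inner ℝ p.2 z.2 + 2 * (a' / a p.1) * v.1 * inner ℝ p.2 v.2) * hadd
  rw [← hκ]
  generalize a' / a p.1 = H at *
  field_simp
  linear_combination hm

end Radial

section GeodesicUniqueness

variable {a : ℝ → ℝ} {k : ℤ} {F Q : ℝ → ℝ}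

/-- A geodesic through the origin stays on the line of its initial velocity. -/
theorem IsRegular.geodesic_radial (ha : IsRegular a) (h : IsProfile k F Q) {γ γ' γ'' : ℝ → R4}
    (hgeo : ∀ s ∈ Icc (0 : ℝ) 1, γ s ∈ spacetime ∧
      HasDerivWithinAt γ (γ' s) (Icc 0 1) s ∧ HasDerivWithinAt γ' (γ'' s) (Icc 0 1) s ∧
      ∀ w, rwMetric k a (γ s) (γ'' s) w + christoffel (rwMetric k a) (γ s) (γ' s) (γ' s) w = 0)
    (h0 : (γ 0).2 = 0) {m : R3} (hm : inner ℝ m (γ' 0).2 = 0) :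
    ∀ s ∈ Icc (0 : ℝ) 1, inner ℝ m (γ s).2 = 0 ∧ inner ℝ m (γ' s).2 = 0 := by
  have hc : ContinuousOn γ (Icc 0 1) := fun s hs => (hgeo s hs).2.1.continuousWithinAt
  have hc' : ContinuousOn γ' (Icc 0 1) := fun s hs => (hgeo s hs).2.2.1.continuousWithinAt
  have ht : ContinuousOn (fun s => (γ s).1) (Icc 0 1) := continuous_fst.comp_continuousOn hc
  have hX : ContinuousOn (fun s => (γ s).2) (Icc 0 1) := continuous_snd.comp_continuousOn hc
  have ht' : ContinuousOn (fun s => (γ' s).1) (Icc 0 1) := continuous_fst.comp_continuousOn hc'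
  have hX' : ContinuousOn (fun s => (γ' s).2) (Icc 0 1) := continuous_snd.comp_continuousOn hc'
  have hpos : ∀ s ∈ Icc (0 : ℝ) 1, 0 < (γ s).1 := fun s hs => (hgeo s hs).1
  have hr : ContinuousOn (fun s => ‖(γ s).2‖ ^ 2) (Icc 0 1) := hX.norm.pow 2
  have hF : ContinuousOn (fun s => F (‖(γ s).2‖ ^ 2)) (Icc 0 1) :=
    h.smooth_left.continuous.comp_continuousOn hr
  have hQ : ContinuousOn (fun s => Q (‖(γ s).2‖ ^ 2)) (Icc 0 1) :=
    h.smooth_right.continuous.comp_continuousOn hr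
  have hF' : ContinuousOn (fun s => deriv F (‖(γ s).2‖ ^ 2)) (Icc 0 1) :=
    (h.smooth_left.continuous_deriv (by simp)).comp_continuousOn hr
  have hQ' : ContinuousOn (fun s => deriv Q (‖(γ s).2‖ ^ 2)) (Icc 0 1) :=
    (h.smooth_right.continuous_deriv (by simp)).comp_continuousOn hr
  have hF0 : ∀ s ∈ Icc (0 : ℝ) 1, F (‖(γ s).2‖ ^ 2) ≠ 0 :=
    fun s _ => (h.pos _ (sq_nonneg _)).ne'
  have hH : ContinuousOn (fun s => deriv a (γ s).1 / a (γ s).1) (Icc 0 1) := by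
    refine ContinuousOn.comp (g := fun t => deriv a t / a t) (t := Ioi 0) ?_ ht hpos
    exact fun t ht => ((ha.hasDerivAt_deriv ht).continuousAt.div
      (ha.hasDerivAt ht).continuousAt (ha.pos ht).ne').continuousWithinAt
  have hXX' : ContinuousOn (fun s => (inner ℝ (γ s).2 (γ' s).2 : ℝ)) (Icc 0 1) := hX.inner hX'
  have hX'X' : ContinuousOn (fun s => (inner ℝ (γ' s).2 (γ' s).2 : ℝ)) (Icc 0 1) := hX'.inner hX'
  have hcm : ∀ (c : ℝ → R4) (c' : R4) (s : ℝ), HasDerivWithinAt c c' (Icc 0 1) s →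
      HasDerivWithinAt (fun s => (inner ℝ m (c s).2 : ℝ)) (inner ℝ m c'.2) (Icc 0 1) s := by
    intro c c' s hs
    exact ((innerSL ℝ m).comp (ContinuousLinearMap.snd ℝ ℝ R3)).hasFDerivAt.comp_hasDerivWithinAt
      s hs
  -- Along the given curve the coefficients are known continuous functions of `s`, so the nonlinear
  -- system is a homogeneous linear equation for `⟨m, X⟩`.
  refine eq_zero_of_linear_ode ?_ ?_ (fun s hs => hcm γ _ s (hgeo s hs).2.1)
    (fun s hs => (hcm γ' _ s (hgeo s hs).2.2.1).congr_deriv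
      (h.acceleration_eq (ha.hasDerivAt (hpos s hs)) (ha.pos (hpos s hs)).ne'
        (hgeo s hs).2.2.2 m)) ?_ hm
  · exact (((((continuousOn_const.mul hH).mul ht').mul hF).add
      ((continuousOn_const.mul hF').mul hXX')).neg).div hF hF0
  · have hE : ContinuousOn (fun s => deriv Q (‖(γ s).2‖ ^ 2) * inner ℝ (γ s).2 (γ' s).2 ^ 2
        + (Q (‖(γ s).2‖ ^ 2) - deriv F (‖(γ s).2‖ ^ 2)) * inner ℝ (γ' s).2 (γ' s).2)
        (Icc 0 1) := (hQ'.mul (hXX'.pow 2)).add ((hQ.sub hF').mul hX'X')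
    exact ((((hQ.mul ((((((continuousOn_const.mul hH).mul ht').mul hXX').add
      ((continuousOn_const.mul hF').mul (hXX'.pow 2))).add (hE.mul hr)).neg)).add
      ((((continuousOn_const.mul hH).mul ht').mul hQ).mul hXX')).add hE).neg).div hF hF0
  · rw [h0, inner_zero_right]

theorem eq_smul_of_orthogonal {n X : R3} (hn : ‖n‖ = 1)
    (h : ∀ m : R3, inner ℝ m n = 0 → inner ℝ m X = 0) : X = (inner ℝ n X : ℝ) • n := by
  have hnn : (inner ℝ n n : ℝ) = 1 := by rw [real_inner_self_eq_norm_sq, hn]; norm_num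
  have h1 : inner ℝ (X - (inner ℝ n X : ℝ) • n) n = 0 := by
    rw [inner_sub_left, real_inner_smul_left, hnn, real_inner_comm]
    ring
  have h2 := h _ h1
  have h3 : inner ℝ (X - (inner ℝ n X : ℝ) • n) (X - (inner ℝ n X : ℝ) • n) = 0 := by
    rw [inner_sub_right, h2, real_inner_smul_right, h1]
    ring
  exact sub_eq_zero.1 (inner_self_eq_zero.1 h3)

/-- The proper distance along the slice of `τ` to the event at time `t`. -/
def rhoAt (a : ℝ → ℝ) (τ t : ℝ) : ℝ :=
  √(1 - (a t / a τ) ^ 2) * rhoRatio a (τ, √(1 - (a t / a τ) ^ 2) ^ 2)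

theorem IsRegular.hasDerivAt_rhoAt (ha : IsRegular a) {t τ : ℝ} (ht : 0 < t) (h : t < τ) :
    HasDerivAt (rhoAt a τ) (-(a t / a τ / √(1 - (a t / a τ) ^ 2))) t := by
  obtain ⟨h1, h2, h3, h4⟩ := ha.hasDerivAt_slope ht h
  have hτ := ht.trans h
  have hA := ha.pos hτ
  have h5 := HasDerivAt.comp t (ha.hasDerivAt_mul_rhoRatio hτ ⟨by linarith, h2⟩) h4
  refine h5.congr_deriv ?_
  rw [ha.rateFun_slope ht h.le]
  have hd := ha.deriv_ne_zero t ht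
  field_simp

theorem IsRegular.continuousOn_rhoAt (ha : IsRegular a) {t τ : ℝ} (hτ : 0 < τ) (ht : 0 < t) :
    ContinuousOn (rhoAt a τ) (Icc t τ) := by
  have hy : ContinuousOn (fun s => √(1 - (a s / a τ) ^ 2)) (Icc t τ) :=
    (continuousOn_const.sub (((ha.continuousOn_Ioi.mono fun s hs =>
      ht.trans_le hs.1).div_const _).pow 2)).sqrt
  refine ContinuousOn.comp (t := Ioo (-1) 1) (g := fun y => y * rhoRatio a (τ, y ^ 2))
    (fun y hy => (ha.hasDerivAt_mul_rhoRatio hτ hy).continuousAt.continuousWithinAt) hy ?_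
  intro s hs
  obtain ⟨h0, h1⟩ := ha.one_sub_ratio_sq (ht.trans_le hs.1) hs.2
  refine ⟨by linarith [Real.sqrt_nonneg (1 - (a s / a τ) ^ 2)], ?_⟩
  rwa [Real.sqrt_lt' one_pos, one_pow]

theorem IsRegular.rhoAt_self (ha : IsRegular a) {τ : ℝ} (hτ : 0 < τ) : rhoAt a τ τ = 0 := by
  simp [rhoAt, div_self (ha.pos hτ).ne']

/-! ### Integration of the radial motion by its first integrals -/

theorem hasDerivAt_of_unit {f : ℝ → ℝ} {f' s : ℝ} (hs : s ∈ Ioo (0 : ℝ) 1)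
    (h : HasDerivWithinAt f f' (Icc 0 1) s) : HasDerivAt f f' s :=
  h.hasDerivAt (Icc_mem_nhds hs.1 hs.2)

theorem strictAntiOn_unit {f f' : ℝ → ℝ}
    (h : ∀ s ∈ Icc (0 : ℝ) 1, HasDerivWithinAt f (f' s) (Icc 0 1) s)
    (hneg : ∀ s ∈ Ioo (0 : ℝ) 1, f' s < 0) : StrictAntiOn f (Icc 0 1) := by
  refine strictAntiOn_of_deriv_neg (convex_Icc 0 1) (fun s hs => (h s hs).continuousWithinAt) ?_
  rw [interior_Icc]
  intro s hs
  rw [(hasDerivAt_of_unit hs (h s (Ioo_subset_Icc_self hs))).deriv]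
  exact hneg s hs

theorem eq_of_hasDerivAt_eq {f g f' : ℝ → ℝ} (hf : ContinuousOn f (Icc 0 1))
    (hg : ContinuousOn g (Icc 0 1)) (hf' : ∀ s ∈ Ioo (0 : ℝ) 1, HasDerivAt f (f' s) s)
    (hg' : ∀ s ∈ Ioo (0 : ℝ) 1, HasDerivAt g (f' s) s) (h0 : f 0 = g 0) : f 1 = g 1 := by
  obtain ⟨c, -, hc⟩ := exists_hasDerivAt_eq_slope (fun s => f s - g s) (fun s => f' s - f' s)
    one_pos (hf.sub hg) fun s hs => (hf' s hs).fun_sub (hg' s hs)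
  simp only [sub_self, h0, sub_zero, div_one] at hc
  linarith

/-- The radial motion of a geodesic starting orthogonally to the worldline. -/
theorem IsRegular.radial_motion (ha : IsRegular a) {τ ρ : ℝ} (hτ : 0 < τ) (hρ : 0 ≤ ρ)
    {t t' t'' p p' p'' : ℝ → ℝ}
    (hpos : ∀ s ∈ Icc (0 : ℝ) 1, 0 < t s)
    (ht : ∀ s ∈ Icc (0 : ℝ) 1, HasDerivWithinAt t (t' s) (Icc 0 1) s)
    (ht' : ∀ s ∈ Icc (0 : ℝ) 1, HasDerivWithinAt t' (t'' s) (Icc 0 1) s)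
    (hp : ∀ s ∈ Icc (0 : ℝ) 1, HasDerivWithinAt p (p' s) (Icc 0 1) s)
    (hp' : ∀ s ∈ Icc (0 : ℝ) 1, HasDerivWithinAt p' (p'' s) (Icc 0 1) s)
    (e1 : ∀ s ∈ Icc (0 : ℝ) 1, t'' s + a (t s) * deriv a (t s) * p' s ^ 2 = 0)
    (e2 : ∀ s ∈ Icc (0 : ℝ) 1,
      a (t s) ^ 2 * p'' s + 2 * a (t s) * deriv a (t s) * t' s * p' s = 0)
    (ht0 : t 0 = τ) (ht0' : t' 0 = 0) (hp0 : p 0 = 0) (hp0' : p' 0 = (a τ)⁻¹ * ρ) :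
    t 1 ≤ τ ∧ rhoAt a τ (t 1) = ρ ∧ chiAt a τ (t 1) = p 1 := by
  have hA := ha.pos hτ
  have h01 : (0 : ℝ) ∈ Icc (0 : ℝ) 1 := by simp
  have h11 : (1 : ℝ) ∈ Icc (0 : ℝ) 1 := by simp
  have hat : ∀ s ∈ Icc (0 : ℝ) 1,
      HasDerivWithinAt (fun s => a (t s)) (deriv a (t s) * t' s) (Icc 0 1) s := fun s hs =>
    (ha.hasDerivAt (hpos s hs)).comp_hasDerivWithinAt s (ht s hs)
  have hmom : ∀ s ∈ Icc (0 : ℝ) 1, a (t s) ^ 2 * p' s = a τ * ρ := by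
    have := eq_of_hasDerivWithinAt_zero (f := fun s => a (t s) ^ 2 * p' s) fun s hs => by
      refine (((hat s hs).fun_pow 2).fun_mul (hp' s hs)).congr_deriv ?_
      simp only [Nat.cast_ofNat, Nat.reduceSub, pow_one]
      linear_combination e2 s hs
    intro s hs
    rw [this s hs, ht0, hp0']
    field_simp
  have hp'eq : ∀ s ∈ Icc (0 : ℝ) 1, p' s = a τ * ρ / a (t s) ^ 2 := by
    intro s hs
    rw [← hmom s hs, mul_div_cancel_left₀ _ (pow_ne_zero 2 (ha.pos (hpos s hs)).ne')]
  -- For `ρ = 0` the momentum vanishes and the geodesic is constant; the sign arguments of the other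
  -- case need `ρ > 0`.
  rcases hρ.eq_or_lt with rfl | hρ
  · have hp'0 : ∀ s ∈ Icc (0 : ℝ) 1, p' s = 0 := fun s hs => by rw [hp'eq s hs]; simp
    have hp1 := eq_of_hasDerivWithinAt_zero (f := p)
      (fun s hs => (hp s hs).congr_deriv (hp'0 s hs)) 1 h11
    have ht'0 := eq_of_hasDerivWithinAt_zero (f := t') fun s hs => by
      have := e1 s hs
      rw [hp'0 s hs, zero_pow two_ne_zero, mul_zero, add_zero] at this
      exact (ht' s hs).congr_deriv this
    have ht1 := eq_of_hasDerivWithinAt_zero (f := t)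
      (fun s hs => (ht s hs).congr_deriv ((ht'0 s hs).trans ht0')) 1 h11
    rw [ht1, ht0, hp1, hp0, ha.rhoAt_self hτ, ha.chiAt_self hτ]
    exact ⟨le_rfl, rfl, rfl⟩
  · have henergy : ∀ s ∈ Icc (0 : ℝ) 1,
        t' s ^ 2 = (a τ * ρ / a (t s)) ^ 2 - ρ ^ 2 := by
      have := eq_of_hasDerivWithinAt_zero
        (f := fun s => t' s ^ 2 - (a τ * ρ / a (t s)) ^ 2) fun s hs => by
        have h1 := (ha.pos (hpos s hs)).ne'
        refine (((ht' s hs).fun_pow 2).fun_sub (((hasDerivWithinAt_const s (Icc 0 1)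
          (a τ * ρ)).fun_div (hat s hs) h1).fun_pow 2)).congr_deriv ?_
        have h2 := e1 s hs
        rw [hp'eq s hs] at h2
        simp only [Nat.cast_ofNat, Nat.reduceSub, pow_one]
        field_simp at h2 ⊢
        linear_combination 2 * t' s * h2
      intro s hs
      have h1 := this s hs
      rw [ht0, ht0'] at h1
      have h2 : a τ * ρ / a τ = ρ := by field_simp
      rw [h2] at h1
      linarith
    -- The first integral is degenerate at the start, where `t' = 0`, and by itself would allow `t`
    -- to remain at `τ`. The sign of `t''` excludes this and selects the decreasing root.
    have hneg'' : ∀ s ∈ Icc (0 : ℝ) 1, t'' s < 0 := by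
      intro s hs
      have h1 := e1 s hs
      have h2 := ha.pos (hpos s hs)
      have h3 := ha.deriv_pos (hpos s hs)
      have h4 : 0 < p' s := by rw [hp'eq s hs]; positivity
      have : 0 < a (t s) * deriv a (t s) * p' s ^ 2 := by positivity
      linarith
    have hanti' := strictAntiOn_unit ht' fun s hs => hneg'' s (Ioo_subset_Icc_self hs)
    have hneg' : ∀ s ∈ Ioc (0 : ℝ) 1, t' s < 0 := by
      intro s hs
      have := hanti' h01 (Ioc_subset_Icc_self hs) hs.1
      rwa [ht0'] at this
    have hanti := strictAntiOn_unit ht fun s hs => hneg' s (Ioo_subset_Ioc_self hs)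
    have hlt : ∀ s ∈ Ioc (0 : ℝ) 1, t s < τ := by
      intro s hs
      have := hanti h01 (Ioc_subset_Icc_self hs) hs.1
      rwa [ht0] at this
    have hmaps : MapsTo t (Icc 0 1) (Icc (t 1) τ) := by
      intro s hs
      refine ⟨hanti.antitoneOn hs h11 hs.2, ?_⟩
      rw [← ht0]
      exact hanti.antitoneOn h01 hs hs.1
    have htc : ContinuousOn t (Icc 0 1) := fun s hs => (ht s hs).continuousWithinAt
    have hslope : ∀ s ∈ Ioo (0 : ℝ) 1,
        t' s = -(ρ * √(1 - (a (t s) / a τ) ^ 2) / (a (t s) / a τ)) := by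
      intro s hs
      have hs' := Ioo_subset_Icc_self hs
      obtain ⟨h1, -, h3, -⟩ := ha.hasDerivAt_slope (hpos s hs') (hlt s (Ioo_subset_Ioc_self hs))
      have h4 := ha.pos (hpos s hs')
      have h5 : t' s ^ 2 = (-(ρ * √(1 - (a (t s) / a τ) ^ 2) / (a (t s) / a τ))) ^ 2 := by
        rw [henergy s hs', neg_sq, div_pow (ρ * _), mul_pow ρ, h3]
        field_simp
      have h6 : -(ρ * √(1 - (a (t s) / a τ) ^ 2) / (a (t s) / a τ)) < 0 :=
        neg_lt_zero.2 (by positivity)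
      have h7 := hneg' s (Ioo_subset_Ioc_self hs)
      rcases sq_eq_sq_iff_eq_or_eq_neg.1 h5 with h | h
      · exact h
      · linarith
    -- Composed with `t`, the functions `rhoAt` and `chiAt` have derivatives `ρ` and `p'`, so
    -- comparing values at `s = 1` replaces an appeal to uniqueness for the radial system.
    refine ⟨(hlt 1 (by simp)).le, ?_, ?_⟩
    · have := eq_of_hasDerivAt_eq (f := fun s => rhoAt a τ (t s)) (g := fun s => s * ρ)
        (f' := fun _ => ρ) ((ha.continuousOn_rhoAt hτ (hpos 1 h11)).comp htc hmaps)
        (by fun_prop) (fun s hs => ?_) (fun s _ => by simpa using (hasDerivAt_id s).mul_const ρ)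
        (by simp [ht0, ha.rhoAt_self hτ])
      · simpa using this
      · have hs' := Ioo_subset_Icc_self hs
        have h1 := hlt s (Ioo_subset_Ioc_self hs)
        refine ((ha.hasDerivAt_rhoAt (hpos s hs') h1).comp s
          (hasDerivAt_of_unit hs (ht s hs'))).congr_deriv ?_
        obtain ⟨h2, -, -, -⟩ := ha.hasDerivAt_slope (hpos s hs') h1
        have h4 := ha.pos (hpos s hs')
        rw [hslope s hs]
        generalize √(1 - (a (t s) / a τ) ^ 2) = y at h2 ⊢
        field_simp
    · refine eq_of_hasDerivAt_eq (f := fun s => chiAt a τ (t s)) (g := p)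
        (f' := p') ((ha.continuousOn_chiAt hτ (hpos 1 h11)).comp htc hmaps)
        (fun s hs => (hp s hs).continuousWithinAt) (fun s hs => ?_)
        (fun s hs => hasDerivAt_of_unit hs (hp s (Ioo_subset_Icc_self hs)))
        (by simp [ht0, ha.chiAt_self hτ, hp0])
      have hs' := Ioo_subset_Icc_self hs
      have h1 := hlt s (Ioo_subset_Ioc_self hs)
      refine ((ha.hasDerivAt_chiAt (hpos s hs') h1).comp s
        (hasDerivAt_of_unit hs (ht s hs'))).congr_deriv ?_
      obtain ⟨h2, -, -, -⟩ := ha.hasDerivAt_slope (hpos s hs') h1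
      have h4 := ha.pos (hpos s hs')
      rw [hslope s hs, hp'eq s hs']
      generalize √(1 - (a (t s) / a τ) ^ 2) = y at h2 ⊢
      field_simp

/-- Every point reached by the exponential map orthogonally to the worldline lies in the chart,
with the expected coordinates. -/
theorem IsRegular.exists_aux_of_isExp (ha : IsRegular a) (hk : k = 0 ∨ k = -1) {τ : ℝ}
    (hτ : 0 < τ) {x : R3} {P : R4}
    (h : IsExp (rwMetric k a) spacetime (comoving τ)
      (∑ j : Fin 3, x j • fermiFrame a j.succ τ) P) :
    ∃ q ∈ auxDomain, auxToFermi a q = (τ, x) ∧ auxToCosmo a q = P := by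
  obtain ⟨F, Q, hFQ⟩ := exists_isProfile hk
  obtain ⟨γ, γ', γ'', hgeo, h0, h0', h1⟩ := h
  have hA := ha.pos hτ
  rw [ha.sum_fermiFrame hτ] at h0'
  obtain ⟨n, hn, hnx⟩ : ∃ n : R3, ‖n‖ = 1 ∧ x = ‖x‖ • n := by
    by_cases hx0 : x = 0
    · exact ⟨EuclideanSpace.single 0 1, by simp, by simp [hx0]⟩
    · refine ⟨‖x‖⁻¹ • x, norm_smul_inv_norm hx0, ?_⟩
      rw [smul_smul, mul_inv_cancel₀ (norm_ne_zero_iff.2 hx0), one_smul]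
  have hnn : (inner ℝ n n : ℝ) = 1 := by rw [real_inner_self_eq_norm_sq, hn]; norm_num
  have h0X : (γ 0).2 = 0 := by rw [h0]; rfl
  have hv0 : (γ' 0).2 = ((a τ)⁻¹ * ‖x‖) • n := by rw [h0', mul_smul, ← hnx]
  have hrad : ∀ m : R3, inner ℝ m n = 0 → ∀ s ∈ Icc (0 : ℝ) 1,
      inner ℝ m (γ s).2 = 0 ∧ inner ℝ m (γ' s).2 = 0 := fun m hm =>
    ha.geodesic_radial hFQ hgeo h0X (by rw [hv0, real_inner_smul_right, hm, mul_zero])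
  have hX : ∀ s ∈ Icc (0 : ℝ) 1, (γ s).2 = (inner ℝ n (γ s).2 : ℝ) • n := fun s hs =>
    eq_smul_of_orthogonal hn fun m hm => (hrad m hm s hs).1
  have hX' : ∀ s ∈ Icc (0 : ℝ) 1, (γ' s).2 = (inner ℝ n (γ' s).2 : ℝ) • n := fun s hs =>
    eq_smul_of_orthogonal hn fun m hm => (hrad m hm s hs).2
  have hX'' : ∀ s ∈ Icc (0 : ℝ) 1, (γ'' s).2 = (inner ℝ n (γ'' s).2 : ℝ) • n := fun s hs =>
    eq_smul_of_orthogonal hn fun m hm => by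
      rw [hFQ.acceleration_eq (ha.hasDerivAt (hgeo s hs).1) (ha.pos (hgeo s hs).1).ne'
        (hgeo s hs).2.2.2 m, (hrad m hm s hs).1, (hrad m hm s hs).2]
      ring
  have hfst : ∀ (c : ℝ → R4) (c' : R4) (s : ℝ), HasDerivWithinAt c c' (Icc 0 1) s →
      HasDerivWithinAt (fun s => (c s).1) c'.1 (Icc 0 1) s := fun c c' s hs =>
    (ContinuousLinearMap.fst ℝ ℝ R3).hasFDerivAt.comp_hasDerivWithinAt s hs
  have hsnd : ∀ (c : ℝ → R4) (c' : R4) (s : ℝ), HasDerivWithinAt c c' (Icc 0 1) s →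
      HasDerivWithinAt (fun s => (inner ℝ n (c s).2 : ℝ)) (inner ℝ n c'.2) (Icc 0 1) s :=
    fun c c' s hs =>
      ((innerSL ℝ n).comp (ContinuousLinearMap.snd ℝ ℝ R3)).hasFDerivAt.comp_hasDerivWithinAt s hs
  have hexpr : ∀ s ∈ Icc (0 : ℝ) 1, ∀ w : R4,
      -((γ'' s).1 + a (γ s).1 * deriv a (γ s).1 * inner ℝ n (γ' s).2 ^ 2) * w.1
      + (a (γ s).1 ^ 2 * inner ℝ n (γ'' s).2 + 2 * a (γ s).1 * deriv a (γ s).1 * (γ' s).1 *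
        inner ℝ n (γ' s).2) * inner ℝ n w.2 = 0 := by
    intro s hs w
    rw [← hFQ.geodesic_expr_radial (ha.hasDerivAt (hgeo s hs).1) hn (inner ℝ n (γ s).2),
      ← hX s hs, ← hX' s hs, ← hX'' s hs]
    exact (hgeo s hs).2.2.2 w
  -- The test vectors `(1, 0)` and `(0, n)` extract the two scalar equations.
  obtain ⟨hle, hρ, hχ⟩ := ha.radial_motion hτ (norm_nonneg x) (fun s hs => (hgeo s hs).1)
    (fun s hs => hfst γ _ s (hgeo s hs).2.1) (fun s hs => hfst γ' _ s (hgeo s hs).2.2.1)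
    (fun s hs => hsnd γ _ s (hgeo s hs).2.1) (fun s hs => hsnd γ' _ s (hgeo s hs).2.2.1)
    (fun s hs => by
      have := hexpr s hs (1, 0)
      simp only [mul_one, inner_zero_right, mul_zero, add_zero] at this
      linarith)
    (fun s hs => by
      have := hexpr s hs (0, n)
      simp only [mul_zero, zero_add, hnn, mul_one] at this
      exact this)
    (by rw [h0]; rfl) (by rw [h0']) (by rw [h0X, inner_zero_right])
    (by rw [hv0, real_inner_smul_right, hnn, mul_one])
  have h11 : (1 : ℝ) ∈ Icc (0 : ℝ) 1 := by simp
  have ht1 : 0 < (γ 1).1 := (hgeo 1 h11).1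
  obtain ⟨h2, h3⟩ := ha.one_sub_ratio_sq ht1 hle
  set y := √(1 - (a (γ 1).1 / a τ) ^ 2) with hy
  have hy0 : 0 ≤ y := Real.sqrt_nonneg _
  have hy2 : y ^ 2 = 1 - (a (γ 1).1 / a τ) ^ 2 := Real.sq_sqrt h2
  have hyn : ‖y • n‖ = y := by rw [norm_smul, hn, mul_one, Real.norm_of_nonneg hy0]
  refine ⟨(τ, y • n), ⟨hτ, ?_⟩, ?_, ?_⟩
  · simp only [hyn]
    exact (sq_lt_one_iff₀ hy0).1 (by rw [hy2]; exact h3)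
  · simp only [auxToFermi, auxParam, hyn]
    rw [smul_smul, mul_comm]
    change (τ, rhoAt a τ (γ 1).1 • n) = (τ, x)
    rw [hρ, ← hnx]
  · simp only [auxToCosmo, auxParam, hyn]
    rw [smul_smul, mul_comm]
    change (timeFun a (τ, y ^ 2), chiAt a τ (γ 1).1 • n) = P
    rw [hχ, ← hX 1 h11, ← h1]
    refine Prod.ext ?_ rfl
    simp only [timeFun, scaleArg, one_pow, one_mul, hy2, sub_sub_cancel]
    rw [Real.sqrt_sq (ha.ratio_mem ht1 hle).1.le, mul_div_cancel₀ _ hA.ne',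
      ha.scaleInv_apply ht1.le]

end GeodesicUniqueness

/-! ### The line element in Fermi coordinates -/

section LineElement

variable {a F Q : ℝ → ℝ} {k : ℤ}

theorem IsRegular.gTauTau_auxToFermi (ha : IsRegular a) {q : R4} (hq : q ∈ auxDomain) :
    gTauTau a q.1 ‖(auxToFermi a q).2‖ = -(deriv a q.1) ^ 2 *
      (rateFun a (auxParam q) + a q.1 * ‖q.2‖ ^ 2 * accRatio a (auxParam q)) ^ 2 := by
  have hy := norm_mem_Ico hq
  have h1 : 0 < 1 - ‖q.2‖ ^ 2 := sub_pos.2 (pow_lt_one₀ hy.1 hy.2 two_ne_zero)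
  have h2 : 0 < √(1 - ‖q.2‖ ^ 2) := Real.sqrt_pos.2 h1
  have h3 : √((1 - ‖q.2‖ ^ 2)⁻¹ - 1) = ‖q.2‖ / √(1 - ‖q.2‖ ^ 2) := by
    have : (1 - ‖q.2‖ ^ 2)⁻¹ - 1 = ‖q.2‖ ^ 2 / (1 - ‖q.2‖ ^ 2) := by field_simp; ring
    rw [this, Real.sqrt_div' _ h1.le, Real.sqrt_sq hy.1]
  have h4 : rateFun a (auxParam q) = deriv (scaleInv a) (a q.1 * √(1 - ‖q.2‖ ^ 2)) := by
    simp [rateFun, scaleArg, auxParam]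
  rw [gTauTau, ha.sigmaOf_auxToFermi hq]
  simp only [acc_substitution hy]
  rw [h3, Real.sqrt_inv, div_inv_eq_mul, ← h4]
  change _ = -(deriv a q.1) ^ 2 * (rateFun a (auxParam q) + a q.1 * ‖q.2‖ ^ 2 *
    accRatio a (q.1, ‖q.2‖ ^ 2)) ^ 2
  congr 3
  field_simp

/-- The bracket is the polarized Lagrange identity for `|X × dX|²`; it vanishes when one argument is
radial. -/
theorem fermiLineElement_eq (gtt l : ℝ) (X : R3) (u v : R4) :
    fermiLineElement gtt l X u v = gtt * (u.1 * v.1) + inner ℝ u.2 v.2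
      + l * (‖X‖ ^ 2 * inner ℝ u.2 v.2 - inner ℝ X u.2 * inner ℝ X v.2) := by
  rw [← real_inner_self_eq_norm_sq]
  simp only [fermiLineElement, PiLp.inner_apply, Fin.sum_univ_three, RCLike.inner_apply,
    conj_trivial]
  ring

/-- The difference of the angular coefficients of the metric and of the Euclidean metric, in terms
of the auxiliary parameters. -/
def angularDefect (a F : ℝ → ℝ) (x : ℝ × ℝ) : ℝ :=
  a x.1 ^ 2 * (1 - x.2) * chiRatio a x ^ 2 * F (x.2 * chiRatio a x ^ 2) - rhoRatio a x ^ 2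

theorem IsRegular.contDiffOn_angularDefect (ha : IsRegular a) (hFQ : IsProfile k F Q) {n : ℕ∞}
    (h : ContDiffOn ℝ (n + 2) a (Ioi 0)) :
    ContDiffOn ℝ (n + 1) (angularDefect a F) (paramDomain a) := by
  have hG := ha.contDiffOn_chiRatio h
  have hA : ContDiffOn ℝ (n + 1) (fun x : ℝ × ℝ => a x.1) (paramDomain a) :=
    contDiffOn_comp_fst (h.of_le (by gcongr; exact one_le_two))
  have hF : ContDiff ℝ (n + 1) F := hFQ.smooth_left.of_le (by exact_mod_cast le_top)
  exact ((((hA.pow 2).mul (contDiffOn_const.sub contDiffOn_snd)).mul (hG.pow 2)).mul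
    (hF.comp_contDiffOn (contDiffOn_snd.mul (hG.pow 2)))).sub ((ha.contDiffOn_rhoRatio h).pow 2)

/-- At `r = 0` one has `P = a/ȧ`, `G = 1/ȧ` and `F = 1`, so the two terms cancel. Division by `r` is
legitimate because of this. -/
theorem IsRegular.angularDefect_zero (ha : IsRegular a) (hFQ : IsProfile k F Q) {τ : ℝ}
    (hτ : 0 < τ) : angularDefect a F (τ, 0) = 0 := by
  have hx := ha.mem_paramDomain hτ le_rfl one_pos
  have h1 := ha.rhoRatio_add hx
  have h2 := ha.chiRatio_add hx
  simp only [mul_zero, zero_mul, add_zero, sub_zero, div_one] at h1 h2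
  simp only [angularDefect, zero_mul, hFQ.zero, h1, h2]
  ring

theorem IsRegular.mul_divSnd_angularDefect (ha : IsRegular a) (hFQ : IsProfile k F Q) {x : ℝ × ℝ}
    (hx : x ∈ paramDomain a) : x.2 * divSnd (angularDefect a F) x = angularDefect a F x := by
  rw [mul_divSnd ha.isOpen_paramDomain (fun x hx u hu => ha.paramDomain_star hx hu)
    (by simpa using ha.contDiffOn_angularDefect hFQ ha.contDiffOn_two) hx,
    ha.angularDefect_zero hFQ hx.1, sub_zero]

/-- The coefficient `λ_k` in terms of the auxiliary parameters. -/
def lambdaParam (a F : ℝ → ℝ) (x : ℝ × ℝ) : ℝ := divSnd (angularDefect a F) x / rhoRatio a x ^ 4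

/-- The coefficient `λ_k` as a function of `τ` and `ρ²`. -/
def lambdaFun (a F : ℝ → ℝ) (z : ℝ × ℝ) : ℝ :=
  lambdaParam a F (z.1, 1 - (sigmaOf a z.1 √z.2)⁻¹)

theorem IsRegular.contDiffOn_lambdaParam (ha : IsRegular a) (hFQ : IsProfile k F Q) {n : ℕ∞}
    (h : ContDiffOn ℝ (n + 2) a (Ioi 0)) :
    ContDiffOn ℝ n (lambdaParam a F) (paramDomain a) :=
  (contDiffOn_divSnd ha.isOpen_paramDomain (fun _ hx _ hu => ha.paramDomain_star hx hu)
    (ha.contDiffOn_angularDefect hFQ h)).div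
    (((ha.contDiffOn_rhoRatio h).of_le le_self_add).pow 4)
    fun _ hx => (pow_pos (ha.rhoRatio_pos hx) 4).ne'

theorem IsRegular.lambdaFun_sq (ha : IsRegular a) {τ y : ℝ} (hτ : 0 < τ)
    (hy : y ∈ Ico (0 : ℝ) 1) :
    lambdaFun a F (τ, (y * rhoRatio a (τ, y ^ 2)) ^ 2) = lambdaParam a F (τ, y ^ 2) := by
  have hP := ha.rhoRatio_pos (sq_mem_paramDomain ha hτ (Ico_subset_Ioo_neg_one hy))
  simp only [lambdaFun]
  rw [Real.sqrt_sq (mul_nonneg hy.1 hP.le), ha.sigmaOf_eq hτ hy, inv_inv, sub_sub_cancel]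

/-- The parameters `(τ, ρ²)` as a function of `(τ, r)`. -/
def sqParam (a : ℝ → ℝ) (x : ℝ × ℝ) : ℝ × ℝ := (x.1, x.2 * rhoRatio a x ^ 2)

theorem IsRegular.contDiffOn_sqParam (ha : IsRegular a) {n : ℕ∞}
    (h : ContDiffOn ℝ (n + 2) a (Ioi 0)) : ContDiffOn ℝ (n + 1) (sqParam a) (paramDomain a) :=
  contDiffOn_fst.prodMk (contDiffOn_snd.mul ((ha.contDiffOn_rhoRatio h).pow 2))

/-- The radial derivative is `∂_r (r P²) = P (P + 2 r ∂_r P) = P a b' > 0`, also at `r = 0`: `ρ²` is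
as good a parameter as `r`. -/
theorem IsRegular.sqParam_ker (ha : IsRegular a) {x : ℝ × ℝ} (hx : x ∈ paramDomain a) (v : ℝ × ℝ)
    (hv : fderiv ℝ (sqParam a) x v = 0) : v = 0 := by
  have hP := (ha.differentiableAt_rhoRatio hx).hasFDerivAt
  have hfst : HasFDerivAt (fun x : ℝ × ℝ => x.1) (ContinuousLinearMap.fst ℝ ℝ ℝ) x :=
    hasFDerivAt_fst
  have hsnd : HasFDerivAt (fun x : ℝ × ℝ => x.2) (ContinuousLinearMap.snd ℝ ℝ ℝ) x :=
    hasFDerivAt_snd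
  have h : HasFDerivAt (sqParam a) _ x := hfst.prodMk (hsnd.fun_mul (hP.pow 2))
  rw [h.fderiv, ContinuousLinearMap.prod_apply, Prod.mk_eq_zero] at hv
  obtain ⟨h1, h2⟩ := hv
  have h1 : v.1 = 0 := h1
  have h3 : v = v.2 • ((0 : ℝ), (1 : ℝ)) := Prod.ext (by simp [h1]) (by simp)
  have h4 : fderiv ℝ (rhoRatio a) x v = v.2 * fderiv ℝ (rhoRatio a) x (0, 1) := by
    conv_lhs => rw [h3, map_smul, smul_eq_mul]
  have h5 : v.2 * (rhoRatio a x * (a x.1 * rateFun a x)) = 0 := by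
    rw [← ha.rhoRatio_add hx]
    simp [h4] at h2
    linear_combination h2
  have h6 := mul_pos (ha.rhoRatio_pos hx) (mul_pos (ha.pos hx.1) (ha.rateFun_pos hx))
  exact Prod.ext h1 ((mul_eq_zero.1 h5).resolve_right h6.ne')

/-- In terms of `r` the coefficient is regular across `r = 0`; a local inverse of `sqParam`
transports this to `ρ²`. The class is `C^n`, not `C^(n+1)`, because of the Hadamard quotient. -/
theorem IsRegular.contDiffOn_lambdaFun (ha : IsRegular a) (hFQ : IsProfile k F Q) {n : ℕ∞}
    (h : ContDiffOn ℝ (n + 2) a (Ioi 0)) :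
    ContDiffOn ℝ n (lambdaFun a F) {q | 0 < q.1 ∧ 0 ≤ q.2 ∧ q.2 < radius a q.1 ^ 2} := by
  rintro ⟨τ, s⟩ ⟨hτ, hs0, hs1⟩
  obtain ⟨y, hy, hρ⟩ := ha.exists_mul_rhoRatio_eq hτ (Real.sqrt_nonneg s) (by
    have h0 := ha.mul_rhoRatio_lt_radius hτ (y := 0) (by simp)
    rw [zero_mul] at h0
    exact (Real.sqrt_lt' h0).2 hs1)
  have hx := sq_mem_paramDomain ha hτ (Ico_subset_Ioo_neg_one hy)
  have hs : sqParam a (τ, y ^ 2) = (τ, s) := by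
    simp only [sqParam]
    rw [← mul_pow, hρ, Real.sq_sqrt hs0]
  have hW := ha.isOpen_paramDomain.mem_nhds hx
  obtain ⟨g, hg, hg0, hgr, -, -⟩ := exists_contDiffAt_localInverse (n := n + 1) (by simp)
    ((ha.contDiffOn_sqParam h).contDiffAt hW) (fun v => ha.sqParam_ker hx v)
  rw [hs] at hg hg0 hgr
  have hgW : ∀ᶠ z in 𝓝 (τ, s), g z ∈ paramDomain a :=
    hg.continuousAt.eventually (by rw [hg0]; exact hW)
  have hcomp : ContDiffAt ℝ n (fun z => lambdaParam a F (g z)) (τ, s) := by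
    refine ContDiffAt.comp (g := lambdaParam a F) (τ, s) ?_ (hg.of_le le_self_add)
    rw [hg0]
    exact (ha.contDiffOn_lambdaParam hFQ h).contDiffAt hW
  -- The comparison with `lambdaFun` is made only for `s ≥ 0`, since its definition truncates
  -- negative `s` through the square root.
  refine hcomp.contDiffWithinAt.congr_of_eventuallyEq_of_mem ?_ ⟨hτ, hs0, hs1⟩
  filter_upwards [mem_nhdsWithin_of_mem_nhds (hgr.and hgW), self_mem_nhdsWithin] with z hz hzS
  obtain ⟨hz1, hz2⟩ := hz
  have hP := ha.rhoRatio_pos hz2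
  have e1 : (sqParam a (g z)).1 = z.1 := by rw [hz1]
  have e2 : (sqParam a (g z)).2 = z.2 := by rw [hz1]
  simp only [sqParam] at e1 e2
  have h0 : 0 ≤ (g z).2 := by
    have := hzS.2.1
    rw [← e2] at this
    exact nonneg_of_mul_nonneg_left this (pow_pos hP 2)
  have hy' : √(g z).2 ∈ Ico (0 : ℝ) 1 :=
    ⟨Real.sqrt_nonneg _, (Real.sqrt_lt' one_pos).2 (by simpa using hz2.2.1)⟩
  have h3 := ha.lambdaFun_sq (F := F) hz2.1 hy'
  rw [Real.sq_sqrt h0, mul_pow, Real.sq_sqrt h0, Prod.mk.eta, e2, e1, Prod.mk.eta] at h3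
  exact h3

theorem IsRegular.lambdaFun_spec (ha : IsRegular a) (hFQ : IsProfile k F Q) {τ ρ : ℝ}
    (hτ : 0 < τ) (h0 : 0 ≤ ρ) (h1 : ρ < radius a τ) :
    ρ ^ 4 * lambdaFun a F (τ, ρ ^ 2) =
      a τ ^ 2 / sigmaOf a τ ρ * Sk k (chiOf a τ (sigmaOf a τ ρ)) ^ 2 - ρ ^ 2 := by
  obtain ⟨y, hy, rfl⟩ := ha.exists_mul_rhoRatio_eq hτ h0 h1
  have hx := sq_mem_paramDomain ha hτ (Ico_subset_Ioo_neg_one hy)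
  have hP := (ha.rhoRatio_pos hx).ne'
  have h2 := ha.mul_divSnd_angularDefect hFQ hx
  rw [ha.lambdaFun_sq hτ hy, ha.sigmaOf_eq hτ hy, chiOf_substitution hy, hFQ.sq, lambdaParam]
  simp only [angularDefect] at h2
  rw [mul_pow y, mul_pow y, mul_pow y, div_inv_eq_mul]
  field_simp
  linear_combination y ^ 2 * h2

/-- The metric in Fermi coordinates. -/
theorem IsRegular.rwMetric_fermiPoint (ha : IsRegular a) (hFQ : IsProfile k F Q) {p : R4}
    (hp : p ∈ fermiRange a) (u v : R4) :
    rwMetric k a (fermiPoint a p) (fderiv ℝ (fermiPoint a) p u) (fderiv ℝ (fermiPoint a) p v) =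
      fermiLineElement (gTauTau a p.1 ‖p.2‖) (lambdaFun a F (p.1, ‖p.2‖ ^ 2)) p.2 u v := by
  rw [← ha.image_auxToFermi] at hp
  obtain ⟨q, hq, rfl⟩ := hp
  obtain ⟨w, rfl⟩ := ha.fderiv_auxToFermi_surjective hq u
  obtain ⟨w', rfl⟩ := ha.fderiv_auxToFermi_surjective hq v
  have hx := ha.auxParam_mem hq
  have hr1 : 0 < 1 - ‖q.2‖ ^ 2 := sub_pos.2 hx.2.1
  have hP := ha.rhoRatio_pos hx
  have hG := ha.chiRatio_pos hx
  have hs := Real.sqrt_pos.2 hr1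
  have hs2 := Real.sq_sqrt hr1.le
  have r1 := ha.rhoRatio_add hx
  have r2 := ha.chiRatio_add hx
  have r3 := hFQ.add (‖q.2‖ ^ 2 * chiRatio a (auxParam q) ^ 2)
  have r4 := ha.mul_divSnd_angularDefect hFQ hx
  have hlam : lambdaFun a F (q.1, ‖(auxToFermi a q).2‖ ^ 2) * rhoRatio a (auxParam q) ^ 4 =
      divSnd (angularDefect a F) (auxParam q) := by
    rw [norm_auxToFermi ha hq, ha.lambdaFun_sq hq.1 (norm_mem_Ico hq)]
    exact div_mul_cancel₀ _ (pow_pos hP 4).ne'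
  rw [ha.fderiv_fermiPoint_aux hq, ha.fderiv_fermiPoint_aux hq, ha.fermiPoint_auxToFermi hq,
    fermiLineElement_eq]
  change _ = gTauTau a q.1 ‖(auxToFermi a q).2‖ * _ + _ +
    lambdaFun a F (q.1, ‖(auxToFermi a q).2‖ ^ 2) * _
  rw [ha.gTauTau_auxToFermi hq]
  generalize lambdaFun a F (q.1, ‖(auxToFermi a q).2‖ ^ 2) = l at hlam ⊢
  rw [ha.fderiv_auxToFermi hq, ha.fderiv_auxToFermi hq, ha.fderiv_auxToCosmo hq,
    ha.fderiv_auxToCosmo hq, rwMetric, hFQ.spatialMetric_eq]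
  simp only [auxToFermi, auxToCosmo, (ha.aux_time hq).2.2.1, norm_smul, inner_add_left,
    inner_add_right, real_inner_smul_left, real_inner_smul_right, Real.norm_eq_abs, mul_pow,
    sq_abs, hs2]
  simp only [angularDefect, ← hlam] at r4
  rw [real_inner_comm q.2 w.2, real_inner_self_eq_norm_sq q.2]
  change _ + 2 * ‖q.2‖ ^ 2 * _ = a q.1 * _ at r1
  change _ + 2 * ‖q.2‖ ^ 2 * _ = _ / (1 - ‖q.2‖ ^ 2) at r2
  change ‖q.2‖ ^ 2 * _ = a q.1 ^ 2 * (1 - ‖q.2‖ ^ 2) * _ * F (‖q.2‖ ^ 2 * _) - _ at r4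
  rw [mul_comm (chiRatio a (auxParam q) ^ 2) (‖q.2‖ ^ 2)]
  -- The origin is separate because the eliminations below divide by `r`.
  rcases eq_or_ne q.2 0 with h0 | h0
  · rw [h0] at r1 r2 ⊢
    simp only [norm_zero, inner_zero_left, ne_eq, OfNat.ofNat_ne_zero, not_false_eq_true,
      zero_pow, mul_zero, zero_mul, add_zero, sub_zero, div_one, Real.sqrt_one] at r1 r2 ⊢
    rw [hFQ.zero, r2, r1]
    ring
  · have hr : ‖q.2‖ ^ 2 ≠ 0 := pow_ne_zero 2 (norm_ne_zero_iff.2 h0)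
    generalize ‖q.2‖ ^ 2 = r at *
    generalize fderiv ℝ (rhoRatio a) (auxParam q) (0, 1) = P' at *
    generalize fderiv ℝ (chiRatio a) (auxParam q) (0, 1) = G' at *
    generalize F (r * chiRatio a (auxParam q) ^ 2) = f at *
    generalize Q (r * chiRatio a (auxParam q) ^ 2) = g at *
    generalize rhoRatio a (auxParam q) = P at *
    generalize chiRatio a (auxParam q) = G at *
    generalize rateFun a (auxParam q) = β at *
    generalize accRatio a (auxParam q) = K at *
    generalize √(1 - r) = s at *
    generalize inner ℝ q.2 w.2 = i at *
    generalize inner ℝ q.2 w'.2 = i' at *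
    have htime : β * (deriv a q.1 * s * w.1 - a q.1 / s * i) *
        (β * (deriv a q.1 * s * w'.1 - a q.1 / s * i')) =
        β ^ 2 * (deriv a q.1 ^ 2 * (1 - r) * (w.1 * w'.1)
          - a q.1 * deriv a q.1 * (w.1 * i' + w'.1 * i) + a q.1 ^ 2 / (1 - r) * (i * i')) := by
      rw [← hs2]
      field_simp
      ring
    -- Solving the four relations for `∂_r P`, `∂_r G`, `Q` and `λ` leaves a rational identity in
    -- the remaining quantities.
    have eP : P' = (a q.1 * β - P) / (2 * r) := by rw [← r1]; field_simp; ring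
    have eG : G' = (β / (1 - r) - G) / (2 * r) := by rw [← r2]; field_simp; ring
    have eg : g = (1 - f) / (r * G ^ 2) := by rw [← r3]; field_simp; ring
    have el : l = (a q.1 ^ 2 * (1 - r) * G ^ 2 * f - P ^ 2) / (r * P ^ 4) := by
      rw [← r4]; field_simp
    rw [htime, eP, eG, eg, el]
    field_simp
    ring

end LineElement

/-! ### The maximal Fermi chart -/

theorem IsRegular.isFermiChart {a : ℝ → ℝ} (ha : IsRegular a) {k : ℤ} (hk : k = 0 ∨ k = -1)
    {n : ℕ∞} (h : ContDiffOn ℝ (n + 2) a (Ioi 0)) :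
    IsFermiChart (n + 1) (rwMetric k a) spacetime (Ioi 0) comoving (fermiFrame a)
      (fermiDomain a) (fermiCoord a) where
  subset := by
    rw [ha.fermiDomain_eq]
    rintro _ ⟨q, hq, rfl⟩
    exact (ha.aux_time hq).1
  isOpen := ha.isOpen_fermiDomain
  isOpen_image := by
    rw [ha.fermiCoord_image]
    exact ha.isOpen_fermiRange
  contDiffOn := ha.contDiffOn_fermiCoord h
  contDiffOn_inverse := by
    refine ⟨fermiPoint a, ?_, ?_⟩
    · rw [ha.fermiCoord_image]
      exact ha.contDiffOn_fermiPoint h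
    · rw [ha.fermiDomain_eq]
      rintro _ ⟨q, hq, rfl⟩
      rw [ha.fermiCoord_auxToCosmo hq, ha.fermiPoint_auxToFermi hq]
  along := by
    intro τ hτ
    have hq := zero_mem_auxDomain hτ
    have h0 := ha.auxToCosmo_zero hτ
    refine ⟨?_, ?_⟩
    · rw [ha.fermiDomain_eq]
      exact ⟨_, hq, h0⟩
    · have h1 := ha.fermiCoord_auxToCosmo hq
      rwa [h0, auxToFermi_zero] at h1
  exp_eq := by
    rw [ha.fermiDomain_eq]
    rintro _ ⟨q, hq, rfl⟩
    rw [ha.fermiCoord_auxToCosmo hq]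
    exact ⟨hq.1, ha.isExp_aux hk hq⟩

/-- Only the exponential condition of the competing chart matters: it forces each of its points to
be an auxiliary point with the same coordinates, whatever the regularity of that chart. -/
theorem IsRegular.isMaximalFermiChart {a : ℝ → ℝ} (ha : IsRegular a) {k : ℤ}
    (hk : k = 0 ∨ k = -1) {n : ℕ∞} (h : ContDiffOn ℝ (n + 2) a (Ioi 0)) :
    IsMaximalFermiChart (n + 1) (rwMetric k a) spacetime (Ioi 0) comoving (fermiFrame a)
      (fermiDomain a) (fermiCoord a) := by
  refine ⟨ha.isFermiChart hk h, fun U' φ' hU => ?_⟩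
  have key : ∀ p ∈ U', ∃ q ∈ auxDomain, auxToFermi a q = φ' p ∧ auxToCosmo a q = p :=
    fun p hp => ha.exists_aux_of_isExp hk (hU.exp_eq p hp).1 (hU.exp_eq p hp).2
  refine ⟨fun p hp => ?_, fun p hp => ?_⟩
  · obtain ⟨q, hq, -, rfl⟩ := key p hp
    rw [ha.fermiDomain_eq]
    exact mem_image_of_mem _ hq
  · obtain ⟨q, hq, h1, h2⟩ := key p hp
    rw [← h1, ← h2, ha.fermiCoord_auxToCosmo hq]

end RWFermi

end

theorem theorem4 (k : ℤ) (hk : k = 0 ∨ k = -1) (a : ℝ → ℝ) (ha : RWFermi.IsRegular a) :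
    -- the coordinate functions are well defined: a point has at most one set of coordinates
    Set.InjOn (RWFermi.fermiPoint a) (RWFermi.fermiRange a) ∧
    -- the coordinate frame is a parallel tetrad along the observer's worldline
    RWFermi.IsParallelTetrad (RWFermi.rwMetric k a) (Set.Ioi 0) RWFermi.comoving
      (RWFermi.fermiFrame a) ∧
    -- maximal Fermi chart, of class `C^(n+1)` whenever `a` is of class `C^(n+2)`;
    -- regularity of `a` gives `n = 0`, a smooth `a` gives `n = ∞`
    (∀ n : ℕ∞, ContDiffOn ℝ (n + 2) a (Set.Ioi 0) →
      RWFermi.IsMaximalFermiChart (n + 1) (RWFermi.rwMetric k a) RWFermi.spacetime (Set.Ioi 0)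
        RWFermi.comoving (RWFermi.fermiFrame a) (RWFermi.fermiDomain a)
        (RWFermi.fermiCoord a)) ∧
    -- the domain is the region inside the event horizon
    RWFermi.fermiDomain a =
      {p | p ∈ RWFermi.spacetime ∧ ENNReal.ofReal ‖p.2‖ < RWFermi.chiHoriz a p.1} ∧
    -- if there is no event horizon, the chart is global
    ((∃ t₀, 0 < t₀ ∧ RWFermi.chiHoriz a t₀ = ⊤) →
      RWFermi.fermiDomain a = RWFermi.spacetime) ∧
    -- the line element in Fermi coordinates; `Λ (τ, ρ ^ 2)` is `λ_k(τ, ρ)`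
    ∃ Λ : ℝ × ℝ → ℝ,
      (∀ n : ℕ∞, ContDiffOn ℝ (n + 2) a (Set.Ioi 0) →
        ContDiffOn ℝ n Λ {q | 0 < q.1 ∧ 0 ≤ q.2 ∧ q.2 < RWFermi.radius a q.1 ^ 2}) ∧
      (∀ τ ρ : ℝ, 0 < τ → 0 ≤ ρ → ρ < RWFermi.radius a τ →
        ρ ^ 4 * Λ (τ, ρ ^ 2) =
          a τ ^ 2 / RWFermi.sigmaOf a τ ρ *
            RWFermi.Sk k (RWFermi.chiOf a τ (RWFermi.sigmaOf a τ ρ)) ^ 2 - ρ ^ 2) ∧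
      (∀ q ∈ RWFermi.fermiRange a, ∀ u v : RWFermi.R4,
        RWFermi.rwMetric k a (RWFermi.fermiPoint a q)
            (fderiv ℝ (RWFermi.fermiPoint a) q u) (fderiv ℝ (RWFermi.fermiPoint a) q v) =
          RWFermi.fermiLineElement (RWFermi.gTauTau a q.1 ‖q.2‖) (Λ (q.1, ‖q.2‖ ^ 2)) q.2 u v) := by
  obtain ⟨F, Q, hFQ⟩ := RWFermi.exists_isProfile hk
  exact ⟨ha.injOn_fermiPoint, ha.isParallelTetrad hk, fun n h => ha.isMaximalFermiChart hk h,
    ha.fermiDomain_eq_horizon, fun h => ha.fermiDomain_eq_spacetime h, RWFermi.lambdaFun a F,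
    fun n h => ha.contDiffOn_lambdaFun hFQ h, fun τ ρ hτ h0 h1 => ha.lambdaFun_spec hFQ hτ h0 h1,
    fun q hq u v => ha.rwMetric_fermiPoint hFQ hq u v⟩
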